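/- **Theorem (concentration of the ridged discriminant direction).** Fix sample sizes $n_1,n_2$, put $n=n_1+n_2$, and let the dimension $p\to\infty$. *Data.* For each $p$ let $X_{kj}\in\mathbb R^p$ ($k=1,2$, $1\le j\le n_k$) be independent; for each $k$ the $X_{kj}$ have a common absolutely continuous law on $\mathbb R^p$ with mean $\mu_{(k)}$ and covariance matrix $\Sigma_{(k)}=\sum_{i=1}^p\lambda_{(k),i}u_{(k),i}u_{(k),i}^\top$, where $u_{(k),1},\dots,u_{(k),p}$ is an orthonormal basis. Put $\mu=\mu_{(1)}-\mu_{(2)}$ and write $\mathrm{Angle}(x,y)=\arccos\frac{x^\top y}{\|x\|\|y\|}$ and, for a subspace $V$ with orthogonal projection $P_V$, $\mathrm{Angle}(x,V)=\mathrm{Angle}(x,P_Vx)$. *Assumptions.* 1. $p^{-1/2}\|\mu\|\to\delta$ for some $\delta>0$. 2. There are integers $m_k\ge1$, numbers $\beta_k\in[0,1]$ and $\sigma_{(k),i}^2,\tau_{(k),i}^2>0$, not depending on $p$, with $\lambda_{(k),i}=\sigma_{(k),i}^2p^{\beta_k}+\tau_{(k),i}^2$ for $i\le m_k$ and $\lambda_{(k),i}=\tau_{(k),i}^2$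 for $m_k<i\le p$; the $\tau_{(k),i}^2$ are uniformly bounded and $p^{-1}\sum_{i\le p}\tau_{(k),i}^2\to\tau_k^2>0$. 3. For each $k,j$ there is an infinite random sequence, not depending on $p$, whose first $p$ terms are the scores $\lambda_{(k),i}^{-1/2}u_{(k),i}^\top(X_{kj}-\mu_{(k)})$, $1\le i\le p$. These sequences have uniformly bounded fourth moments, and each is, after some permutation of its indices, $\rho$-mixing: $\sup_j\sup|\mathrm{Corr}(f,g)|\to0$ as $l\to\infty$, the inner supremum being over square-integrable $f,g$ measurable with respect to the terms of index $\le j$ and of index $\ge j+l$, respectively. 4. $\mathrm{Angle}(u_{(k),i},\mu)\to\theta_{(k),i}\in[0,\pi/2]$ for $i\le m_k$, $k=1,2$. 5. Let $\mathcal U$ be the span of all $u_{(k),i}$ with $\beta_k=1$ and $i\le m_k$. Its dimension is a constant $m$ (for all large $p$), and it has an orthonormal basis $u_1,\dots,u_m$ (depending on $p$) with $\mathrm{Angle}(u_i,\mu)\to\theta_i\in[0,\pi/2]$. If $\beta_1=\beta_2=1$, then moreover the matrices $R_{(k)}^{(p)}=(u_a^\top u_{(k),i})_{a\le m,\,i\le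 m_k}$ converge to matrices $R_{(k)}$ with orthonormal columns such that $[R_{(1)}\ R_{(2)}]$ has rank $m$. Assume also $m_k<n_k$ for $k=1,2$ and, without loss of generality, $\tau_1^2\ge\tau_2^2$. *Sample quantities.* Let $\bar X_k$ and $\bar X$ be the class means and the total mean, $d=\bar X_1-\bar X_2$, $S_W=\sum_{k,j}(X_{kj}-\bar X_k)(X_{kj}-\bar X_k)^\top$ and $S_B=\sum_kn_k(\bar X_k-\bar X)(\bar X_k-\bar X)^\top$. Let $S_W=\sum_{i=1}^p\hat\lambda_i\hat u_i\hat u_i^\top$ be an eigen-decomposition with $\hat\lambda_1\ge\dots\ge\hat\lambda_p$ (so $\hat\lambda_i=0$ for $i>n-2$). Let $w_{\mathrm{MDP}}$ be a maximal data piling direction, that is, a maximizer of $w^\top S_Bw$ over unit vectors $w$ with $w^\top S_Ww=0$. For $\alpha\in\mathbb R$ put $\alpha_p=\alpha p$ and let $w_\alpha$ be the unit vector positively proportional to $$\sum_{i=1}^{n-2}\frac{\alpha_p}{\hat\lambda_i+\alpha_p}\,\hat u_i\hat u_i^\top d+\sum_{i=n-1}^{p}\hat u_i\hat u_i^\top d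 ,$$ which equals $\alpha_p(S_W+\alpha_pI_p)^{-1}d$ when $\alpha\neq0$ and the inverse exists. We say that $w_\alpha$ is defined if, for all large $p$, almost surely $\hat\lambda_i+\alpha_p\ne0$ for $1\le i\le n-2$. *Signal subspace.* Let $\mathcal S=\mathrm{span}(\{\hat u_i\}_{i\in\mathcal D}\cup\{w_{\mathrm{MDP}}\})$ where - $\mathcal D=\emptyset$ if $\beta_1,\beta_2<1$; - if $\beta_1=\beta_2=1$: $\mathcal D=\{1,\dots,m\}$ if $\tau_1^2=\tau_2^2$; $\mathcal D=\{1,\dots,m_1\}\cup\{n_1,\dots,n_1+m_2-1\}$ if $\tau_1^2>\tau_2^2$ and $m=m_1$; $\mathcal D=\{1,\dots,m_1+m_2\}\cup\{n_1,\dots,n_1+m_2-1\}$ if $\tau_1^2>\tau_2^2$ and $m>m_1$; - $\mathcal D=\{1,\dots,m_1\}$ if $\beta_1=1>\beta_2$; - if $\beta_1<1=\beta_2$: $\mathcal D=\{1,\dots,m_2\}$ if $\tau_1^2=\tau_2^2$, and $\mathcal D=\{1,\dots,m_2\}\cup\{n_1,\dots,n_1+m_2-1\}$ if $\tau_1^2>\tau_2^2$.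 *Conclusion.* For every $\alpha\in\mathbb R\setminus\{-\tau_1^2,-\tau_2^2\}$ for which $w_\alpha$ is defined, $\mathrm{Angle}(w_\alpha,\mathcal S)\to0$ in probability as $p\to\infty$. -/

import Mathlib

open MeasureTheory ProbabilityTheory Filter Topology
open scoped ENNReal

namespace RidgePiling

/-- `ℝ^p` with the Euclidean inner product. -/
abbrev Vec (p : ℕ) := EuclideanSpace ℝ (Fin p)

/-! ### The `ρ`-mixing condition -/

section Mixing

variable {Ω : Type*} {mΩ : MeasurableSpace Ω}

/-- The correlation of two real random variables (`0` if one of the variances vanishes). -/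
noncomputable def corr (P : Measure Ω) (f g : Ω → ℝ) : ℝ :=
  cov[f, g; P] / (√(Var[f; P]) * √(Var[g; P]))

/-- The maximal correlation `ρ(A, B)` of two sub-`σ`-fields: the supremum of `|Corr(f, g)|` over
square-integrable `f`, `g` that are measurable with respect to `A` and `B`. -/
noncomputable def maxCorr (P : Measure Ω) (A B : MeasurableSpace Ω) : ℝ≥0∞ :=
  ⨆ (f : Ω → ℝ) (g : Ω → ℝ) (_ : Measurable[A] f) (_ : Measurable[B] g)
    (_ : MemLp f 2 P) (_ : MemLp g 2 P), ENNReal.ofReal |corr P f g|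

/-- The `ρ`-mixing coefficient at lag `l` of the sequence `Z 0, Z 1, …`. -/
noncomputable def rhoCoeff (P : Measure Ω) (Z : ℕ → Ω → ℝ) (l : ℕ) : ℝ≥0∞ :=
  ⨆ j : ℕ, maxCorr P
    (⨆ (i : ℕ) (_ : i ≤ j), MeasurableSpace.comap (Z i) inferInstance)
    (⨆ (i : ℕ) (_ : j + l ≤ i), MeasurableSpace.comap (Z i) inferInstance)

def IsRhoMixing (P : Measure Ω) (Z : ℕ → Ω → ℝ) : Prop :=
  Tendsto (rhoCoeff P Z) atTop (𝓝 0)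

end Mixing

/-! ### Sample quantities. The two classes are indexed by `0, 1 : Fin 2`, and `x k j` is the
`j`th observation of class `k`. -/

section Sample

variable {p : ℕ} {n : Fin 2 → ℕ}

/-- The sample mean of class `k`. -/
noncomputable def classMean (x : (k : Fin 2) → Fin (n k) → Vec p) (k : Fin 2) : Vec p :=
  (n k : ℝ)⁻¹ • ∑ j, x k j

/-- The sample mean of all observations. -/
noncomputable def totalMean (x : (k : Fin 2) → Fin (n k) → Vec p) : Vec p :=
  ((n 0 + n 1 : ℕ) : ℝ)⁻¹ • ∑ k, ∑ j, x k j

/-- The sample mean difference `d`. -/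
noncomputable def meanDiff (x : (k : Fin 2) → Fin (n k) → Vec p) : Vec p :=
  classMean x 0 - classMean x 1

/-- The rank one matrix `v vᵀ`. -/
def outer (v : Vec p) : Matrix (Fin p) (Fin p) ℝ := Matrix.of fun a b => v a * v b

/-- The within-class scatter matrix `S_W`. -/
noncomputable def withinScatter (x : (k : Fin 2) → Fin (n k) → Vec p) :
    Matrix (Fin p) (Fin p) ℝ :=
  ∑ k, ∑ j, outer (x k j - classMean x k)

/-- The between-class scatter matrix `S_B`. -/
noncomputable def betweenScatter (x : (k : Fin 2) → Fin (n k) → Vec p) :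
    Matrix (Fin p) (Fin p) ℝ :=
  ∑ k, (n k : ℝ) • outer (classMean x k - totalMean x)

/-- The quadratic form `vᵀ M v`. -/
noncomputable def quadForm (M : Matrix (Fin p) (Fin p) ℝ) (v : Vec p) : ℝ :=
  inner ℝ v (Matrix.toEuclideanLin M v)

/-- `w` is a maximal data piling direction: a unit vector which maximizes `wᵀ S_B w` among the
unit vectors with `wᵀ S_W w = 0`. -/
def IsMaximalDataPiling (x : (k : Fin 2) → Fin (n k) → Vec p) (w : Vec p) : Prop :=
  ‖w‖ = 1 ∧ quadForm (withinScatter x) w = 0 ∧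
    ∀ v : Vec p, ‖v‖ = 1 → quadForm (withinScatter x) v = 0 →
      quadForm (betweenScatter x) v ≤ quadForm (betweenScatter x) w

/-- `M = U Diag(lam) Uᵀ` with `U = [u 0, u 1, …]` orthogonal and `lam` in descending order. -/
def IsEigenDecomposition (M : Matrix (Fin p) (Fin p) ℝ) (lam : Fin p → ℝ) (u : Fin p → Vec p) :
    Prop :=
  Orthonormal ℝ u ∧ Antitone lam ∧ ∀ i, Matrix.toEuclideanLin M (u i) = lam i • u i

/-- No denominator `lam i + α p`, `i < N - 2`, in the ridged discriminant vector vanishes; here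
`N` is the total sample size. -/
def RidgeDefined (N : ℕ) (α : ℝ) (lam : Fin p → ℝ) : Prop :=
  ∀ i : Fin p, (i : ℕ) < N - 2 → lam i + α * p ≠ 0

/-- The unnormalized ridged discriminant vector
`∑_{i < N - 2} α_p / (lam i + α_p) ⟪u i, d⟫ u i + ∑_{i ≥ N - 2} ⟪u i, d⟫ u i` with `α_p = α p`,
where `lam`, `u` is an eigen-decomposition of `S_W`, so that `lam i = 0` for `i ≥ N - 2`. -/
noncomputable def ridgeVector (N : ℕ) (α : ℝ) (lam : Fin p → ℝ) (u : Fin p → Vec p) (d : Vec p) :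
    Vec p :=
  ∑ i : Fin p, ((if (i : ℕ) < N - 2 then α * p / (lam i + α * p) else 1) * inner ℝ (u i) d) • u i

/-- The ridged linear discriminant vector `w_α`, of norm `1`. -/
noncomputable def ridgeDirection (N : ℕ) (α : ℝ) (lam : Fin p → ℝ) (u : Fin p → Vec p)
    (d : Vec p) : Vec p :=
  ‖ridgeVector N α lam u d‖⁻¹ • ridgeVector N α lam u d

/-- For `α ≠ 0` the ridge vector is `α_p (S_W + α_p I)⁻¹ d`, with `α_p = α p`. -/
theorem ridgeVector_spec {M : Matrix (Fin p) (Fin p) ℝ} {lam : Fin p → ℝ} {u : Fin p → Vec p}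
    (h : IsEigenDecomposition M lam u) (N : ℕ) (hlam : ∀ i : Fin p, N - 2 ≤ (i : ℕ) → lam i = 0)
    (α : ℝ) (hdef : RidgeDefined N α lam) (d : Vec p) :
    Matrix.toEuclideanLin M (ridgeVector N α lam u d) + (α * p) • ridgeVector N α lam u d
      = (α * p) • d := by
  have hd : ∑ i, inner ℝ (u i) d • u i = d := by
    have hsp : ⊤ ≤ Submodule.span ℝ (Set.range u) := by
      rw [h.1.linearIndependent.span_eq_top_of_card_eq_finrank' (by simp)]
    have := (OrthonormalBasis.mk h.1 hsp).sum_repr' d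
    simpa using this
  conv_rhs => rw [← hd]
  unfold ridgeVector
  rw [map_sum, Finset.smul_sum, Finset.smul_sum, ← Finset.sum_add_distrib]
  refine Finset.sum_congr rfl fun i _ => ?_
  rw [map_smul, h.2.2 i, smul_smul, smul_smul, smul_smul, ← add_smul]
  congr 1
  by_cases hi : (i : ℕ) < N - 2
  · have := hdef i hi
    rw [if_pos hi]
    field_simp
  · rw [if_neg hi, hlam i (by omega)]
    ring

/-- The signal subspace: the span of the sample eigenvectors with (one-based) index in `D` and of
the maximal data piling direction `w`. -/
def signalSubspace (D : Set ℕ) (u : Fin p → Vec p) (w : Vec p) : Submodule ℝ (Vec p) :=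
  Submodule.span ℝ ({v | ∃ i : Fin p, (i : ℕ) + 1 ∈ D ∧ u i = v} ∪ {w})

/-- The angle between a vector and a subspace: the angle between the vector and its orthogonal
projection. -/
noncomputable def angleToSubspace (w : Vec p) (V : Submodule ℝ (Vec p)) : ℝ :=
  InnerProductGeometry.angle w (V.starProjection w)

end Sample

/-- The index set `D`, one-based, for `tail 0 ≥ tail 1`. Here `dimU` is the dimension of the
common leading eigenspace, and `β k ≤ 1`. -/
noncomputable def signalIndices (n m : Fin 2 → ℕ) (β tail : Fin 2 → ℝ) (dimU : ℕ) : Set ℕ :=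
  open Classical in
  if β 0 = 1 ∧ β 1 = 1 then
    if tail 0 = tail 1 then Set.Icc 1 dimU
    else if dimU = m 0 then Set.Icc 1 (m 0) ∪ Set.Icc (n 0) (n 0 + m 1 - 1)
    else Set.Icc 1 (m 0 + m 1) ∪ Set.Icc (n 0) (n 0 + m 1 - 1)
  else if β 0 = 1 then Set.Icc 1 (m 0)
  else if β 1 = 1 then
    if tail 0 = tail 1 then Set.Icc 1 (m 1)
    else Set.Icc 1 (m 1) ∪ Set.Icc (n 0) (n 0 + m 1 - 1)
  else ∅

/-! ### The population model. For each dimension `p` and class `k`, `mu p k` and `Sig p k` are the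
population mean and covariance, and `lam p k i`, `u p k i` (zero-based `i < p`) are the
eigenvalues and eigenvectors of `Sig p k`. Values at `i ≥ p` are irrelevant. -/

section Population

variable {Ω : Type*} {mΩ : MeasurableSpace Ω}

/-- The training data in dimension `p`: independent observations; those of class `k` share an
absolutely continuous law on `ℝ^p` with mean `mu k` and covariance matrix `Sig k`. -/
structure IsTrainingSample (P : Measure Ω) {n : Fin 2 → ℕ} {p : ℕ}
    (X : (k : Fin 2) → Fin (n k) → Ω → Vec p) (mu : Fin 2 → Vec p)
    (Sig : Fin 2 → Matrix (Fin p) (Fin p) ℝ) : Prop where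
  measurable : ∀ k j, Measurable (X k j)
  indep : iIndepFun (fun (q : (k : Fin 2) × Fin (n k)) => X q.1 q.2) P
  ident : ∀ k j j', IdentDistrib (X k j) (X k j') P P
  absCont : ∀ k j, P.map (X k j) ≪ volume
  sqIntegrable : ∀ k j, MemLp (X k j) 2 P
  mean : ∀ k j, ∫ ω, X k j ω ∂P = mu k
  covariance : ∀ k j a b, cov[fun ω => X k j ω a, fun ω => X k j ω b; P] = Sig k a b

/-- `Sig = U Diag(lam) Uᵀ` with `U = [u 0, …, u (p - 1)]` orthogonal. -/
def IsPopulationEigen {p : ℕ} (Sig : Matrix (Fin p) (Fin p) ℝ) (lam : ℕ → ℝ) (u : ℕ → Vec p) :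
    Prop :=
  Orthonormal ℝ (fun i : Fin p => u i) ∧
    ∀ i : Fin p, Matrix.toEuclideanLin Sig (u i) = lam i • u i

/-- The population mean difference in dimension `p`. -/
noncomputable def muDiff (mu : ∀ p : ℕ, Fin 2 → Vec p) (p : ℕ) : Vec p := mu p 0 - mu p 1

/-- `p^{-1/2} ‖μ‖ → δ` with `δ > 0`. -/
def MeanDifferenceScale (mu : ∀ p : ℕ, Fin 2 → Vec p) (δ : ℝ) : Prop :=
  0 < δ ∧ Tendsto (fun p : ℕ => ‖muDiff mu p‖ / √(p : ℝ)) atTop (𝓝 δ)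

/-- The generalized heterogeneous spiked covariance model; `sigSq k i`, `tauSq k i`, `tail k`
are `σ_{(k),i}²`, `τ_{(k),i}²`, `τ_k²`. -/
structure SpikedEigenvalues (m : Fin 2 → ℕ) (β : Fin 2 → ℝ) (sigSq tauSq : Fin 2 → ℕ → ℝ)
    (tail : Fin 2 → ℝ) (lam : ∀ _p : ℕ, Fin 2 → ℕ → ℝ) : Prop where
  m_pos : ∀ k, 1 ≤ m k
  beta_mem : ∀ k, β k ∈ Set.Icc (0 : ℝ) 1
  sigSq_pos : ∀ k i, i < m k → 0 < sigSq k i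
  tauSq_pos : ∀ k i, 0 < tauSq k i
  spike : ∀ p k i, i < p → i < m k → lam p k i = sigSq k i * (p : ℝ) ^ β k + tauSq k i
  nonspike : ∀ p k i, i < p → m k ≤ i → lam p k i = tauSq k i
  tauSq_bdd : ∃ C, ∀ k i, tauSq k i ≤ C
  tail_pos : ∀ k, 0 < tail k
  tauSq_avg : ∀ k, Tendsto (fun p : ℕ => (∑ i ∈ Finset.range p, tauSq k i) / p) atTop
    (𝓝 (tail k))

/-- The true principal component scores `lam_i^{-1/2} ⟪u_i, X_{kj} - μ_{(k)}⟫`, `i < p`, are the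
first `p` elements of an infinite sequence `z k j`, which does not depend on `p`, is `ρ`-mixing
under some permutation, and has uniformly bounded fourth moments. -/
structure MixingScores (P : Measure Ω) {n : Fin 2 → ℕ}
    (X : ∀ p : ℕ, (k : Fin 2) → Fin (n k) → Ω → Vec p) (mu : ∀ p : ℕ, Fin 2 → Vec p)
    (lam : ∀ _p : ℕ, Fin 2 → ℕ → ℝ) (u : ∀ p : ℕ, Fin 2 → ℕ → Vec p)
    (z : (k : Fin 2) → Fin (n k) → ℕ → Ω → ℝ) : Prop where
  score : ∀ p k j i ω, i < p →
    (√(lam p k i))⁻¹ * inner ℝ (u p k i) (X p k j ω - mu p k) = z k j i ω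
  fourth_moment : ∃ C, ∀ k j i,
    Integrable (fun ω => z k j i ω ^ 4) P ∧ ∫ ω, z k j i ω ^ 4 ∂P ≤ C
  mixing : ∀ k j, ∃ perm : Equiv.Perm ℕ, IsRhoMixing P (fun i => z k j (perm i))

/-- The leading eigenvectors have limiting angles in `[0, π/2]` with `μ`. -/
def LeadingAngles (m : Fin 2 → ℕ) (mu : ∀ p : ℕ, Fin 2 → Vec p)
    (u : ∀ p : ℕ, Fin 2 → ℕ → Vec p) : Prop :=
  ∀ k i, i < m k → ∃ θ ∈ Set.Icc 0 (Real.pi / 2),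
    Tendsto (fun p => InnerProductGeometry.angle (u p k i) (muDiff mu p)) atTop (𝓝 θ)

/-- The common leading eigenspace: the span of the leading eigenspaces of those classes `k` that
have `β k = 1`. -/
def commonLeadingSpace (m : Fin 2 → ℕ) (β : Fin 2 → ℝ) {p : ℕ} (u : Fin 2 → ℕ → Vec p) :
    Submodule ℝ (Vec p) :=
  Submodule.span ℝ {v | ∃ k i, β k = 1 ∧ i < m k ∧ u k i = v}

/-- The common leading eigenspace has the fixed dimension `dimU` (for all large `p`), and an
orthonormal basis whose elements have limiting angles in `[0, π/2]` with `μ`. If both classes have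
strong spikes, the coordinate matrices `R_{(k)}^{(p)}` of the leading eigenvectors in this basis
converge to matrices `R k` with orthonormal columns, and `[R 0, R 1]` has rank `dimU`. -/
def CommonLeadingBasis (m : Fin 2 → ℕ) (β : Fin 2 → ℝ) (dimU : ℕ)
    (mu : ∀ p : ℕ, Fin 2 → Vec p) (u : ∀ p : ℕ, Fin 2 → ℕ → Vec p) : Prop :=
  ∃ e : ∀ p : ℕ, Fin dimU → Vec p,
    (∀ᶠ p in atTop, Orthonormal ℝ (e p) ∧
      Submodule.span ℝ (Set.range (e p)) = commonLeadingSpace m β (u p)) ∧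
    (∀ a, ∃ θ ∈ Set.Icc 0 (Real.pi / 2),
      Tendsto (fun p => InnerProductGeometry.angle (e p a) (muDiff mu p)) atTop (𝓝 θ)) ∧
    (β 0 = 1 → β 1 = 1 → ∃ R : (k : Fin 2) → Matrix (Fin dimU) (Fin (m k)) ℝ,
      (∀ k a (i : Fin (m k)), Tendsto (fun p => inner ℝ (e p a) (u p k i)) atTop (𝓝 (R k a i))) ∧
      (∀ k, (R k).transpose * R k = 1) ∧
      (Matrix.fromCols (R 0) (R 1)).rank = dimU)

end Population

end RidgePiling

/-! After division by √p, the nonzero spectrum of `S_W / p` is that of the Gram matrix of the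
class-centred observations, whose size is fixed as p grows. Once this Gram matrix has a limit, the
rest is finite-dimensional perturbation theory for a fixed sample point.

The limit of the Gram matrix. The noise splits into the strong spikes (`β k = 1`), which lie in the
common leading space of dimension `dimU`, and the bulk, all of whose eigenvalues are o(p). A
weighted law of large numbers for ρ-mixing sequences makes the squared norms of the bulk vectors
converge to `tail k`. Since the scores are uncorrelated and the observations independent, the bulk
vectors become orthogonal to each other, to the leading space and to the mean difference. On
class-centred coefficients the limit therefore acts as GᵀG + diag(tail), where G holds the limiting
leading coordinates (`IsSpikedModel.hasGramLimit`). Convergence in probability may be tested along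
subsequences, on which these limits hold almost surely and the coordinates of the spikes converge by
compactness.

Eigenvalues. The functionals that define G are few, so min-max and dimension counts show that the
eigenvalues with index outside `signalIndices` tend to `tail 0` or `tail 1`.

Eigenvectors. Such a sample eigenvector is a combination of the observations whose coefficients
almost solve (GᵀG + diag(tail))v = tv with t = `tail 0` or `tail 1`. If every exact solution has Gv
= 0 (`IsPureAt`), the eigenvector has almost no component in the leading space. Apart from that
space d is asymptotically orthogonal to the centred observations, so the eigenvector is almost
orthogonal to d (`eventually_abs_inner_le`). As α ≠ -t, the ridge factor stays bounded, and these
terms of the ridge vector vanish. Purity is automatic at `tail 1`, the smallest diagonal entry. At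
`tail 0` it holds for almost every sample: multiplying class 1 by a factor s > 0 destroys purity for
only finitely many s (`finite_not_isPureAt_scaleOne`), and the law of the data is absolutely
continuous.

Conclusion. What remains of the ridge vector are its components along the signal eigenvectors and
the projection of d to the kernel of `S_W`. The latter is a multiple of the maximal data piling
direction (`nullPart_mem_span`), and its scaled norm stays away from 0 because the bulk noise of the
class means contributes to d outside the leading space (`exists_le_norm_nullPart`). The discarded
part is thus small relative to the whole vector, and so is the angle. -/

namespace RidgePiling

/-! ### Min-max bounds for scatter operators in terms of Gram forms. -/

section Gram

variable {ι : Type*} [Fintype ι] {p : ℕ} {F : Type*} [AddCommGroup F] [Module ℝ F]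
  [FiniteDimensional ℝ F]

/-- `lam`, `u` is an eigen-decomposition, in descending order, of the scatter operator
`x ↦ ∑ q, ⟪y q, x⟫ y q`. -/
def IsScatterEigen (y : ι → Vec p) (lam : Fin p → ℝ) (u : Fin p → Vec p) : Prop :=
  Orthonormal ℝ u ∧ Antitone lam ∧ ∀ i, ∑ q, inner ℝ (y q) (u i) • y q = lam i • u i

theorem sum_inner_smul_of_orthonormal {u : Fin p → Vec p} (hu : Orthonormal ℝ u) (x : Vec p) :
    ∑ i, inner ℝ (u i) x • u i = x := by
  have hsp : ⊤ ≤ Submodule.span ℝ (Set.range u) := by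
    rw [hu.linearIndependent.span_eq_top_of_card_eq_finrank' (by simp)]
  simpa using (OrthonormalBasis.mk hu hsp).sum_repr' x

theorem sum_inner_mul_inner_of_orthonormal {u : Fin p → Vec p} (hu : Orthonormal ℝ u)
    (x z : Vec p) : ∑ i, inner ℝ (u i) x * inner ℝ (u i) z = inner ℝ x z := by
  conv_rhs => rw [← sum_inner_smul_of_orthonormal hu x, sum_inner]
  simp [real_inner_smul_left]

theorem norm_sq_eq_sum_of_orthonormal {u : Fin p → Vec p} (hu : Orthonormal ℝ u) (x : Vec p) :
    ‖x‖ ^ 2 = ∑ i, inner ℝ (u i) x ^ 2 := by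
  rw [← real_inner_self_eq_norm_sq, ← sum_inner_mul_inner_of_orthonormal hu]
  simp [sq]

namespace IsScatterEigen

variable {y : ι → Vec p} {lam : Fin p → ℝ} {u : Fin p → Vec p}

theorem sum_mul_inner (h : IsScatterEigen y lam u) (i : Fin p) (x : Vec p) :
    ∑ q, inner ℝ (y q) (u i) * inner ℝ (y q) x = lam i * inner ℝ (u i) x := by
  have := congrArg (fun v => inner ℝ v x) (h.2.2 i)
  simpa [sum_inner, real_inner_smul_left] using this

theorem sum_mul_inner_self (h : IsScatterEigen y lam u) (i j : Fin p) :
    ∑ q, inner ℝ (y q) (u i) * inner ℝ (y q) (u j) = if i = j then lam i else 0 := by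
  rw [h.sum_mul_inner, orthonormal_iff_ite.1 h.1]
  split_ifs <;> simp

theorem nonneg (h : IsScatterEigen y lam u) (i : Fin p) : 0 ≤ lam i := by
  have := h.sum_mul_inner_self i i
  rw [if_pos rfl] at this
  rw [← this]
  exact Finset.sum_nonneg fun q _ => mul_self_nonneg _

theorem inner_eq_zero (h : IsScatterEigen y lam u) {i : Fin p} (hi : lam i = 0) (q : ι) :
    inner ℝ (y q) (u i) = 0 := by
  have := h.sum_mul_inner_self i i
  rw [if_pos rfl, hi, Finset.sum_eq_zero_iff_of_nonneg fun q _ => mul_self_nonneg _] at this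
  simpa using this q

theorem sum_inner_sq (h : IsScatterEigen y lam u) (x : Vec p) :
    ∑ q, inner ℝ (y q) x ^ 2 = ∑ i, lam i * inner ℝ (u i) x ^ 2 := by
  have h1 : ∀ q, inner ℝ (y q) x ^ 2
      = ∑ i, inner ℝ (u i) x * (inner ℝ (y q) (u i) * inner ℝ (y q) x) := by
    intro q
    rw [sq]
    nth_rewrite 1 [← sum_inner_mul_inner_of_orthonormal h.1 (y q) x]
    rw [Finset.sum_mul]
    refine Finset.sum_congr rfl fun i _ => ?_
    rw [real_inner_comm (y q)]
    ring
  simp_rw [h1]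
  rw [Finset.sum_comm]
  refine Finset.sum_congr rfl fun i _ => ?_
  rw [← Finset.mul_sum, h.sum_mul_inner]
  ring

/-- Lower bound for a sample eigenvalue by the Gram form on a subspace of small codimension. -/
theorem exists_gram_le (h : IsScatterEigen y lam u) (i : Fin p) (Ψ : (ι → ℝ) →ₗ[ℝ] F)
    (hF : Module.finrank ℝ F + i < Fintype.card ι) :
    ∃ a : ι → ℝ, a ≠ 0 ∧ Ψ a = 0 ∧ ‖∑ q, a q • y q‖ ^ 2 ≤ lam i * ∑ q, a q ^ 2 := by
  classical
  -- Besides `Ψ a = 0`, the combination `∑ a q • y q` is made orthogonal to the `i` leading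
  -- eigenvectors; the dimension count leaves a nonzero `a`.
  let Φ : (ι → ℝ) →ₗ[ℝ] F × (Fin i → ℝ) := Ψ.prod
    (LinearMap.pi fun j => ∑ q, (inner ℝ (u ⟨j, j.2.trans i.2⟩) (y q)) • LinearMap.proj q)
  have hker : LinearMap.ker Φ ≠ ⊥ := by
    apply LinearMap.ker_ne_bot_of_finrank_lt
    simpa using hF
  obtain ⟨a, ha, ha0⟩ := Submodule.exists_mem_ne_zero_of_ne_bot hker
  have ha' : Ψ a = 0 ∧ ∀ j : Fin i, ∑ q, inner ℝ (u ⟨j, j.2.trans i.2⟩) (y q) * a q = 0 := by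
    have := LinearMap.mem_ker.1 ha
    simp only [Φ, LinearMap.prod_apply, Prod.mk_eq_zero, Function.prod_apply] at this
    refine ⟨this.1, fun j => ?_⟩
    simpa using congrFun this.2 j
  refine ⟨a, ha0, ha'.1, ?_⟩
  set x := ∑ q, a q • y q with hx
  have hxj : ∀ j : Fin p, j < i → inner ℝ (u j) x = 0 := by
    intro j hj
    rw [hx, inner_sum, ← ha'.2 ⟨j, hj⟩]
    exact Finset.sum_congr rfl fun q _ => by rw [real_inner_smul_right, mul_comm]
  have h1 : ∑ q, inner ℝ (y q) x ^ 2 ≤ lam i * ‖x‖ ^ 2 := by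
    rw [h.sum_inner_sq, norm_sq_eq_sum_of_orthonormal h.1, Finset.mul_sum]
    refine Finset.sum_le_sum fun j _ => ?_
    rcases lt_or_ge j i with hj | hj
    · simp [hxj j hj]
    · exact mul_le_mul_of_nonneg_right (h.2.1 hj) (sq_nonneg _)
  have h2 : ‖x‖ ^ 2 = ∑ q, a q * inner ℝ (y q) x := by
    rw [← real_inner_self_eq_norm_sq]
    nth_rewrite 1 [hx]
    simp [sum_inner, real_inner_smul_left]
  -- Cauchy-Schwarz for `‖x‖² = ∑ a q ⟪y q, x⟫` turns the bound on the scatter form at `x` into one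
  -- on the Gram form at `a`.
  have h3 : (‖x‖ ^ 2) ^ 2 ≤ (∑ q, a q ^ 2) * ∑ q, inner ℝ (y q) x ^ 2 := by
    rw [h2]; exact Finset.sum_mul_sq_le_sq_mul_sq _ _ _
  have h4 : 0 ≤ ∑ q, a q ^ 2 := Finset.sum_nonneg fun q _ => sq_nonneg _
  rcases (sq_nonneg ‖x‖).eq_or_lt with h0 | h0
  · rw [← h0]; exact mul_nonneg (h.nonneg i) h4
  · refine le_of_mul_le_mul_right ?_ h0
    nlinarith [mul_le_mul_of_nonneg_left h1 h4]

/-- Upper bound for a sample eigenvalue by the Gram form on a subspace of large dimension. -/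
theorem exists_le_gram (h : IsScatterEigen y lam u) (i : Fin p) (Ψ : (ι → ℝ) →ₗ[ℝ] F)
    (hF : Module.finrank ℝ F ≤ i) :
    ∃ x : Vec p, x ≠ 0 ∧ Ψ (fun q => inner ℝ (y q) x) = 0 ∧
      lam i * ‖x‖ ^ 2 ≤ ∑ q, inner ℝ (y q) x ^ 2 ∧
      lam i * ∑ q, inner ℝ (y q) x ^ 2 ≤ ‖∑ q, inner ℝ (y q) x • y q‖ ^ 2 := by
  classical
  -- `x` is sought in the span of the first `i + 1` eigenvectors. There both forms are diagonal,
  -- with entries `lam j` and `lam j ^ 2`, and `lam j ≥ lam i`.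
  let E : (Fin (i + 1) → ℝ) →ₗ[ℝ] Vec p :=
    ∑ j : Fin (i + 1), (LinearMap.proj j).smulRight (u ⟨j, by omega⟩)
  let Y : Vec p →ₗ[ℝ] (ι → ℝ) := LinearMap.pi fun q => innerₗ (Vec p) (y q)
  have hker : LinearMap.ker (Ψ ∘ₗ Y ∘ₗ E) ≠ ⊥ := by
    apply LinearMap.ker_ne_bot_of_finrank_lt
    simp only [Module.finrank_fintype_fun_eq_card, Fintype.card_fin]
    omega
  obtain ⟨c, hc, hc0⟩ := Submodule.exists_mem_ne_zero_of_ne_bot hker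
  have hE : E c = ∑ j : Fin (i + 1), c j • u ⟨j, by omega⟩ := by simp [E]
  have hin : ∀ l : Fin p, inner ℝ (u l) (E c)
      = if hl : (l : ℕ) < i + 1 then c ⟨l, hl⟩ else 0 := by
    intro l
    rw [hE, inner_sum]
    simp_rw [real_inner_smul_right, orthonormal_iff_ite.1 h.1]
    split_ifs with hl
    · rw [Finset.sum_eq_single ⟨l, hl⟩]
      · simp
      · intro b _ hb
        rw [if_neg, mul_zero]
        intro hlb
        exact hb (by ext; simp [hlb])
      · simp
    · refine Finset.sum_eq_zero fun b _ => ?_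
      rw [if_neg, mul_zero]
      intro hlb
      rw [hlb] at hl
      exact hl b.2
  have hin' : ∀ l : Fin p, i < l → inner ℝ (u l) (E c) = 0 := by
    intro l hl
    rw [hin, dif_neg]
    have : (i : ℕ) < l := hl
    omega
  refine ⟨E c, ?_, ?_, ?_, ?_⟩
  · intro h0
    apply hc0
    ext j
    have := hin ⟨j, by omega⟩
    rw [h0, inner_zero_right, dif_pos j.2] at this
    simpa using this.symm
  · exact LinearMap.mem_ker.1 hc
  · rw [h.sum_inner_sq, norm_sq_eq_sum_of_orthonormal h.1, Finset.mul_sum]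
    refine Finset.sum_le_sum fun j _ => ?_
    rcases lt_or_ge i j with hj | hj
    · simp [hin' j hj]
    · exact mul_le_mul_of_nonneg_right (h.2.1 hj) (sq_nonneg _)
  · rw [h.sum_inner_sq, norm_sq_eq_sum_of_orthonormal h.1, Finset.mul_sum]
    refine Finset.sum_le_sum fun j _ => ?_
    rw [inner_sum]
    have : ∑ q, inner ℝ (u j) (inner ℝ (y q) (E c) • y q) = lam j * inner ℝ (u j) (E c) := by
      rw [← h.sum_mul_inner]
      refine Finset.sum_congr rfl fun q _ => ?_
      rw [real_inner_smul_right, real_inner_comm (u j)]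
      ring
    rw [this]
    rcases lt_or_ge i j with hj | hj
    · simp [hin' j hj]
    · have h1 := h.2.1 hj
      have h2 := h.nonneg j
      have h3 : lam i * lam j ≤ lam j * lam j := mul_le_mul_of_nonneg_right h1 h2
      nlinarith [mul_le_mul_of_nonneg_right h3 (sq_nonneg (inner ℝ (u j) (E c)))]

end IsScatterEigen

end Gram

/-! ### The limiting Gram matrix and its perturbation bounds. -/

section Limit

/-- The index set of the observations. -/
abbrev Idx (n : Fin 2 → ℕ) := (k : Fin 2) × Fin (n k)

variable {n : Fin 2 → ℕ}

def IsClassCentred (a : Idx n → ℝ) : Prop := ∀ k, ∑ j, a ⟨k, j⟩ = 0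

/-- The limiting Gram matrix of the class-centred noise outside the leading eigenspaces. -/
noncomputable def tailGram (tail : Fin 2 → ℝ) (q r : Idx n) : ℝ :=
  if q.1 = r.1 then tail q.1 * ((if q = r then 1 else 0) - (n q.1 : ℝ)⁻¹) else 0

/-- Each diagonal block is `tail k` times the centring projection, which fixes class-centred
vectors. -/
theorem sum_tailGram_mul (tail : Fin 2 → ℝ) {a : Idx n → ℝ} (ha : IsClassCentred a)
    (q : Idx n) : ∑ r, tailGram tail q r * a r = tail q.1 * a q := by
  obtain ⟨k, j⟩ := q
  rw [Fintype.sum_sigma, Finset.sum_eq_single k]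
  · simp only [tailGram, if_true, Sigma.mk.injEq, heq_eq_eq, true_and, mul_assoc, sub_mul]
    rw [← Finset.mul_sum, Finset.sum_sub_distrib, ← Finset.mul_sum, ha k]
    simp
  · intro l _ hl
    refine Finset.sum_eq_zero fun j' _ => ?_
    simp [tailGram, Ne.symm hl]
  · simp

/-- The class-centred and rescaled observations `y s q`, with mean difference `d s`, have a limiting
Gram matrix. Here `e s` is an orthonormal basis of the common leading eigenspace and `G` is the
limit of the coordinates of the observations in this basis. -/
structure HasGramLimit (tail : Fin 2 → ℝ) {M : ℕ} {N : ℕ → ℕ} (y : ∀ s, Idx n → Vec (N s))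
    (e : ∀ s, Fin M → Vec (N s)) (d : ∀ s, Vec (N s)) (G : Fin M → Idx n → ℝ) : Prop where
  orthonormal : ∀ᶠ s in atTop, Orthonormal ℝ (e s)
  centred : ∀ s k, ∑ j, y s ⟨k, j⟩ = 0
  coord : ∀ a q, Tendsto (fun s => inner ℝ (e s a) (y s q)) atTop (𝓝 (G a q))
  gram : ∀ q r, Tendsto (fun s => inner ℝ (y s q) (y s r)) atTop
    (𝓝 (∑ a, G a q * G a r + tailGram tail q r))
  cross : ∀ q, Tendsto (fun s => inner ℝ (d s) (y s q)
    - ∑ a, inner ℝ (e s a) (d s) * inner ℝ (e s a) (y s q)) atTop (𝓝 0)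
  bdd : ∃ B, ∀ᶠ s in atTop, ‖d s‖ ≤ B
  resid : ∃ c > 0, ∀ᶠ s in atTop, c ≤ ‖d s‖ ^ 2 - ∑ a, inner ℝ (e s a) (d s) ^ 2

theorem isClassCentred_inner {p : ℕ} {y : Idx n → Vec p} (hy : ∀ k, ∑ j, y ⟨k, j⟩ = 0)
    (x : Vec p) : IsClassCentred fun q => inner ℝ (y q) x := by
  intro k
  rw [← sum_inner, hy k, inner_zero_left]

/-- The limit of the Gram form on class-centred coefficients. -/
def limitForm (tail : Fin 2 → ℝ) {M : ℕ} (G : Fin M → Idx n → ℝ) (a : Idx n → ℝ) : ℝ :=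
  ∑ b, (∑ q, G b q * a q) ^ 2 + ∑ q, tail q.1 * a q ^ 2

/-- Every vector `v` with `(Gᵀ G + diag tail) v = t v` lies in the kernel of `G`. -/
def IsPureAt (tail : Fin 2 → ℝ) {M : ℕ} (G : Fin M → Idx n → ℝ) (t : ℝ) : Prop :=
  ∀ v : Idx n → ℝ, (∀ q, ∑ b, G b q * ∑ r, G b r * v r + tail q.1 * v q = t * v q) →
    ∀ b, ∑ r, G b r * v r = 0

/-- Quantitative form of purity: the kernel of `GᵀG + diag tail - t` lies in that of `G`, so `G`
factors through this operator by a linear map, which is bounded in finite dimension. Approximate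
eigenvectors are then almost killed by `G`. -/
theorem IsPureAt.exists_bound {tail : Fin 2 → ℝ} {M : ℕ} {G : Fin M → Idx n → ℝ} {t : ℝ}
    (h : IsPureAt tail G t) : ∃ C, 0 ≤ C ∧ ∀ v : Idx n → ℝ, ∀ η, 0 ≤ η →
      (∀ q, |∑ b, G b q * ∑ r, G b r * v r + tail q.1 * v q - t * v q| ≤ η) →
      ∀ b, |∑ r, G b r * v r| ≤ C * η := by
  let g : (Idx n → ℝ) →ₗ[ℝ] (Fin M → ℝ) :=
    LinearMap.pi fun b => ∑ r, G b r • LinearMap.proj r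
  let f : (Idx n → ℝ) →ₗ[ℝ] (Idx n → ℝ) :=
    LinearMap.pi fun q => ∑ b, G b q • (LinearMap.proj b ∘ₗ g)
      + (tail q.1 - t) • LinearMap.proj q
  have hg : ∀ v b, g v b = ∑ r, G b r * v r := fun v b => by simp [g]
  have hf : ∀ v q, f v q = ∑ b, G b q * ∑ r, G b r * v r + tail q.1 * v q - t * v q := by
    intro v q
    simp [f, hg]
    ring
  have hker : LinearMap.ker f ≤ LinearMap.ker g := by
    intro v hv
    rw [LinearMap.mem_ker] at hv ⊢
    ext b
    rw [hg]
    refine h v (fun q => ?_) b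
    have := congrFun hv q
    rw [hf] at this
    simpa [sub_eq_zero] using this
  -- `g ∘ l` is the factor of `g` through the range of `f`; which right inverse `l` is taken does
  -- not matter.
  obtain ⟨l, hl⟩ := f.rangeRestrict.exists_rightInverse_of_surjective f.range_rangeRestrict
  let L := LinearMap.toContinuousLinearMap (g ∘ₗ l)
  refine ⟨‖L‖, L.opNorm_nonneg, fun v η hη hv b => ?_⟩
  have h1 : g v = L (f.rangeRestrict v) := by
    have h2 : f (v - l (f.rangeRestrict v)) = 0 := by
      have := LinearMap.congr_fun hl (f.rangeRestrict v)
      rw [map_sub, sub_eq_zero]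
      exact (congrArg Subtype.val this).symm
    have h3 := LinearMap.mem_ker.1 (hker (LinearMap.mem_ker.2 h2))
    rw [map_sub, sub_eq_zero] at h3
    exact h3
  rw [← hg, h1]
  calc |L (f.rangeRestrict v) b| ≤ ‖L (f.rangeRestrict v)‖ := norm_le_pi_norm (L _) b
    _ ≤ ‖L‖ * ‖f.rangeRestrict v‖ := L.le_opNorm _
    _ ≤ ‖L‖ * η := by
      gcongr
      change ‖f v‖ ≤ η
      rw [pi_norm_le_iff_of_nonneg hη]
      intro q
      rw [hf]
      exact hv q

/-- The deviation of the Gram matrix from its limit. -/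
noncomputable def gramError (tail : Fin 2 → ℝ) {M p : ℕ} (y : Idx n → Vec p)
    (G : Fin M → Idx n → ℝ) (q r : Idx n) : ℝ :=
  inner ℝ (y q) (y r) - (∑ a, G a q * G a r + tailGram tail q r)

theorem sum_inner_mul_eq (tail : Fin 2 → ℝ) {M p : ℕ} (y : Idx n → Vec p)
    (G : Fin M → Idx n → ℝ) {a : Idx n → ℝ} (ha : IsClassCentred a) (q : Idx n) :
    ∑ r, inner ℝ (y q) (y r) * a r
      = ∑ b, G b q * ∑ r, G b r * a r + tail q.1 * a q + ∑ r, gramError tail y G q r * a r := by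
  have h1 : ∀ r, inner ℝ (y q) (y r) * a r = (∑ b, G b q * G b r) * a r
      + tailGram tail q r * a r + gramError tail y G q r * a r := by
    intro r; rw [gramError]; ring
  simp_rw [h1, Finset.sum_add_distrib, sum_tailGram_mul tail ha]
  congr 2
  simp_rw [Finset.sum_mul, Finset.mul_sum]
  rw [Finset.sum_comm]
  simp_rw [mul_assoc]

theorem norm_sq_sum_smul_eq (tail : Fin 2 → ℝ) {M p : ℕ} (y : Idx n → Vec p)
    (G : Fin M → Idx n → ℝ) {a : Idx n → ℝ} (ha : IsClassCentred a) :
    ‖∑ q, a q • y q‖ ^ 2 = limitForm tail G a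
      + ∑ q, a q * ∑ r, gramError tail y G q r * a r := by
  have h1 : ‖∑ q, a q • y q‖ ^ 2 = ∑ q, a q * ∑ r, inner ℝ (y q) (y r) * a r := by
    rw [← real_inner_self_eq_norm_sq, sum_inner]
    refine Finset.sum_congr rfl fun q _ => ?_
    rw [real_inner_smul_left, inner_sum]
    congr 1
    refine Finset.sum_congr rfl fun r _ => ?_
    rw [real_inner_smul_right, mul_comm]
  rw [h1]
  simp_rw [sum_inner_mul_eq tail y G ha, mul_add, Finset.sum_add_distrib]
  rw [limitForm]
  congr 2
  · simp_rw [Finset.mul_sum]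
    rw [Finset.sum_comm]
    refine Finset.sum_congr rfl fun b _ => ?_
    rw [sq, Finset.sum_mul_sum]
    refine Finset.sum_congr rfl fun q _ => Finset.sum_congr rfl fun r _ => ?_
    ring
  · exact Finset.sum_congr rfl fun q _ => by ring

namespace HasGramLimit

variable {tail : Fin 2 → ℝ} {M : ℕ} {N : ℕ → ℕ} {y : ∀ s, Idx n → Vec (N s)}
  {e : ∀ s, Fin M → Vec (N s)} {d : ∀ s, Vec (N s)} {G : Fin M → Idx n → ℝ}
  {lam : ∀ s, Fin (N s) → ℝ} {u : ∀ s, Fin (N s) → Vec (N s)}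

theorem eventually_gramError_le (h : HasGramLimit tail y e d G) {η : ℝ} (hη : 0 < η) :
    ∀ᶠ s in atTop, ∀ q r, |gramError tail (y s) G q r| ≤ η := by
  rw [eventually_all]
  intro q
  rw [eventually_all]
  intro r
  have := (h.gram q r).sub_const (∑ a, G a q * G a r + tailGram tail q r)
  rw [sub_self] at this
  filter_upwards [this.abs.eventually_le_const (by simpa using hη)] with s hs
  exact hs

/-- Entrywise convergence of a matrix of fixed size is uniform on the unit ball of coefficients; the
uniformity is needed because the vectors supplied by min-max vary with `s`. -/
theorem eventually_norm_sq_sub_le (h : HasGramLimit tail y e d G) {ε : ℝ} (hε : 0 < ε) :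
    ∀ᶠ s in atTop, ∀ a : Idx n → ℝ, IsClassCentred a →
      |‖∑ q, a q • y s q‖ ^ 2 - limitForm tail G a| ≤ ε * ∑ q, a q ^ 2 := by
  have hη : 0 < ε / (Fintype.card (Idx n) + 1) := by positivity
  filter_upwards [h.eventually_gramError_le hη] with s hs a ha
  rw [norm_sq_sum_smul_eq tail (y s) G ha, add_sub_cancel_left]
  set η := ε / (Fintype.card (Idx n) + 1) with hηdef
  calc |∑ q, a q * ∑ r, gramError tail (y s) G q r * a r|
      ≤ ∑ q, |a q| * ∑ r, η * |a r| := by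
        refine (Finset.abs_sum_le_sum_abs _ _).trans (Finset.sum_le_sum fun q _ => ?_)
        rw [abs_mul]
        refine mul_le_mul_of_nonneg_left ?_ (abs_nonneg _)
        refine (Finset.abs_sum_le_sum_abs _ _).trans (Finset.sum_le_sum fun r _ => ?_)
        rw [abs_mul]
        exact mul_le_mul_of_nonneg_right (hs q r) (abs_nonneg _)
    _ = η * (∑ q, |a q|) ^ 2 := by
        rw [← Finset.mul_sum, ← Finset.sum_mul]; ring
    _ ≤ η * (Fintype.card (Idx n) * ∑ q, |a q| ^ 2) := by
        gcongr
        exact sq_sum_le_card_mul_sum_sq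
    _ ≤ ε * ∑ q, a q ^ 2 := by
        simp_rw [sq_abs]
        rw [← mul_assoc]
        refine mul_le_mul_of_nonneg_right ?_ (Finset.sum_nonneg fun q _ => sq_nonneg _)
        rw [hηdef, div_mul_eq_mul_div, div_le_iff₀ (by positivity)]
        nlinarith

/-- The lower half of Courant-Fischer in the limit, tested on the kernel of `Ψ`, whose codimension
is at most the dimension of `F`. -/
theorem eventually_le_eigenvalue (h : HasGramLimit tail y e d G)
    (hs : ∀ s, IsScatterEigen (y s) (lam s) (u s)) {F : Type*} [AddCommGroup F] [Module ℝ F]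
    [FiniteDimensional ℝ F] (Ψ : (Idx n → ℝ) →ₗ[ℝ] F) {t : ℝ}
    (hΨ : ∀ a, Ψ a = 0 → IsClassCentred a ∧ t * ∑ q, a q ^ 2 ≤ limitForm tail G a)
    {ε : ℝ} (hε : 0 < ε) :
    ∀ᶠ s in atTop, ∀ i : Fin (N s), Module.finrank ℝ F + i < Fintype.card (Idx n) →
      t - ε ≤ lam s i := by
  filter_upwards [h.eventually_norm_sq_sub_le hε] with s hq i hi
  obtain ⟨a, ha0, ha, hle⟩ := (hs s).exists_gram_le i Ψ hi
  have hpos : 0 < ∑ q, a q ^ 2 := by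
    obtain ⟨q, hq⟩ := Function.ne_iff.1 ha0
    exact Finset.sum_pos' (fun q _ => sq_nonneg _) ⟨q, Finset.mem_univ _, by
      have : a q ≠ 0 := hq
      positivity⟩
  have h1 := hΨ a ha
  have h2 := (abs_le.1 (hq a h1.1)).1
  refine le_of_mul_le_mul_right ?_ hpos
  linarith [h1.2]

/-- The upper half of Courant-Fischer: the span of the leading `i + 1` eigenvectors contains a
nonzero vector whose Gram coefficients are killed by `Ψ`. -/
theorem eventually_eigenvalue_le (h : HasGramLimit tail y e d G)
    (hs : ∀ s, IsScatterEigen (y s) (lam s) (u s)) {F : Type*} [AddCommGroup F] [Module ℝ F]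
    [FiniteDimensional ℝ F] (Ψ : (Idx n → ℝ) →ₗ[ℝ] F) {t : ℝ} (ht : 0 ≤ t)
    (hΨ : ∀ a, IsClassCentred a → Ψ a = 0 → limitForm tail G a ≤ t * ∑ q, a q ^ 2)
    {ε : ℝ} (hε : 0 < ε) :
    ∀ᶠ s in atTop, ∀ i : Fin (N s), Module.finrank ℝ F ≤ i → lam s i ≤ t + ε := by
  filter_upwards [h.eventually_norm_sq_sub_le hε] with s hq i hi
  obtain ⟨x, hx0, hx, h1, h2⟩ := (hs s).exists_le_gram i Ψ hi
  by_contra! hlt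
  have hxpos : 0 < ‖x‖ ^ 2 := by positivity
  -- Since `t ≥ 0`, the eigenvalue is positive here, so the coefficient vector cannot vanish.
  have hpos : 0 < ∑ q, inner ℝ (y s q) x ^ 2 := lt_of_lt_of_le (by nlinarith) h1
  have hc := isClassCentred_inner (h.centred s) x
  have h3 := (abs_le.1 (hq _ hc)).2
  have h4 := hΨ _ hc hx
  nlinarith

end HasGramLimit

end Limit

/-! ### Limits of the sample eigenvalues, and near-orthogonality of eigenvectors to the mean
difference. -/

section Eigenvalues

variable {n : Fin 2 → ℕ}

theorem card_idx (n : Fin 2 → ℕ) : Fintype.card (Idx n) = n 0 + n 1 := by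
  simp [Fintype.card_sigma, Fin.sum_univ_two]

/-- The leading coordinates depend on the class-centred coefficients through `ρ` linear
functionals only. -/
def HasRankBound {M : ℕ} (G : Fin M → Idx n → ℝ) (ρ : ℕ) : Prop :=
  ∃ Ψ : (Idx n → ℝ) →ₗ[ℝ] (Fin ρ → ℝ), ∀ a, Ψ a = 0 → ∀ b, ∑ q, G b q * a q = 0

/-- The leading coordinates depend on the coefficients of class `1` through `ρ` linear functionals
only. -/
def HasClassOneRankBound {M : ℕ} (G : Fin M → Idx n → ℝ) (ρ : ℕ) : Prop :=
  ∃ Ψ : (Idx n → ℝ) →ₗ[ℝ] (Fin ρ → ℝ), ∀ a, (∀ j, a ⟨0, j⟩ = 0) → Ψ a = 0 →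
    ∀ b, ∑ q, G b q * a q = 0

theorem mul_sum_sq_le_limitForm {tail : Fin 2 → ℝ} {M : ℕ} (G : Fin M → Idx n → ℝ) {t : ℝ}
    {a : Idx n → ℝ} (h : ∀ q, a q ≠ 0 → t ≤ tail q.1) :
    t * ∑ q, a q ^ 2 ≤ limitForm tail G a := by
  rw [limitForm, Finset.mul_sum]
  refine le_add_of_nonneg_of_le (Finset.sum_nonneg fun b _ => sq_nonneg _)
    (Finset.sum_le_sum fun q _ => ?_)
  by_cases hq : a q = 0
  · simp [hq]
  · exact mul_le_mul_of_nonneg_right (h q hq) (sq_nonneg _)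

theorem limitForm_le_mul_sum_sq {tail : Fin 2 → ℝ} {M : ℕ} {G : Fin M → Idx n → ℝ} {t : ℝ}
    {a : Idx n → ℝ} (hG : ∀ b, ∑ q, G b q * a q = 0) (h : ∀ q, a q ≠ 0 → tail q.1 ≤ t) :
    limitForm tail G a ≤ t * ∑ q, a q ^ 2 := by
  simp only [limitForm, hG, Finset.mul_sum]
  simp only [ne_eq, OfNat.ofNat_ne_zero, not_false_eq_true, zero_pow, Finset.sum_const_zero,
    zero_add]
  refine Finset.sum_le_sum fun q _ => ?_
  by_cases hq : a q = 0
  · simp [hq]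
  · exact mul_le_mul_of_nonneg_right (h q hq) (sq_nonneg _)

/-- The eigenvalues beyond the `(n 0 + n 1 - 2)`th vanish. -/
theorem IsScatterEigen.eigenvalue_eq_zero {p : ℕ} {y : Idx n → Vec p} {lam : Fin p → ℝ}
    {u : Fin p → Vec p} (h : IsScatterEigen y lam u) (hy : ∀ k, ∑ j, y ⟨k, j⟩ = 0)
    (hn : ∀ k, 0 < n k) {i : Fin p} (hi : n 0 + n 1 - 2 ≤ i) : lam i = 0 := by
  -- A class-centred vector is determined by all but the last of its entries in each class, which is
  -- where `n 0 + n 1 - 2` comes from.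
  let Ψ : (Idx n → ℝ) →ₗ[ℝ] ((k : Fin 2) × Fin (n k - 1) → ℝ) :=
    LinearMap.pi fun q => LinearMap.proj ⟨q.1, ⟨q.2, by omega⟩⟩
  have hF : Module.finrank ℝ ((k : Fin 2) × Fin (n k - 1) → ℝ) ≤ i := by
    rw [Module.finrank_fintype_fun_eq_card, card_idx]
    have := hn 0
    have := hn 1
    omega
  obtain ⟨x, hx0, hx, h1, -⟩ := h.exists_le_gram i Ψ hF
  have hlt : ∀ k (j : Fin (n k)), (j : ℕ) < n k - 1 → inner ℝ (y ⟨k, j⟩) x = 0 :=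
    fun k j hj => congrFun hx ⟨k, ⟨j, hj⟩⟩
  have hall : ∀ q, inner ℝ (y q) x = 0 := by
    rintro ⟨k, j⟩
    by_cases hj : (j : ℕ) < n k - 1
    · exact hlt k j hj
    · have hc := isClassCentred_inner hy x k
      rw [Finset.sum_eq_single j] at hc
      · exact hc
      · intro l _ hl
        refine hlt k l ?_
        have : (l : ℕ) ≠ j := fun h => hl (Fin.ext h)
        omega
      · simp
  simp only [hall, ne_eq, OfNat.ofNat_ne_zero, not_false_eq_true, zero_pow,
    Finset.sum_const_zero] at h1
  have hxpos : 0 < ‖x‖ ^ 2 := by positivity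
  nlinarith [h.nonneg i]

namespace HasGramLimit

variable {tail : Fin 2 → ℝ} {M : ℕ} {N : ℕ → ℕ} {y : ∀ s, Idx n → Vec (N s)}
  {e : ∀ s, Fin M → Vec (N s)} {d : ∀ s, Vec (N s)} {G : Fin M → Idx n → ℝ}
  {lam : ∀ s, Fin (N s) → ℝ} {u : ∀ s, Fin (N s) → Vec (N s)}

theorem tail_one_le (htail : tail 1 ≤ tail 0) (k : Fin 2) : tail 1 ≤ tail k := by
  fin_cases k
  · exact htail
  · exact le_rfl

theorem tail_le_zero (htail : tail 1 ≤ tail 0) (k : Fin 2) : tail k ≤ tail 0 := by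
  fin_cases k
  · exact le_rfl
  · exact htail

/-- Class-centred vectors form a space of codimension at most 2, on which the limiting form is at
least `tail 1`. -/
theorem eventually_tail_one_sub_le (h : HasGramLimit tail y e d G)
    (hs : ∀ s, IsScatterEigen (y s) (lam s) (u s)) (htail : tail 1 ≤ tail 0)
    {ε : ℝ} (hε : 0 < ε) :
    ∀ᶠ s in atTop, ∀ i : Fin (N s), (i : ℕ) < n 0 + n 1 - 2 → tail 1 - ε ≤ lam s i := by
  let Ψ : (Idx n → ℝ) →ₗ[ℝ] (Fin 2 → ℝ) :=
    LinearMap.pi fun k => ∑ j, LinearMap.proj ⟨k, j⟩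
  have hΨ : ∀ a, Ψ a = 0 → IsClassCentred a ∧ tail 1 * ∑ q, a q ^ 2 ≤ limitForm tail G a := by
    refine fun a ha => ⟨fun k => ?_, mul_sum_sq_le_limitForm G fun q _ => tail_one_le htail _⟩
    simpa [Ψ] using congrFun ha k
  filter_upwards [h.eventually_le_eigenvalue hs Ψ hΨ hε] with s h1 i hi
  refine h1 i ?_
  rw [Module.finrank_fintype_fun_eq_card, Fintype.card_fin, card_idx]
  omega

/-- Test vectors: class-centred and supported on class 0, a space of dimension at least `n 0 - 1` on
which the limiting form is at least `tail 0`. -/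
theorem eventually_tail_zero_sub_le (h : HasGramLimit tail y e d G)
    (hs : ∀ s, IsScatterEigen (y s) (lam s) (u s)) {ε : ℝ} (hε : 0 < ε) :
    ∀ᶠ s in atTop, ∀ i : Fin (N s), (i : ℕ) + 1 < n 0 → tail 0 - ε ≤ lam s i := by
  let Ψ : (Idx n → ℝ) →ₗ[ℝ] ℝ × (Fin (n 1) → ℝ) :=
    (∑ j, LinearMap.proj (R := ℝ) (φ := fun _ : Idx n => ℝ) ⟨0, j⟩).prod
      (LinearMap.pi fun j => LinearMap.proj ⟨1, j⟩)
  have hΨ : ∀ a, Ψ a = 0 → IsClassCentred a ∧ tail 0 * ∑ q, a q ^ 2 ≤ limitForm tail G a := by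
    intro a ha
    simp only [Ψ, LinearMap.prod_apply, Function.prod_apply, Prod.mk_eq_zero] at ha
    have h1 : ∀ j, a ⟨1, j⟩ = 0 := fun j => congrFun ha.2 j
    have h0 : ∑ j, a ⟨0, j⟩ = 0 := by simpa using ha.1
    refine ⟨fun k => ?_, mul_sum_sq_le_limitForm G fun q hq => ?_⟩
    · fin_cases k
      · exact h0
      · exact Finset.sum_eq_zero fun j _ => h1 j
    · obtain ⟨k, j⟩ := q
      fin_cases k
      · exact le_rfl
      · exact absurd (h1 j) hq
  filter_upwards [h.eventually_le_eigenvalue hs Ψ hΨ hε] with s h1 i hi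
  refine h1 i ?_
  rw [Module.finrank_prod, Module.finrank_self, Module.finrank_fintype_fun_eq_card,
    Fintype.card_fin, card_idx]
  omega

/-- Off `ρ` functionals the contribution of `G` disappears, and only the diagonal part, at most
`tail 0`, is left. -/
theorem eventually_le_tail_zero_add (h : HasGramLimit tail y e d G)
    (hs : ∀ s, IsScatterEigen (y s) (lam s) (u s)) (htail : tail 1 ≤ tail 0) (h0 : 0 ≤ tail 0)
    {ρ : ℕ} (hρ : HasRankBound G ρ) {ε : ℝ} (hε : 0 < ε) :
    ∀ᶠ s in atTop, ∀ i : Fin (N s), ρ ≤ i → lam s i ≤ tail 0 + ε := by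
  obtain ⟨Ψ, hΨ⟩ := hρ
  filter_upwards [h.eventually_eigenvalue_le hs Ψ h0 (fun a _ ha =>
    limitForm_le_mul_sum_sq (hΨ a ha) fun q _ => tail_le_zero htail _) hε] with s h1 i hi
  exact h1 i (by simpa using hi)

/-- For class-centred coefficients, `n 0 - 1` conditions annihilate class 0 and `ρ` further ones the
contribution of `G`; what is left is `tail 1`. As `i` is zero-based, the codimension `n 0 - 1 + ρ`
reads `n 0 + ρ ≤ i + 1`. -/
theorem eventually_le_tail_one_add (h : HasGramLimit tail y e d G)
    (hs : ∀ s, IsScatterEigen (y s) (lam s) (u s)) (h0 : 0 ≤ tail 1)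
    {ρ : ℕ} (hρ : HasClassOneRankBound G ρ) {ε : ℝ} (hε : 0 < ε) :
    ∀ᶠ s in atTop, ∀ i : Fin (N s), n 0 + ρ ≤ i + 1 → 0 < n 0 → lam s i ≤ tail 1 + ε := by
  obtain ⟨Ψ₁, hΨ₁⟩ := hρ
  let Ψ : (Idx n → ℝ) →ₗ[ℝ] (Fin (n 0 - 1) → ℝ) × (Fin ρ → ℝ) :=
    (LinearMap.pi fun j => LinearMap.proj ⟨0, ⟨j, by omega⟩⟩).prod Ψ₁
  have hΨ : ∀ a, IsClassCentred a → Ψ a = 0 →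
      limitForm tail G a ≤ tail 1 * ∑ q, a q ^ 2 := by
    intro a hc ha
    simp only [Ψ, LinearMap.prod_apply, Function.prod_apply, Prod.mk_eq_zero] at ha
    have hlt : ∀ j : Fin (n 0), (j : ℕ) < n 0 - 1 → a ⟨0, j⟩ = 0 :=
      fun j hj => congrFun ha.1 ⟨j, hj⟩
    have hall : ∀ j, a ⟨0, j⟩ = 0 := by
      intro j
      by_cases hj : (j : ℕ) < n 0 - 1
      · exact hlt j hj
      · have hc0 := hc 0
        rw [Finset.sum_eq_single j] at hc0
        · exact hc0
        · intro l _ hl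
          refine hlt l ?_
          have : (l : ℕ) ≠ j := fun h => hl (Fin.ext h)
          omega
        · simp
    refine limitForm_le_mul_sum_sq (hΨ₁ a hall ha.2) fun q hq => ?_
    obtain ⟨k, j⟩ := q
    fin_cases k
    · exact absurd (hall j) hq
    · exact le_rfl
  filter_upwards [h.eventually_eigenvalue_le hs Ψ h0 hΨ hε] with s h1 i hi hn
  refine h1 i ?_
  rw [Module.finrank_prod, Module.finrank_fintype_fun_eq_card,
    Module.finrank_fintype_fun_eq_card, Fintype.card_fin, Fintype.card_fin]
  omega

/-- If an eigenvalue is close to `t`, then its eigenvector is almost orthogonal to `d`. -/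
theorem eventually_abs_inner_le (h : HasGramLimit tail y e d G)
    (hs : ∀ s, IsScatterEigen (y s) (lam s) (u s)) {t c : ℝ} (ht : IsPureAt tail G t)
    (hc : 0 < c) {ε : ℝ} (hε : 0 < ε) :
    ∃ η > 0, ∀ᶠ s in atTop, ∀ i : Fin (N s), c ≤ lam s i → |lam s i - t| ≤ η →
      |inner ℝ (u s i) (d s)| ≤ ε := by
  obtain ⟨C, hC0, hC⟩ := ht.exists_bound
  obtain ⟨B, hB⟩ := h.bdd
  set K : ℝ := (Fintype.card (Idx n) : ℝ) with hK
  have hK0 : 0 ≤ K := by positivity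
  -- `L * η` collects the errors below: the deviation of `cross`, and for each of the `M` leading
  -- coordinates the deviation of `coord` plus the purity bound.
  set L : ℝ := K + M * (|B| * (K + C * (K + 1))) with hL
  have hL0 : 0 ≤ L := by positivity
  set η : ℝ := ε * √c / (L + 1) with hη
  have hη0 : 0 < η := by positivity
  refine ⟨η, hη0, ?_⟩
  have h1 : ∀ᶠ s in atTop, ∀ q, |inner ℝ (d s) (y s q)
      - ∑ a, inner ℝ (e s a) (d s) * inner ℝ (e s a) (y s q)| ≤ η := by
    rw [eventually_all]
    exact fun q => (h.cross q).abs.eventually_le_const (by simpa using hη0)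
  have h2 : ∀ᶠ s in atTop, ∀ a q, |inner ℝ (e s a) (y s q) - G a q| ≤ η := by
    rw [eventually_all]
    intro a
    rw [eventually_all]
    intro q
    have := (h.coord a q).sub_const (G a q)
    rw [sub_self] at this
    exact this.abs.eventually_le_const (by simpa using hη0)
  filter_upwards [h1, h2, h.eventually_gramError_le hη0, h.orthonormal, hB]
    with s h1 h2 h3 h4 h5 i hi hit
  have hpos : 0 < lam s i := hc.trans_le hi
  have hsq : 0 < √(lam s i) := Real.sqrt_pos.2 hpos
  have hsq2 : √(lam s i) * √(lam s i) = lam s i := Real.mul_self_sqrt hpos.le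
  -- The dual eigenvector: `v` is a class-centred unit eigenvector of the Gram matrix for the same
  -- eigenvalue.
  set v : Idx n → ℝ := fun q => inner ℝ (y s q) (u s i) / √(lam s i) with hv
  have hvq : ∀ q, inner ℝ (y s q) (u s i) = √(lam s i) * v q := fun q => by
    rw [hv]; field_simp
  have hvc : IsClassCentred v := by
    intro k
    have := isClassCentred_inner (h.centred s) (u s i) k
    simp only [hv]
    rw [← Finset.sum_div, this, zero_div]
  have hv1 : ∑ q, v q ^ 2 = 1 := by
    have := (hs s).sum_mul_inner_self i i
    rw [if_pos rfl] at this
    simp only [hvq] at this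
    have h6 : ∑ q, v q ^ 2 * lam s i = lam s i := by
      conv_rhs => rw [← this]
      refine Finset.sum_congr rfl fun q _ => ?_
      linear_combination (-(v q) ^ 2) * hsq2
    rw [← Finset.sum_mul] at h6
    exact mul_right_cancel₀ hpos.ne' (by rw [h6, one_mul])
  have hvle : ∀ q, |v q| ≤ 1 := by
    intro q
    rw [abs_le_one_iff_mul_self_le_one, ← sq, ← hv1]
    exact Finset.single_le_sum (f := fun q => v q ^ 2) (fun q _ => sq_nonneg _)
      (Finset.mem_univ q)
  have hsum : ∀ (f : Idx n → ℝ) (δ : ℝ), (∀ q, |f q| ≤ δ) → |∑ q, f q * v q| ≤ K * δ := by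
    intro f δ hf
    refine (Finset.abs_sum_le_sum_abs _ _).trans ?_
    calc ∑ q, |f q * v q| ≤ ∑ _q : Idx n, δ := by
          refine Finset.sum_le_sum fun q _ => ?_
          rw [abs_mul]
          exact (mul_le_of_le_one_right (abs_nonneg _) (hvle q)).trans (hf q)
      _ = K * δ := by simp [hK]
  have heig : ∀ q, ∑ r, inner ℝ (y s q) (y s r) * v r = lam s i * v q := by
    intro q
    have h6 := (hs s).sum_mul_inner i (y s q)
    rw [real_inner_comm (y s q) (u s i), hvq] at h6
    refine mul_left_cancel₀ hsq.ne' ?_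
    rw [Finset.mul_sum, mul_left_comm, ← h6]
    refine Finset.sum_congr rfl fun r _ => ?_
    rw [hvq, real_inner_comm (y s r)]
    ring
  -- `v` solves the limiting equation at `t` up to `(K + 1) * η`: `η` from the eigenvalue and `K *
  -- η` from the Gram matrix.
  have hG : ∀ b, |∑ r, G b r * v r| ≤ C * ((K + 1) * η) := by
    refine hC v _ (by positivity) fun q => ?_
    have h6 := sum_inner_mul_eq tail (y s) G hvc q
    rw [heig] at h6
    have h7 : ∑ b, G b q * ∑ r, G b r * v r + tail q.1 * v q - t * v q
        = (lam s i - t) * v q - ∑ r, gramError tail (y s) G q r * v r := by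
      linear_combination -h6
    rw [h7]
    refine (abs_sub _ _).trans ?_
    have h8 := hsum _ η (h3 q)
    have h9 : |(lam s i - t) * v q| ≤ η := by
      rw [abs_mul]
      exact (mul_le_of_le_one_right (abs_nonneg _) (hvle q)).trans hit
    linarith
  have he : ∀ a, |inner ℝ (e s a) (d s)| ≤ |B| := by
    intro a
    refine (abs_real_inner_le_norm _ _).trans ?_
    rw [h4.1 a, one_mul]
    exact h5.trans (le_abs_self B)
  have hey : ∀ a, |∑ q, inner ℝ (e s a) (y s q) * v q| ≤ (K + C * (K + 1)) * η := by
    intro a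
    have h6 : ∑ q, inner ℝ (e s a) (y s q) * v q
        = ∑ q, (inner ℝ (e s a) (y s q) - G a q) * v q + ∑ q, G a q * v q := by
      rw [← Finset.sum_add_distrib]
      exact Finset.sum_congr rfl fun q _ => by ring
    rw [h6]
    refine (abs_add_le _ _).trans ?_
    have h7 := hsum _ η (h2 a)
    have h8 := hG a
    linarith
  -- The product with `d` splits into the part outside the leading space, small by `cross`, and the
  -- leading part, small by purity.
  have hmain : √(lam s i) * inner ℝ (u s i) (d s)
      = ∑ q, (inner ℝ (d s) (y s q)
        - ∑ a, inner ℝ (e s a) (d s) * inner ℝ (e s a) (y s q)) * v q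
        + ∑ a, inner ℝ (e s a) (d s) * ∑ q, inner ℝ (e s a) (y s q) * v q := by
    have h6 := (hs s).sum_mul_inner i (d s)
    simp only [hvq] at h6
    have h7 : √(lam s i) * inner ℝ (u s i) (d s) = ∑ q, inner ℝ (d s) (y s q) * v q := by
      refine mul_left_cancel₀ hsq.ne' ?_
      rw [← mul_assoc, hsq2, ← h6, Finset.mul_sum]
      refine Finset.sum_congr rfl fun q _ => ?_
      rw [real_inner_comm (d s)]
      ring
    rw [h7]
    simp_rw [sub_mul, Finset.sum_sub_distrib, Finset.sum_mul, Finset.mul_sum]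
    rw [Finset.sum_comm (s := (Finset.univ : Finset (Idx n)))]
    simp [mul_assoc]
  have hbound : √(lam s i) * |inner ℝ (u s i) (d s)| ≤ L * η := by
    rw [← abs_of_pos hsq, ← abs_mul, hmain]
    refine (abs_add_le _ _).trans ?_
    have h6 := hsum _ η h1
    have h7 : |∑ a, inner ℝ (e s a) (d s) * ∑ q, inner ℝ (e s a) (y s q) * v q|
        ≤ M * (|B| * ((K + C * (K + 1)) * η)) := by
      refine (Finset.abs_sum_le_sum_abs _ _).trans ?_
      calc _ ≤ ∑ _a : Fin M, |B| * ((K + C * (K + 1)) * η) := by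
            refine Finset.sum_le_sum fun a _ => ?_
            rw [abs_mul]
            exact mul_le_mul (he a) (hey a) (abs_nonneg _) (abs_nonneg _)
        _ = _ := by simp
    rw [hL]
    linarith
  have hsc : √c ≤ √(lam s i) := Real.sqrt_le_sqrt hi
  have hc' : 0 < √c := Real.sqrt_pos.2 hc
  refine le_of_mul_le_mul_left ?_ hc'
  calc √c * |inner ℝ (u s i) (d s)| ≤ √(lam s i) * |inner ℝ (u s i) (d s)| := by gcongr
    _ ≤ L * η := hbound
    _ ≤ √c * ε := by
      rw [hη, mul_div_assoc', div_le_iff₀ (by positivity)]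
      nlinarith [mul_pos hε hc']

end HasGramLimit

end Eigenvalues

/-! ### Ridge coefficients outside the signal indices, and the null part of the mean difference. -/

section Asymptotics

variable {n : Fin 2 → ℕ}

/-- Pairing the equation with `v` gives `‖G v‖² + ∑ (tail q - tail 1) v q ^ 2 = 0`, a sum of
nonnegative terms. -/
theorem isPureAt_tail_one {tail : Fin 2 → ℝ} {M : ℕ} {G : Fin M → Idx n → ℝ}
    (htail : tail 1 ≤ tail 0) : IsPureAt tail G (tail 1) := by
  intro v hv
  have h1 : ∑ b, (∑ r, G b r * v r) ^ 2 + ∑ q : Idx n, (tail q.1 - tail 1) * v q ^ 2 = 0 := by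
    have h2 : ∑ q, v q * (∑ b, G b q * ∑ r, G b r * v r + tail q.1 * v q - tail 1 * v q) = 0 :=
      Finset.sum_eq_zero fun q _ => by rw [hv q]; ring
    rw [← h2]
    have h3 : ∀ q : Idx n, v q * (∑ b, G b q * ∑ r, G b r * v r + tail q.1 * v q - tail 1 * v q)
        = ∑ b, G b q * v q * ∑ r, G b r * v r + (tail q.1 - tail 1) * v q ^ 2 := by
      intro q
      rw [add_sub_assoc, mul_add, Finset.mul_sum]
      congr 1
      · exact Finset.sum_congr rfl fun b _ => by ring
      · ring
    simp_rw [h3, Finset.sum_add_distrib]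
    rw [Finset.sum_comm]
    simp_rw [← Finset.sum_mul, ← sq]
  have h4 : 0 ≤ ∑ q : Idx n, (tail q.1 - tail 1) * v q ^ 2 :=
    Finset.sum_nonneg fun q _ => mul_nonneg
      (sub_nonneg.2 (HasGramLimit.tail_one_le htail _)) (sq_nonneg _)
  have h5 : ∑ b, (∑ r, G b r * v r) ^ 2 = 0 :=
    le_antisymm (by linarith) (Finset.sum_nonneg fun b _ => sq_nonneg _)
  rw [Finset.sum_eq_zero_iff_of_nonneg fun b _ => sq_nonneg _] at h5
  exact fun b => by simpa using h5 b (Finset.mem_univ b)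

namespace HasGramLimit

variable {tail : Fin 2 → ℝ} {M : ℕ} {N : ℕ → ℕ} {y : ∀ s, Idx n → Vec (N s)}
  {e : ∀ s, Fin M → Vec (N s)} {d : ∀ s, Vec (N s)} {G : Fin M → Idx n → ℝ}
  {lam : ∀ s, Fin (N s) → ℝ} {u : ∀ s, Fin (N s) → Vec (N s)}

/-- For eigenvalues near `t` the denominator is at least `|t + α| / 2`, so the ridge factor is
bounded and the near-orthogonality to `d` survives. -/
theorem eventually_abs_ridge_coef_le (h : HasGramLimit tail y e d G)
    (hs : ∀ s, IsScatterEigen (y s) (lam s) (u s)) {t c α : ℝ} (ht : IsPureAt tail G t)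
    (hc : 0 < c) (hα : α ≠ -t) {ε : ℝ} (hε : 0 < ε) :
    ∃ η > 0, ∀ᶠ s in atTop, ∀ i : Fin (N s), c ≤ lam s i → |lam s i - t| ≤ η →
      |α / (lam s i + α) * inner ℝ (u s i) (d s)| ≤ ε := by
  have hαt : 0 < |t + α| := abs_pos.2 fun h => hα (by linarith)
  have hε' : 0 < ε * (|t + α| / 2) / (|α| + 1) := by positivity
  obtain ⟨η, hη, hev⟩ := h.eventually_abs_inner_le hs ht hc hε'
  refine ⟨min η (|t + α| / 2), lt_min hη (half_pos hαt), ?_⟩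
  filter_upwards [hev] with s hs i hi hit
  have h1 := hs i hi (hit.trans (min_le_left _ _))
  have h2 : |t + α| / 2 ≤ |lam s i + α| := by
    have h3 : |t + α| ≤ |lam s i + α| + |lam s i - t| := by
      have : t + α = (lam s i + α) - (lam s i - t) := by ring
      rw [this]
      exact abs_sub _ _
    have h4 := hit.trans (min_le_right _ _)
    linarith
  have h5 : 0 < |lam s i + α| := (half_pos hαt).trans_le h2
  rw [abs_mul, abs_div, div_mul_eq_mul_div, div_le_iff₀ h5]
  calc |α| * |inner ℝ (u s i) (d s)| ≤ |α| * (ε * (|t + α| / 2) / (|α| + 1)) := by gcongr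
    _ ≤ ε * (|t + α| / 2) := by
      rw [mul_div_assoc', div_le_iff₀ (by positivity)]
      nlinarith [mul_pos hε (half_pos hαt), abs_nonneg α]
    _ ≤ ε * |lam s i + α| := by gcongr

/-- The ridged coefficients of `d` outside the signal indices vanish asymptotically. -/
theorem eventually_forall_abs_ridge_coef_le (h : HasGramLimit tail y e d G)
    (hs : ∀ s, IsScatterEigen (y s) (lam s) (u s)) (htail : tail 1 ≤ tail 0) (h1 : 0 < tail 1)
    (hn : 0 < n 0) (hpure : IsPureAt tail G (tail 0)) {ρ ρ₁ : ℕ} (hρ : HasRankBound G ρ)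
    (hρ₁ : HasClassOneRankBound G ρ₁) {D : Set ℕ}
    (hD : ∀ i, i < n 0 + n 1 - 2 → i + 1 ∉ D →
      ρ ≤ i ∧ (i + 1 < n 0 ∨ n 0 + ρ₁ ≤ i + 1 ∨ tail 0 = tail 1))
    {α : ℝ} (hα0 : α ≠ -tail 0) (hα1 : α ≠ -tail 1) {ε : ℝ} (hε : 0 < ε) :
    ∀ᶠ s in atTop, ∀ i : Fin (N s), (i : ℕ) < n 0 + n 1 - 2 → (i : ℕ) + 1 ∉ D →
      |α / (lam s i + α) * inner ℝ (u s i) (d s)| ≤ ε := by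
  obtain ⟨η₀, hη₀, ev₀⟩ := h.eventually_abs_ridge_coef_le hs hpure (half_pos h1) hα0 hε
  obtain ⟨η₁, hη₁, ev₁⟩ := h.eventually_abs_ridge_coef_le hs
    (isPureAt_tail_one htail) (half_pos h1) hα1 hε
  filter_upwards [ev₀, ev₁, h.eventually_tail_one_sub_le hs htail (half_pos h1),
    h.eventually_tail_one_sub_le hs htail (lt_min hη₀ hη₁),
    h.eventually_tail_zero_sub_le hs hη₀,
    h.eventually_le_tail_zero_add hs htail (h1.le.trans htail) hρ hη₀,
    h.eventually_le_tail_one_add hs h1.le hρ₁ hη₁] with s ev₀ ev₁ hlow hlow1 hlow0 hup0 hup1 i hi hiD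
  obtain ⟨hiρ, hcase⟩ := hD i hi hiD
  have hc : tail 1 / 2 ≤ lam s i := by linarith [hlow i hi]
  have hl := hlow1 i hi
  have hmin0 := min_le_left η₀ η₁
  have hmin1 := min_le_right η₀ η₁
  have hu := hup0 i hiρ
  -- The eigenvalue is squeezed to `tail 0` before index `n 0`, to `tail 1` beyond the window that
  -- starts there, and to the common value if the tails agree.
  rcases hcase with hcase | hcase | hcase
  · exact ev₀ i hc (abs_le.2 ⟨by linarith [hlow0 i hcase], by linarith⟩)
  · exact ev₁ i hc (abs_le.2 ⟨by linarith, by linarith [hup1 i hcase hn]⟩)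
  · exact ev₀ i hc (abs_le.2 ⟨by linarith, by linarith⟩)

end HasGramLimit

/-- The part of `d` in the span of the `u i` with `K ≤ i`. -/
noncomputable def nullPart {p : ℕ} (K : ℕ) (u : Fin p → Vec p) (d : Vec p) : Vec p :=
  ∑ i : Fin p, (if (i : ℕ) < K then 0 else inner ℝ (u i) d) • u i

theorem inner_sum_smul_of_orthonormal {p : ℕ} {u : Fin p → Vec p} (hu : Orthonormal ℝ u)
    (f : Fin p → ℝ) (i : Fin p) : inner ℝ (u i) (∑ j, f j • u j) = f i := by
  simp [inner_sum, real_inner_smul_right, orthonormal_iff_ite.1 hu]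

theorem norm_sq_sum_smul_of_orthonormal {p : ℕ} {u : Fin p → Vec p} (hu : Orthonormal ℝ u)
    (f : Fin p → ℝ) : ‖∑ j, f j • u j‖ ^ 2 = ∑ j, f j ^ 2 := by
  rw [norm_sq_eq_sum_of_orthonormal hu]
  simp_rw [inner_sum_smul_of_orthonormal hu]

/-- The null part is `d - w` with `w` a combination of the observations whose coefficients are
bounded, since the eigenvalues that occur stay away from 0. By `cross`, `w` meets `d` asymptotically
only inside the leading space, so it cannot cancel the component of `d` outside, which `resid`
bounds below. -/
theorem HasGramLimit.exists_le_norm_nullPart {tail : Fin 2 → ℝ} {M : ℕ} {N : ℕ → ℕ}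
    {y : ∀ s, Idx n → Vec (N s)} {e : ∀ s, Fin M → Vec (N s)} {d : ∀ s, Vec (N s)}
    {G : Fin M → Idx n → ℝ} {lam : ∀ s, Fin (N s) → ℝ} {u : ∀ s, Fin (N s) → Vec (N s)}
    (h : HasGramLimit tail y e d G)
    (hs : ∀ s, IsScatterEigen (y s) (lam s) (u s)) (htail : tail 1 ≤ tail 0) (h1 : 0 < tail 1) :
    ∃ c > 0, ∀ᶠ s in atTop, c ≤ ‖nullPart (n 0 + n 1 - 2) (u s) (d s)‖ ^ 2 := by
  obtain ⟨c, hc, hres⟩ := h.resid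
  obtain ⟨B, hB⟩ := h.bdd
  have hY : ∃ Y : ℝ, 0 ≤ Y ∧ ∀ᶠ s in atTop, ∀ q, ‖y s q‖ ^ 2 ≤ Y := by
    let f : Idx n → ℝ := fun q => ∑ a, G a q * G a q + tailGram tail q q + 1
    refine ⟨∑ q, |f q|, Finset.sum_nonneg fun q _ => abs_nonneg _, ?_⟩
    rw [eventually_all]
    intro q
    filter_upwards [(h.gram q q).eventually_le_const (lt_add_one _)] with s hs
    rw [real_inner_self_eq_norm_sq] at hs
    exact hs.trans ((le_abs_self (f q)).trans (Finset.single_le_sum (f := fun q => |f q|)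
      (fun q _ => abs_nonneg _) (Finset.mem_univ q)))
  obtain ⟨Y, hY0, hY⟩ := hY
  set c₀ := tail 1 / 2 with hc₀
  have hc₀pos : 0 < c₀ := half_pos h1
  set A : ℝ := (B ^ 2 + Y) / c₀ with hA
  have hA0 : 0 ≤ A := by positivity
  -- Makes the error in `⟪d, w⟫` at most `c / 4`; it enters `‖d - w‖²` twice, which leaves `c / 2`.
  set δ : ℝ := c / (4 * (Fintype.card (Idx n) * A + 1)) with hδ
  have hδ0 : 0 < δ := by positivity
  have hcr : ∀ᶠ s in atTop, ∀ q, |inner ℝ (d s) (y s q)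
      - ∑ a, inner ℝ (e s a) (d s) * inner ℝ (e s a) (y s q)| ≤ δ := by
    rw [eventually_all]
    exact fun q => (h.cross q).abs.eventually_le_const (by simpa using hδ0)
  refine ⟨c / 2, half_pos hc, ?_⟩
  filter_upwards [hres, hB, hY, hcr, h.orthonormal,
    h.eventually_tail_one_sub_le hs htail hc₀pos] with s hres hB hY hcr ho hlow
  have hlow' : ∀ i : Fin (N s), (i : ℕ) < n 0 + n 1 - 2 → c₀ ≤ lam s i :=
    fun i hi => by linarith [hlow i hi]
  set co : Idx n → ℝ := fun q => ∑ i : Fin (N s), if (i : ℕ) < n 0 + n 1 - 2 then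
    inner ℝ (u s i) (d s) * inner ℝ (y s q) (u s i) / lam s i else 0 with hco
  have hx : nullPart (n 0 + n 1 - 2) (u s) (d s) = d s - ∑ q, co q • y s q := by
    rw [eq_sub_iff_add_eq]
    conv_rhs => rw [← sum_inner_smul_of_orthonormal (hs s).1 (d s)]
    have h2 : ∑ q, co q • y s q = ∑ i : Fin (N s), (if (i : ℕ) < n 0 + n 1 - 2 then
        inner ℝ (u s i) (d s) else 0) • u s i := by
      simp_rw [hco, Finset.sum_smul]
      rw [Finset.sum_comm]
      refine Finset.sum_congr rfl fun i _ => ?_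
      split_ifs with hi
      · have hpos : 0 < lam s i := hc₀pos.trans_le (hlow' i hi)
        have h3 := (hs s).2.2 i
        have h4 : ∀ c : ℝ, c • u s i = (c / lam s i) • (lam s i • u s i) := by
          intro c
          rw [smul_smul, div_mul_cancel₀ _ hpos.ne']
        rw [h4, ← h3, Finset.smul_sum]
        refine Finset.sum_congr rfl fun q _ => ?_
        rw [smul_smul]
        congr 1
        ring
      · simp
    rw [h2, nullPart, ← Finset.sum_add_distrib]
    refine Finset.sum_congr rfl fun i _ => ?_
    split_ifs <;> simp
  have hcoA : ∀ q, |co q| ≤ A := by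
    intro q
    have h2 : |co q| ≤ ∑ i : Fin (N s),
        (inner ℝ (u s i) (d s) ^ 2 + inner ℝ (u s i) (y s q) ^ 2) / c₀ := by
      refine (Finset.abs_sum_le_sum_abs _ _).trans (Finset.sum_le_sum fun i _ => ?_)
      split_ifs with hi
      · have hpos : 0 < lam s i := hc₀pos.trans_le (hlow' i hi)
        rw [abs_div, abs_mul, abs_of_pos hpos, real_inner_comm (u s i) (y s q)]
        refine div_le_div₀ (by positivity) ?_ hc₀pos (hlow' i hi)
        have h3 := sq_nonneg (|inner ℝ (u s i) (d s)| - |inner ℝ (u s i) (y s q)|)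
        have h4 := sq_abs (inner ℝ (u s i) (d s))
        have h5 := sq_abs (inner ℝ (u s i) (y s q))
        have h6 := abs_nonneg (inner ℝ (u s i) (d s))
        have h7 := abs_nonneg (inner ℝ (u s i) (y s q))
        nlinarith
      · rw [abs_zero]; positivity
    refine h2.trans ?_
    rw [← Finset.sum_div, Finset.sum_add_distrib, ← norm_sq_eq_sum_of_orthonormal (hs s).1,
      ← norm_sq_eq_sum_of_orthonormal (hs s).1, hA]
    have h3 : ‖d s‖ ^ 2 ≤ B ^ 2 := by gcongr
    have := hY q
    gcongr
  set w := ∑ q, co q • y s q with hw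
  have hdw : |inner ℝ (d s) w - ∑ a, inner ℝ (e s a) (d s) * inner ℝ (e s a) w|
      ≤ Fintype.card (Idx n) * A * δ := by
    have h2 : inner ℝ (d s) w - ∑ a, inner ℝ (e s a) (d s) * inner ℝ (e s a) w
        = ∑ q, co q * (inner ℝ (d s) (y s q)
          - ∑ a, inner ℝ (e s a) (d s) * inner ℝ (e s a) (y s q)) := by
      simp_rw [hw, inner_sum, real_inner_smul_right, mul_sub, Finset.sum_sub_distrib,
        Finset.mul_sum]
      rw [Finset.sum_comm]
      congr 1
      exact Finset.sum_congr rfl fun q _ => Finset.sum_congr rfl fun a _ => by ring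
    rw [h2]
    refine (Finset.abs_sum_le_sum_abs _ _).trans ?_
    calc _ ≤ ∑ _q : Idx n, A * δ := by
          refine Finset.sum_le_sum fun q _ => ?_
          rw [abs_mul]
          exact mul_le_mul (hcoA q) (hcr q) (abs_nonneg _) hA0
      _ = _ := by simp; ring
  have hbes : ∑ a, inner ℝ (e s a) w ^ 2 ≤ ‖w‖ ^ 2 := by
    simpa using ho.sum_inner_products_le (x := w) (s := Finset.univ)
  have hexp : ‖d s - w‖ ^ 2 = ‖d s‖ ^ 2 - 2 * inner ℝ (d s) w + ‖w‖ ^ 2 := norm_sub_sq_real _ _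
  have hsq : 0 ≤ ∑ a, (inner ℝ (e s a) (d s) - inner ℝ (e s a) w) ^ 2 :=
    Finset.sum_nonneg fun a _ => sq_nonneg _
  have hsq' : ∑ a, (inner ℝ (e s a) (d s) - inner ℝ (e s a) w) ^ 2
      = ∑ a, inner ℝ (e s a) (d s) ^ 2 - 2 * ∑ a, inner ℝ (e s a) (d s) * inner ℝ (e s a) w
        + ∑ a, inner ℝ (e s a) w ^ 2 := by
    rw [Finset.mul_sum, ← Finset.sum_sub_distrib, ← Finset.sum_add_distrib]
    exact Finset.sum_congr rfl fun a _ => by ring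
  have hδA : Fintype.card (Idx n) * A * δ ≤ c / 4 := by
    rw [hδ, mul_div_assoc', div_le_div_iff₀ (by positivity) (by norm_num)]
    nlinarith
  have h3 := (abs_le.1 hdw).2
  rw [hx, hexp]
  linarith

end Asymptotics

/-! ### Scatter matrices as operators, the data piling direction, and angles to subspaces. -/

section Angle

variable {n : Fin 2 → ℕ} {p : ℕ}

theorem toEuclideanLin_outer (w v : Vec p) :
    Matrix.toEuclideanLin (outer w) v = (inner ℝ w v : ℝ) • w := by
  ext a
  simp only [outer, Matrix.toLpLin_apply, Matrix.mulVec, dotProduct, Matrix.of_apply,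
    PiLp.smul_apply, smul_eq_mul, PiLp.inner_apply, Finset.sum_mul]
  refine Finset.sum_congr rfl fun b _ => ?_
  simp
  ring

/-- The class-centred observations. -/
noncomputable def centredObs (x : (k : Fin 2) → Fin (n k) → Vec p) (q : Idx n) : Vec p :=
  x q.1 q.2 - classMean x q.1

theorem toEuclideanLin_withinScatter (x : (k : Fin 2) → Fin (n k) → Vec p) (v : Vec p) :
    Matrix.toEuclideanLin (withinScatter x) v
      = ∑ q, (inner ℝ (centredObs x q) v : ℝ) • centredObs x q := by
  rw [withinScatter, Fintype.sum_sigma]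
  simp [map_sum, toEuclideanLin_outer, centredObs]

theorem sum_centredObs (hn : ∀ k, 0 < n k) (x : (k : Fin 2) → Fin (n k) → Vec p) (k : Fin 2) :
    ∑ j, centredObs x ⟨k, j⟩ = 0 := by
  have : (n k : ℝ) ≠ 0 := by exact_mod_cast (hn k).ne'
  change ∑ j, (x k j - classMean x k) = 0
  rw [Finset.sum_sub_distrib, Finset.sum_const, Finset.card_univ, Fintype.card_fin, classMean]
  rw [← Nat.cast_smul_eq_nsmul ℝ, smul_smul, mul_inv_cancel₀ this, one_smul, sub_self]

theorem quadForm_withinScatter (x : (k : Fin 2) → Fin (n k) → Vec p) (v : Vec p) :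
    quadForm (withinScatter x) v = ∑ q, inner ℝ (centredObs x q) v ^ 2 := by
  rw [quadForm, toEuclideanLin_withinScatter, inner_sum]
  refine Finset.sum_congr rfl fun q _ => ?_
  rw [real_inner_smul_right, real_inner_comm v, sq]

theorem quadForm_withinScatter_eq_zero_iff (x : (k : Fin 2) → Fin (n k) → Vec p) (v : Vec p) :
    quadForm (withinScatter x) v = 0 ↔ ∀ q, inner ℝ (centredObs x q) v = 0 := by
  rw [quadForm_withinScatter, Finset.sum_eq_zero_iff_of_nonneg fun q _ => sq_nonneg _]
  simp

/-- The total mean is the weighted average of the class means, so `S_B` is a multiple of `d dᵀ`, and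
data piling maximizes `⟪d, w⟫²` on the kernel of `S_W`. -/
theorem quadForm_betweenScatter (hn : ∀ k, 0 < n k) (x : (k : Fin 2) → Fin (n k) → Vec p)
    (v : Vec p) : quadForm (betweenScatter x) v
      = (n 0 * n 1 / (n 0 + n 1) : ℝ) * inner ℝ (meanDiff x) v ^ 2 := by
  have h0 : (0 : ℝ) < n 0 := by exact_mod_cast hn 0
  have h1 : (0 : ℝ) < n 1 := by exact_mod_cast hn 1
  have hs : ∀ k, ∑ j, x k j = (n k : ℝ) • classMean x k := by
    intro k
    have : (n k : ℝ) ≠ 0 := by exact_mod_cast (hn k).ne'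
    rw [classMean, smul_smul, mul_inv_cancel₀ this, one_smul]
  have ht : inner ℝ (totalMean x) v = (n 0 * inner ℝ (classMean x 0) v
      + n 1 * inner ℝ (classMean x 1) v) / (n 0 + n 1 : ℝ) := by
    rw [totalMean]
    simp only [hs, Fin.sum_univ_two, real_inner_smul_left, inner_add_left]
    push_cast
    ring
  rw [quadForm, betweenScatter, map_sum, LinearMap.sum_apply, inner_sum, Fin.sum_univ_two]
  have hq : ∀ (c : ℝ) (w : Vec p),
      inner ℝ v (c • (inner ℝ w v : ℝ) • w) = c * inner ℝ w v ^ 2 := by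
    intro c w
    rw [real_inner_smul_right, real_inner_smul_right, real_inner_comm w, sq]
  simp only [map_smul, LinearMap.smul_apply, toEuclideanLin_outer]
  rw [hq, hq]
  simp only [meanDiff, inner_sub_left, ht]
  field_simp
  ring

theorem isScatterEigen_of_isEigenDecomposition {x : (k : Fin 2) → Fin (n k) → Vec p}
    {lam : Fin p → ℝ} {u : Fin p → Vec p} (h : IsEigenDecomposition (withinScatter x) lam u) :
    IsScatterEigen (fun q => (√(p : ℝ))⁻¹ • centredObs x q) (fun i => lam i / p) u := by
  refine ⟨h.1, fun i j hij => div_le_div_of_nonneg_right (h.2.1 hij) (Nat.cast_nonneg _),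
    fun i => ?_⟩
  have h1 := h.2.2 i
  rw [toEuclideanLin_withinScatter] at h1
  have h2 : (√(p : ℝ))⁻¹ * (√(p : ℝ))⁻¹ = (p : ℝ)⁻¹ := by
    rw [← mul_inv, Real.mul_self_sqrt (Nat.cast_nonneg _)]
  beta_reduce
  rw [div_eq_inv_mul, mul_smul, ← h1, Finset.smul_sum]
  refine Finset.sum_congr rfl fun q _ => ?_
  rw [real_inner_smul_left, smul_smul, smul_smul, ← h2]
  congr 1
  ring

/-- The maximal data piling direction is parallel to the projection of `d` onto the kernel of the
scatter operator. -/
theorem IsScatterEigen.nullPart_mem_span {ι : Type*} [Fintype ι] {y : ι → Vec p}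
    {lam : Fin p → ℝ} {u : Fin p → Vec p} (h : IsScatterEigen y lam u) {K : ℕ}
    (hpos : ∀ i : Fin p, (i : ℕ) < K → 0 < lam i) (hzero : ∀ i : Fin p, K ≤ i → lam i = 0)
    {d w : Vec p} (hw : ‖w‖ = 1) (hyw : ∀ q, inner ℝ (y q) w = 0)
    (hmax : ∀ v : Vec p, ‖v‖ = 1 → (∀ q, inner ℝ (y q) v = 0) →
      inner ℝ d v ^ 2 ≤ inner ℝ d w ^ 2) :
    nullPart K u d ∈ Submodule.span ℝ {w} := by
  set x := nullPart K u d with hx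
  have hux : ∀ i, inner ℝ (u i) x = if (i : ℕ) < K then 0 else inner ℝ (u i) d :=
    fun i => inner_sum_smul_of_orthonormal h.1 _ i
  have huw : ∀ i : Fin p, (i : ℕ) < K → inner ℝ (u i) w = 0 := by
    intro i hi
    have h1 := h.sum_mul_inner i w
    simp only [hyw, mul_zero, Finset.sum_const_zero] at h1
    exact (mul_eq_zero.1 h1.symm).resolve_left (hpos i hi).ne'
  have hdw : inner ℝ d w = inner ℝ x w := by
    rw [← sum_inner_mul_inner_of_orthonormal h.1 d w,
      ← sum_inner_mul_inner_of_orthonormal h.1 x w]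
    refine Finset.sum_congr rfl fun i _ => ?_
    rw [hux]
    split_ifs with hi
    · rw [huw i hi]; ring
    · rfl
  have hdx : inner ℝ d x = ‖x‖ ^ 2 := by
    rw [← sum_inner_mul_inner_of_orthonormal h.1 d x, norm_sq_eq_sum_of_orthonormal h.1]
    refine Finset.sum_congr rfl fun i _ => ?_
    rw [hux]
    split_ifs with hi
    · simp
    · ring
  have hyx : ∀ q, inner ℝ (y q) x = 0 := by
    intro q
    rw [hx, nullPart, inner_sum]
    refine Finset.sum_eq_zero fun i _ => ?_
    rw [real_inner_smul_right]
    split_ifs with hi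
    · simp
    · rw [h.inner_eq_zero (hzero i (not_lt.1 hi)), mul_zero]
  by_cases hx0 : x = 0
  · rw [hx0]; exact Submodule.zero_mem _
  have hxn : ‖x‖ ≠ 0 := norm_ne_zero_iff.2 hx0
  -- Testing maximality against the normalized null part forces equality in Cauchy-Schwarz between
  -- it and `w`.
  have h1 := hmax (‖x‖⁻¹ • x) (by rw [norm_smul, norm_inv, norm_norm, inv_mul_cancel₀ hxn])
    (fun q => by rw [real_inner_smul_right, hyx, mul_zero])
  rw [real_inner_smul_right, hdx, hdw] at h1
  have h2 : ‖x‖⁻¹ * ‖x‖ ^ 2 = ‖x‖ := by field_simp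
  rw [h2] at h1
  have h3 : ‖x - inner ℝ x w • w‖ ^ 2 ≤ 0 := by
    rw [norm_sub_sq_real, norm_smul, real_inner_smul_right, hw, mul_one, Real.norm_eq_abs, sq_abs]
    nlinarith
  have h4 : x - inner ℝ x w • w = 0 := by
    rw [← norm_eq_zero]
    exact pow_eq_zero_iff two_ne_zero |>.1 (le_antisymm h3 (sq_nonneg _))
  rw [Submodule.mem_span_singleton]
  exact ⟨inner ℝ x w, (sub_eq_zero.1 h4).symm⟩

theorem angleToSubspace_eq_arccos (w : Vec p) (V : Submodule ℝ (Vec p)) :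
    angleToSubspace w V = Real.arccos (‖V.starProjection w‖ / ‖w‖) := by
  rw [angleToSubspace, InnerProductGeometry.angle]
  congr 1
  have h1 : inner ℝ w (V.starProjection w) = ‖V.starProjection w‖ ^ 2 := by
    rw [← real_inner_self_eq_norm_sq]
    have := V.starProjection_inner_eq_zero w (V.starProjection w)
      (V.starProjection_apply_mem w)
    rw [inner_sub_left, sub_eq_zero] at this
    exact this
  rw [h1]
  by_cases h0 : ‖V.starProjection w‖ = 0
  · simp [h0]
  · field_simp

theorem angleToSubspace_smul {c : ℝ} (hc : 0 < c) (w : Vec p) (V : Submodule ℝ (Vec p)) :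
    angleToSubspace (c • w) V = angleToSubspace w V := by
  rw [angleToSubspace_eq_arccos, angleToSubspace_eq_arccos, map_smul, norm_smul, norm_smul,
    mul_div_mul_left _ _ (norm_ne_zero_iff.2 hc.ne')]

theorem norm_sq_starProjection (w : Vec p) (V : Submodule ℝ (Vec p)) :
    ‖V.starProjection w‖ ^ 2 = ‖w‖ ^ 2 - ‖w - V.starProjection w‖ ^ 2 := by
  have h := V.starProjection_inner_eq_zero w (V.starProjection w) (V.starProjection_apply_mem w)
  have h2 : ‖w‖ ^ 2 = ‖(w - V.starProjection w) + V.starProjection w‖ ^ 2 := by simp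
  rw [h2, norm_add_sq_real, h]
  ring

theorem angleToSubspace_le_arccos {w z : Vec p} {V : Submodule ℝ (Vec p)} (hz : z ∈ V)
    (hw : w ≠ 0) {ε : ℝ} (hε : ε ≤ 1) (h : ‖w - z‖ ^ 2 ≤ ε * ‖w‖ ^ 2) :
    angleToSubspace w V ≤ Real.arccos (1 - ε) := by
  rw [angleToSubspace_eq_arccos]
  apply Real.arccos_le_arccos
  have hw0 : 0 < ‖w‖ := norm_pos_iff.2 hw
  have h1 : ‖w - V.starProjection w‖ ≤ ‖w - z‖ := by
    rw [V.starProjection_minimal w]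
    exact ciInf_le ⟨0, by rintro _ ⟨x, rfl⟩; exact norm_nonneg _⟩ (⟨z, hz⟩ : V)
  have h2 : (1 - ε) * ‖w‖ ^ 2 ≤ ‖V.starProjection w‖ ^ 2 := by
    rw [norm_sq_starProjection]
    have : ‖w - V.starProjection w‖ ^ 2 ≤ ‖w - z‖ ^ 2 := by gcongr
    linarith
  rw [le_div_iff₀ hw0]
  have hε0 : 0 ≤ ε := by
    by_contra! hneg
    have := sq_nonneg ‖w - z‖
    nlinarith [mul_pos hw0 hw0]
  -- The squared cosine is at least `1 - ε`, and `1 - ε ≥ (1 - ε) ^ 2`.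
  refine le_of_sq_le_sq ?_ (norm_nonneg _)
  nlinarith [mul_nonneg (mul_nonneg (sub_nonneg.2 hε) hε0) (sq_nonneg ‖w‖)]

end Angle

/-! ### Convergence of the angle for a fixed sample point. -/

section Convergence

variable {n : Fin 2 → ℕ}

theorem angleToSubspace_nonneg {p : ℕ} (w : Vec p) (V : Submodule ℝ (Vec p)) :
    0 ≤ angleToSubspace w V :=
  InnerProductGeometry.angle_nonneg _ _

theorem ridgeVector_smul {p : ℕ} (N : ℕ) (α : ℝ) (lam : Fin p → ℝ) (u : Fin p → Vec p)
    (c : ℝ) (d : Vec p) : ridgeVector N α lam u (c • d) = c • ridgeVector N α lam u d := by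
  rw [ridgeVector, ridgeVector, Finset.smul_sum]
  refine Finset.sum_congr rfl fun i _ => ?_
  rw [real_inner_smul_right, smul_smul]
  congr 1
  ring

theorem card_filter_val_lt_le (p K : ℕ) :
    (Finset.univ.filter fun i : Fin p => (i : ℕ) < K).card ≤ K := by
  refine (Finset.card_le_card_of_injOn (t := Finset.range K) (fun i : Fin p => (i : ℕ)) ?_ ?_).trans
    (Finset.card_range K).le
  · intro i hi
    simpa using hi
  · exact Fin.val_injective.injOn

/-- If the ridged coefficients outside `D` are small compared with the null part of `d`, then the
ridge vector makes a small angle with the signal subspace. -/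
theorem angle_ridgeVector_le {p : ℕ} (hp : 0 < p) {N : ℕ} {α : ℝ} {lam : Fin p → ℝ}
    {u : Fin p → Vec p} (hu : Orthonormal ℝ u) {d w : Vec p} {D : Set ℕ}
    (hspan : nullPart (N - 2) u d ∈ Submodule.span ℝ {w}) {ε η : ℝ} (hε : 0 < ε) (hε1 : ε ≤ 1)
    (hco : ∀ i : Fin p, (i : ℕ) < N - 2 → (i : ℕ) + 1 ∉ D →
      |α / (lam i / p + α) * inner ℝ (u i) d| ≤ η)
    (hη : (N : ℝ) * η ^ 2 ≤ ε * ‖nullPart (N - 2) u d‖ ^ 2) (h0 : nullPart (N - 2) u d ≠ 0) :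
    ridgeVector N α lam u d ≠ 0 ∧
      angleToSubspace (ridgeVector N α lam u d) (signalSubspace D u w) ≤ Real.arccos (1 - ε) := by
  classical
  have hp' : (p : ℝ) ≠ 0 := by exact_mod_cast hp.ne'
  set co : Fin p → ℝ := fun i =>
    (if (i : ℕ) < N - 2 then α * p / (lam i + α * p) else 1) * inner ℝ (u i) d with hcodef
  have hR : ridgeVector N α lam u d = ∑ i, co i • u i := rfl
  have hle : ‖nullPart (N - 2) u d‖ ^ 2 ≤ ‖ridgeVector N α lam u d‖ ^ 2 := by
    rw [hR, nullPart, norm_sq_sum_smul_of_orthonormal hu, norm_sq_sum_smul_of_orthonormal hu]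
    refine Finset.sum_le_sum fun i _ => ?_
    simp only [hcodef]
    split_ifs
    · simp [sq_nonneg]
    · rw [one_mul]
  have hnull : 0 < ‖nullPart (N - 2) u d‖ ^ 2 := by positivity
  have hR0 : ridgeVector N α lam u d ≠ 0 := by
    intro h
    rw [h, norm_zero] at hle
    norm_num at hle
    exact h0 hle
  refine ⟨hR0, ?_⟩
  -- The approximant in the signal subspace: the components with index in `D` and the null part are
  -- kept.
  set z : Vec p := ∑ i : Fin p, (if (i : ℕ) < N - 2 ∧ (i : ℕ) + 1 ∈ D then co i else 0) • u i
    + nullPart (N - 2) u d with hz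
  have hzV : z ∈ signalSubspace D u w := by
    refine Submodule.add_mem _ (Submodule.sum_mem _ fun i _ => ?_) ?_
    · split_ifs with hi
      · exact Submodule.smul_mem _ _ (Submodule.subset_span (Or.inl ⟨i, hi.2, rfl⟩))
      · rw [zero_smul]; exact Submodule.zero_mem _
    · exact Submodule.span_mono Set.subset_union_right hspan
  have hdiff : ridgeVector N α lam u d - z
      = ∑ i : Fin p, (if (i : ℕ) < N - 2 ∧ (i : ℕ) + 1 ∉ D then co i else 0) • u i := by
    rw [hz, hR, nullPart, ← Finset.sum_add_distrib, ← Finset.sum_sub_distrib]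
    refine Finset.sum_congr rfl fun i _ => ?_
    rw [← add_smul, ← sub_smul]
    congr 1
    by_cases h1 : (i : ℕ) < N - 2 <;> by_cases h2 : (i : ℕ) + 1 ∈ D <;> simp [h1, h2, hcodef]
  refine angleToSubspace_le_arccos hzV hR0 hε1 ?_
  rw [hdiff, norm_sq_sum_smul_of_orthonormal hu]
  calc ∑ i : Fin p, (if (i : ℕ) < N - 2 ∧ (i : ℕ) + 1 ∉ D then co i else 0) ^ 2
      ≤ ∑ i : Fin p, (if (i : ℕ) < N - 2 then η ^ 2 else 0) := by
        refine Finset.sum_le_sum fun i _ => ?_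
        by_cases h1 : (i : ℕ) < N - 2
        · by_cases h2 : (i : ℕ) + 1 ∈ D
          · simp [h1, h2, sq_nonneg]
          · simp only [h1, h2, not_false_eq_true, and_self, if_true]
            rw [← sq_abs]
            have h3 : co i = α / (lam i / p + α) * inner ℝ (u i) d := by
              simp only [hcodef, h1, if_true]
              congr 1
              have : lam i + α * p = (lam i / p + α) * p := by field_simp
              rw [this, mul_div_mul_right _ _ hp']
            rw [h3]
            have := hco i h1 h2
            gcongr
        · simp [h1]
    _ ≤ N * η ^ 2 := by
        rw [← Finset.sum_filter, Finset.sum_const, nsmul_eq_mul]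
        have h1 : ((Finset.univ.filter fun i : Fin p => (i : ℕ) < N - 2).card : ℝ) ≤ N := by
          exact_mod_cast (card_filter_val_lt_le p (N - 2)).trans (Nat.sub_le _ _)
        exact mul_le_mul_of_nonneg_right h1 (sq_nonneg _)
    _ ≤ ε * ‖nullPart (N - 2) u d‖ ^ 2 := hη
    _ ≤ ε * ‖ridgeVector N α lam u d‖ ^ 2 := by gcongr

/-- The deterministic core: given the limiting Gram matrix along a sequence of dimensions, purity
and the rank bounds, no probability is involved any more. -/
theorem HasGramLimit.tendsto_angle {tail : Fin 2 → ℝ} {M : ℕ} {N : ℕ → ℕ}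
    {x : ∀ s, (k : Fin 2) → Fin (n k) → Vec (N s)} {e : ∀ s, Fin M → Vec (N s)}
    {G : Fin M → Idx n → ℝ}
    (h : HasGramLimit tail (fun s q => (√(N s : ℝ))⁻¹ • centredObs (x s) q) e
      (fun s => (√(N s : ℝ))⁻¹ • meanDiff (x s)) G)
    (hn : ∀ k, 0 < n k) (htail : tail 1 ≤ tail 0) (h1 : 0 < tail 1)
    (hpure : IsPureAt tail G (tail 0)) {ρ ρ₁ : ℕ} (hρ : HasRankBound G ρ)
    (hρ₁ : HasClassOneRankBound G ρ₁) {D : Set ℕ}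
    (hD : ∀ i, i < n 0 + n 1 - 2 → i + 1 ∉ D →
      ρ ≤ i ∧ (i + 1 < n 0 ∨ n 0 + ρ₁ ≤ i + 1 ∨ tail 0 = tail 1))
    {α : ℝ} (hα0 : α ≠ -tail 0) (hα1 : α ≠ -tail 1)
    {lam : ∀ s, Fin (N s) → ℝ} {u : ∀ s, Fin (N s) → Vec (N s)} {w : ∀ s, Vec (N s)}
    (heig : ∀ s, IsEigenDecomposition (withinScatter (x s)) (lam s) (u s))
    (hw : ∀ᶠ s in atTop, IsMaximalDataPiling (x s) (w s)) (hN : ∀ᶠ s in atTop, 0 < N s) :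
    Tendsto (fun s => angleToSubspace
        (ridgeDirection (n 0 + n 1) α (lam s) (u s) (meanDiff (x s)))
        (signalSubspace D (u s) (w s))) atTop (𝓝 0) := by
  have hs := fun s => isScatterEigen_of_isEigenDecomposition (heig s)
  obtain ⟨c, hc, hnull⟩ := h.exists_le_norm_nullPart hs htail h1
  have hacos : Tendsto (fun ε : ℝ => Real.arccos (1 - ε)) (𝓝[>] 0) (𝓝 0) := by
    have : Tendsto (fun ε : ℝ => Real.arccos (1 - ε)) (𝓝 0) (𝓝 (Real.arccos (1 - 0))) :=
      (Real.continuous_arccos.comp (continuous_const.sub continuous_id)).tendsto 0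
    rw [sub_zero, Real.arccos_one] at this
    exact this.mono_left nhdsWithin_le_nhds
  rw [Metric.tendsto_nhds]
  intro r hr
  obtain ⟨ε, ⟨hεr, hε0, hε1⟩⟩ := ((hacos.eventually_lt_const hr).and
    (Ioc_mem_nhdsGT (zero_lt_one' ℝ))).exists
  -- At most `n 0 + n 1` discarded coefficients of size `η` must have total square below `ε` times
  -- the lower bound `c` for the null part.
  set η : ℝ := √(ε * c / ((n 0 + n 1 : ℕ) + 1)) with hη
  have hη0 : 0 < η := by positivity
  filter_upwards [hnull, hw, hN,
    h.eventually_forall_abs_ridge_coef_le hs htail h1 (hn 0) hpure hρ hρ₁ hD hα0 hα1 hη0,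
    h.eventually_tail_one_sub_le hs htail (half_pos h1)] with s hnull hw hN hco hlow
  have hsq : 0 < √(N s : ℝ) := Real.sqrt_pos.2 (by exact_mod_cast hN)
  have hinner : ∀ v : Vec (N s), (∀ q, inner ℝ ((√(N s : ℝ))⁻¹ • centredObs (x s) q) v = 0) ↔
      quadForm (withinScatter (x s)) v = 0 := by
    intro v
    rw [quadForm_withinScatter_eq_zero_iff]
    simp [real_inner_smul_left, hsq.ne']
  have hspan := (hs s).nullPart_mem_span (K := n 0 + n 1 - 2)
    (d := (√(N s : ℝ))⁻¹ • meanDiff (x s))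
    (fun i hi => by linarith [hlow i hi]) (fun i hi => (hs s).eigenvalue_eq_zero
      (fun k => by rw [← Finset.smul_sum, sum_centredObs hn, smul_zero]) hn hi) hw.1
    ((hinner _).2 hw.2.1) (fun v hv hv0 => by
      have h2 := hw.2.2 v hv ((hinner _).1 hv0)
      have hn0 : (0 : ℝ) < n 0 := by exact_mod_cast hn 0
      have hn1 : (0 : ℝ) < n 1 := by exact_mod_cast hn 1
      rw [quadForm_betweenScatter hn, quadForm_betweenScatter hn] at h2
      have h3 := le_of_mul_le_mul_left h2 (by positivity)
      rw [real_inner_smul_left, real_inner_smul_left, mul_pow, mul_pow]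
      gcongr)
  have h0 : nullPart (n 0 + n 1 - 2) (u s) ((√(N s : ℝ))⁻¹ • meanDiff (x s)) ≠ 0 := by
    intro h0
    rw [h0, norm_zero] at hnull
    norm_num at hnull
    linarith
  have hηle : ((n 0 + n 1 : ℕ) : ℝ) * η ^ 2
      ≤ ε * ‖nullPart (n 0 + n 1 - 2) (u s) ((√(N s : ℝ))⁻¹ • meanDiff (x s))‖ ^ 2 := by
    rw [hη, Real.sq_sqrt (by positivity)]
    calc ((n 0 + n 1 : ℕ) : ℝ) * (ε * c / ((n 0 + n 1 : ℕ) + 1)) ≤ ε * c := by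
          rw [mul_div_assoc', div_le_iff₀ (by positivity)]
          nlinarith [mul_pos hε0 hc]
      _ ≤ _ := by gcongr
  obtain ⟨hR0, hangle⟩ := angle_ridgeVector_le (N := n 0 + n 1) (α := α) (D := D) hN (heig s).1
    hspan hε0 hε1 hco hηle h0
  rw [ridgeVector_smul] at hR0 hangle
  rw [angleToSubspace_smul (inv_pos.2 hsq)] at hangle
  have hR : 0 < ‖ridgeVector (n 0 + n 1) α (lam s) (u s) (meanDiff (x s))‖ :=
    norm_pos_iff.2 (smul_ne_zero_iff.1 hR0).2
  rw [Real.dist_eq, sub_zero, ridgeDirection, angleToSubspace_smul (inv_pos.2 hR), abs_of_nonneg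
    (angleToSubspace_nonneg _ _)]
  exact hangle.trans_lt hεr

end Convergence

/-! ### Measurability of the angle. -/

section Measurability

variable {Ω : Type*} [MeasurableSpace Ω] {p : ℕ}

/-- The distance to a span is below `r` exactly when some rational combination of the spanning
vectors is closer than `r`, which is a countable union. No measurable choice of a basis is needed.
-/
theorem measurable_norm_sub_starProjection {ι : Type*} [Fintype ι] {v : Ω → ι → Vec p}
    (hv : ∀ i, Measurable fun ω => v ω i) {w : Ω → Vec p} (hw : Measurable w) :
    Measurable fun ω =>
      ‖w ω - (Submodule.span ℝ (Set.range (v ω))).starProjection (w ω)‖ := by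
  refine measurable_of_Iio fun r => ?_
  have h : (fun ω => ‖w ω - (Submodule.span ℝ (Set.range (v ω))).starProjection (w ω)‖) ⁻¹'
      Set.Iio r = ⋃ c : ι → ℚ, {ω | ‖w ω - ∑ i, (c i : ℝ) • v ω i‖ < r} := by
    ext ω
    simp only [Set.mem_preimage, Set.mem_Iio, Set.mem_iUnion, Set.mem_ofPred_eq]
    constructor
    · intro hlt
      have hmem := (Submodule.span ℝ (Set.range (v ω))).starProjection_apply_mem (w ω)
      obtain ⟨c, hc⟩ := (Submodule.mem_span_range_iff_exists_fun ℝ).1 hmem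
      rw [← hc] at hlt
      have hd : DenseRange (Pi.map fun (_ : ι) (q : ℚ) => (q : ℝ)) :=
        DenseRange.piMap fun _ => Rat.denseRange_cast
      have ho : IsOpen {c : ι → ℝ | ‖w ω - ∑ i, c i • v ω i‖ < r} :=
        isOpen_lt (by fun_prop) continuous_const
      obtain ⟨q, hq⟩ := hd.exists_mem_open ho ⟨c, hlt⟩
      exact ⟨q, hq⟩
    · rintro ⟨c, hc⟩
      refine lt_of_le_of_lt ?_ hc
      rw [Submodule.starProjection_minimal]
      exact ciInf_le ⟨0, by rintro _ ⟨x, rfl⟩; exact norm_nonneg _⟩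
        (⟨∑ i, (c i : ℝ) • v ω i, Submodule.sum_mem _ fun i _ =>
          Submodule.smul_mem _ _ (Submodule.subset_span ⟨i, rfl⟩)⟩ :
          Submodule.span ℝ (Set.range (v ω)))
  rw [h]
  refine MeasurableSet.iUnion fun c => measurableSet_lt ?_ measurable_const
  have hs : Measurable fun ω => ∑ i, (c i : ℝ) • v ω i := by fun_prop
  exact (hw.sub hs).norm

theorem measurable_angleToSubspace_span {ι : Type*} [Fintype ι] {v : Ω → ι → Vec p}
    (hv : ∀ i, Measurable fun ω => v ω i) {w : Ω → Vec p} (hw : Measurable w) :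
    Measurable fun ω => angleToSubspace (w ω) (Submodule.span ℝ (Set.range (v ω))) := by
  have h : ∀ ω, ‖(Submodule.span ℝ (Set.range (v ω))).starProjection (w ω)‖
      = √(‖w ω‖ ^ 2 - ‖w ω - (Submodule.span ℝ (Set.range (v ω))).starProjection (w ω)‖ ^ 2) := by
    intro ω
    rw [← norm_sq_starProjection, Real.sqrt_sq (norm_nonneg _)]
  simp_rw [angleToSubspace_eq_arccos, h]
  have := measurable_norm_sub_starProjection hv hw
  exact Real.continuous_arccos.measurable.comp
    ((((hw.norm.pow_const 2).sub (this.pow_const 2)).sqrt).div hw.norm)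

-- Padding with zero vectors writes the subspace as the span of a family over a fixed finite type,
-- as the measurability of distances to spans requires.
open Classical in
theorem signalSubspace_eq_span_range (D : Set ℕ) (u : Fin p → Vec p) (w : Vec p) :
    signalSubspace D u w = Submodule.span ℝ
      (Set.range fun o : Option (Fin p) =>
        o.elim w fun i => if (i : ℕ) + 1 ∈ D then u i else 0) := by
  refine le_antisymm (Submodule.span_le.2 ?_) (Submodule.span_le.2 ?_)
  · rintro v (⟨i, hi, rfl⟩ | rfl)
    · exact Submodule.subset_span ⟨some i, by simp [hi]⟩
    · exact Submodule.subset_span ⟨none, rfl⟩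
  · rintro _ ⟨o, rfl⟩
    rcases o with _ | i
    · exact Submodule.subset_span (Or.inr rfl)
    · by_cases hi : (i : ℕ) + 1 ∈ D
      · have : u i ∈ signalSubspace D u w := Submodule.subset_span (Or.inl ⟨i, hi, rfl⟩)
        simpa [hi, signalSubspace] using this
      · simp [hi]

theorem measurable_angle_ridgeDirection {n : Fin 2 → ℕ} {x : (k : Fin 2) → Fin (n k) → Ω → Vec p}
    (hx : ∀ k j, Measurable (x k j)) {lam : Ω → Fin p → ℝ} {u : Ω → Fin p → Vec p}
    (hu : ∀ i, Measurable fun ω => u ω i)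
    (heig : ∀ ω, IsEigenDecomposition (withinScatter fun k j => x k j ω) (lam ω) (u ω))
    {w : Ω → Vec p} (hw : Measurable w) (D : Set ℕ) (N : ℕ) (α : ℝ) :
    Measurable fun ω => angleToSubspace
      (ridgeDirection N α (lam ω) (u ω) (meanDiff fun k j => x k j ω))
      (signalSubspace D (u ω) (w ω)) := by
  classical
  have hmean : ∀ k, Measurable fun ω => classMean (fun k j => x k j ω) k := fun k => by
    unfold classMean
    fun_prop
  have hd : Measurable fun ω => meanDiff fun k j => x k j ω := (hmean 0).sub (hmean 1)
  have hlam : ∀ i, Measurable fun ω => lam ω i := by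
    intro i
    -- Measurability of the eigenvalues follows from that of the eigenvectors, through the Rayleigh
    -- quotient.
    have h : (fun ω => lam ω i)
        = fun ω => ∑ q : Idx n, inner ℝ (x q.1 q.2 ω - classMean (fun k j => x k j ω) q.1)
          (u ω i) ^ 2 := by
      ext ω
      have h1 : quadForm (withinScatter fun k j => x k j ω) (u ω i) = lam ω i := by
        rw [quadForm, (heig ω).2.2 i, real_inner_smul_right, real_inner_self_eq_norm_sq,
          (heig ω).1.1 i]
        ring
      rw [← h1, quadForm_withinScatter]
      rfl
    rw [h]
    exact Finset.measurable_sum _ fun q _ =>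
      (((hx q.1 q.2).sub (hmean q.1)).inner (hu i)).pow_const 2
  have hR : Measurable fun ω => ridgeVector N α (lam ω) (u ω) (meanDiff fun k j => x k j ω) := by
    unfold ridgeVector
    refine Finset.measurable_sum _ fun i _ => ?_
    have h1 : Measurable fun ω => if (i : ℕ) < N - 2 then α * p / (lam ω i + α * p) else 1 := by
      split_ifs
      · exact measurable_const.div ((hlam i).add_const _)
      · exact measurable_const
    have h2 : Measurable fun ω => inner ℝ (u ω i) (meanDiff fun k j => x k j ω) := (hu i).inner hd
    exact (h1.mul h2).smul (hu i)
  simp_rw [signalSubspace_eq_span_range]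
  refine measurable_angleToSubspace_span (fun o => ?_) (hR.norm.inv.smul hR)
  rcases o with _ | i
  · exact hw
  · by_cases hi : (i : ℕ) + 1 ∈ D
    · simpa [hi] using hu i
    · simp [hi]

end Measurability

/-! ### Absolute continuity of finite product measures. -/

section Product

/-- Products of absolutely continuous measures are absolutely continuous. -/
theorem pi_absolutelyContinuous_fin {m : ℕ} {α : Fin m → Type*} [∀ i, MeasurableSpace (α i)]
    {μ ν : ∀ i, Measure (α i)} [∀ i, SigmaFinite (μ i)] [∀ i, SigmaFinite (ν i)]
    (h : ∀ i, μ i ≪ ν i) : Measure.pi μ ≪ Measure.pi ν := by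
  induction m with
  | zero => rw [Subsingleton.elim μ ν]
  | succ m ih =>
    have hμ := (measurePreserving_piFinSuccAbove μ 0).symm
    have hν := (measurePreserving_piFinSuccAbove ν 0).symm
    rw [← hμ.map_eq, ← hν.map_eq]
    exact ((h 0).prod (ih fun i => h _)).map (MeasurableEquiv.measurable _)

theorem pi_absolutelyContinuous {ι : Type*} [Fintype ι] {α : ι → Type*}
    [∀ i, MeasurableSpace (α i)] {μ ν : ∀ i, Measure (α i)} [∀ i, SigmaFinite (μ i)]
    [∀ i, SigmaFinite (ν i)] (h : ∀ i, μ i ≪ ν i) : Measure.pi μ ≪ Measure.pi ν := by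
  let e := (Fintype.equivFin ι).symm
  rw [← (measurePreserving_piCongrLeft μ e).map_eq, ← (measurePreserving_piCongrLeft ν e).map_eq]
  exact (pi_absolutelyContinuous_fin fun i => h (e i)).map (MeasurableEquiv.measurable _)

end Product

/-! ### Purity at `tail 0` for all but finitely many scalings of class 1. -/

section Generic

variable {n : Fin 2 → ℕ} {M : ℕ}

/-- Rescaling of the columns that belong to class `1`. -/
def scaleOne (t : ℝ) (G : Fin M → Idx n → ℝ) : Fin M → Idx n → ℝ :=
  fun b q => (if q.1 = 1 then t else 1) * G b q

/-- Let `v` violate purity and let `x` be its image under the scaled `G`. At `tail 0` the equations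
of class 0 say that `x` is orthogonal to the columns of class 0; those of class 1 express `v`
through `x`. Projecting to `Q`, the orthogonal complement of those columns, gives `K x = (c / t²)
x`, where `K` does not depend on `t`. As `K` has finitely many eigenvalues, only finitely many `t >
0` occur. -/
theorem finite_not_isPureAt_scaleOne {tail : Fin 2 → ℝ} (htail : tail 1 < tail 0)
    (G : Fin M → Idx n → ℝ) :
    {t : ℝ | 0 < t ∧ ¬ IsPureAt tail (scaleOne t G) (tail 0)}.Finite := by
  classical
  let c : ℝ := tail 0 - tail 1
  have hc : 0 < c := sub_pos.2 htail
  let g : Idx n → EuclideanSpace ℝ (Fin M) := fun q => WithLp.toLp 2 fun b => G b q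
  let Q : Submodule ℝ (EuclideanSpace ℝ (Fin M)) :=
    (Submodule.span ℝ (Set.range fun j : Fin (n 0) => g ⟨0, j⟩))ᗮ
  let T : EuclideanSpace ℝ (Fin M) →ₗ[ℝ] EuclideanSpace ℝ (Fin M) :=
    ∑ j : Fin (n 1), (innerₗ _ (g ⟨1, j⟩)).smulRight (g ⟨1, j⟩)
  let K : Module.End ℝ Q := (Q.orthogonalProjectionOnto : _ →ₗ[ℝ] Q) ∘ₗ T ∘ₗ Q.subtype
  have hinj : Set.InjOn (fun t : ℝ => c / t ^ 2)
      {t : ℝ | 0 < t ∧ ¬ IsPureAt tail (scaleOne t G) (tail 0)} := by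
    rintro s ⟨hs, -⟩ t ⟨ht, -⟩ hst
    have hst : c / s ^ 2 = c / t ^ 2 := hst
    rw [div_eq_div_iff (by positivity) (by positivity)] at hst
    have h2 := mul_left_cancel₀ hc.ne' hst
    exact ((sq_eq_sq₀ ht.le hs.le).1 h2).symm
  refine Set.Finite.of_finite_image ((Module.End.finite_hasEigenvalue K).subset ?_) hinj
  rintro _ ⟨t, ⟨ht, hnot⟩, rfl⟩
  simp only [IsPureAt, not_forall] at hnot
  obtain ⟨v, hv, b₀, hb₀⟩ := hnot
  let x : EuclideanSpace ℝ (Fin M) := WithLp.toLp 2 fun b => ∑ r, scaleOne t G b r * v r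
  have hx0 : x ≠ 0 := fun h => hb₀ (congrFun (congrArg WithLp.ofLp h) b₀)
  have hin : ∀ q, ∑ b, G b q * x b = inner ℝ (g q) x := by
    intro q
    rw [PiLp.inner_apply]
    refine Finset.sum_congr rfl fun b _ => ?_
    simp [g, mul_comm]
  have h0 : ∀ j, inner ℝ (g ⟨0, j⟩) x = 0 := by
    intro j
    have := hv ⟨0, j⟩
    rw [← hin]
    simpa [scaleOne, x] using this
  have h1 : ∀ j, t * inner ℝ (g ⟨1, j⟩) x = c * v ⟨1, j⟩ := by
    intro j
    have h2 := hv ⟨1, j⟩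
    rw [← hin, Finset.mul_sum]
    simp only [scaleOne, if_true] at h2
    have h3 : ∑ b, t * (G b ⟨1, j⟩ * x b) = ∑ b, t * G b ⟨1, j⟩
        * ∑ r, (if r.1 = 1 then t else 1) * G b r * v r :=
      Finset.sum_congr rfl fun b _ => by rw [mul_assoc]; rfl
    rw [h3]
    simp only [c]
    linear_combination h2
  have hxQ : x ∈ Q := by
    rw [Submodule.mem_orthogonal]
    intro w hw
    induction hw using Submodule.span_induction with
    | mem w hw => obtain ⟨j, rfl⟩ := hw; exact h0 j
    | zero => exact inner_zero_left _
    | add a b _ _ ha hb => rw [inner_add_left, ha, hb, add_zero]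
    | smul r a _ ha => rw [real_inner_smul_left, ha, mul_zero]
  have hxsum : x = ∑ j, v ⟨0, j⟩ • g ⟨0, j⟩ + t • ∑ j, v ⟨1, j⟩ • g ⟨1, j⟩ := by
    ext b
    simp only [x, g, scaleOne, Fintype.sum_sigma, Fin.sum_univ_two, PiLp.add_apply,
      PiLp.smul_apply, smul_eq_mul, WithLp.ofLp_sum, Finset.sum_apply, WithLp.ofLp_smul,
      Pi.smul_apply, Finset.mul_sum]
    congr 1
    · exact Finset.sum_congr rfl fun j _ => by simp [mul_comm]
    · exact Finset.sum_congr rfl fun j _ => by simp; ring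
  have hT : T x = (c / t ^ 2) • (x - ∑ j, v ⟨0, j⟩ • g ⟨0, j⟩) := by
    nth_rewrite 2 [hxsum]
    rw [add_sub_cancel_left, smul_smul, Finset.smul_sum]
    simp only [T, LinearMap.sum_apply, LinearMap.smulRight_apply, innerₗ_apply_apply]
    refine Finset.sum_congr rfl fun j _ => ?_
    rw [smul_smul]
    congr 1
    have := h1 j
    field_simp
    linarith
  refine Module.End.hasEigenvalue_of_hasEigenvector (x := ⟨x, hxQ⟩) ⟨?_, ?_⟩
  · rw [Module.End.mem_eigenspace_iff]
    change Q.orthogonalProjectionOnto (T x) = (c / t ^ 2) • (⟨x, hxQ⟩ : Q)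
    have hz : Q.orthogonalProjectionOnto (∑ j, v ⟨0, j⟩ • g ⟨0, j⟩) = 0 := by
      rw [Submodule.orthogonalProjectionOnto_eq_zero_iff, Submodule.orthogonal_orthogonal]
      exact Submodule.sum_mem _ fun j _ =>
        Submodule.smul_mem _ _ (Submodule.subset_span ⟨j, rfl⟩)
    rw [hT, map_smul, map_sub, hz, sub_zero]
    congr 1
    exact Submodule.orthogonalProjectionOnto_mem_subspace_eq_self (⟨x, hxQ⟩ : Q)
  · intro h
    exact hx0 (congrArg Subtype.val h)

/-- Impurity is witnessed by a unit vector with `∑ (G v)² ≥ 1 / (k + 1)` for some `k`. For fixed `k`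
this is a closed condition on `(G, v)`, and projecting along the compact sphere keeps it closed, so
the complement is a countable union of closed sets. -/
theorem measurableSet_isPureAt (tail : Fin 2 → ℝ) (t : ℝ) :
    MeasurableSet {G : Fin M → Idx n → ℝ | IsPureAt tail G t} := by
  let C : ℕ → Set ((Fin M → Idx n → ℝ) × Metric.sphere (0 : Idx n → ℝ) 1) := fun k =>
    {x | (∀ q, ∑ b, x.1 b q * ∑ r, x.1 b r * x.2.1 r + tail q.1 * x.2.1 q = t * x.2.1 q) ∧
      1 / ((k : ℝ) + 1) ≤ ∑ b, (∑ r, x.1 b r * x.2.1 r) ^ 2}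
  have hC : ∀ k, IsClosed (C k) := by
    intro k
    have hv : Continuous fun x : (Fin M → Idx n → ℝ) × Metric.sphere (0 : Idx n → ℝ) 1 => x.2.1 :=
      continuous_subtype_val.comp continuous_snd
    have hvr : ∀ r, Continuous
        fun x : (Fin M → Idx n → ℝ) × Metric.sphere (0 : Idx n → ℝ) 1 => x.2.1 r :=
      fun r => (continuous_apply r).comp hv
    have hs : ∀ b, Continuous fun x : (Fin M → Idx n → ℝ) × Metric.sphere (0 : Idx n → ℝ) 1 =>
        ∑ r, x.1 b r * x.2.1 r := fun b =>
      continuous_finsetSum _ fun r _ => Continuous.mul (by fun_prop) (hvr r)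
    have h1 : IsClosed {x : (Fin M → Idx n → ℝ) × Metric.sphere (0 : Idx n → ℝ) 1 |
        ∀ q, ∑ b, x.1 b q * ∑ r, x.1 b r * x.2.1 r + tail q.1 * x.2.1 q = t * x.2.1 q} := by
      simp only [Set.ofPred_forall]
      refine isClosed_iInter fun q => isClosed_eq (Continuous.add ?_ ?_) ?_
      · exact continuous_finsetSum _ fun b _ => Continuous.mul (by fun_prop) (hs b)
      · exact continuous_const.mul (hvr q)
      · exact continuous_const.mul (hvr q)
    exact h1.inter (isClosed_le continuous_const
      (continuous_finsetSum _ fun b _ => (hs b).pow 2))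
  have h : {G : Fin M → Idx n → ℝ | IsPureAt tail G t}ᶜ = ⋃ k, Prod.fst '' C k := by
    ext G
    simp only [Set.mem_compl_iff, Set.mem_ofPred_eq, Set.mem_iUnion, Set.mem_image, Prod.exists,
      exists_and_right, exists_eq_right]
    constructor
    · intro hG
      simp only [IsPureAt, not_forall] at hG
      obtain ⟨v, hv, b, hb⟩ := hG
      have hv0 : ‖v‖ ≠ 0 := by
        intro h0
        rw [norm_eq_zero] at h0
        simp [h0] at hb
      let w : Idx n → ℝ := ‖v‖⁻¹ • v
      have hw : ∀ b, ∑ r, G b r * w r = ‖v‖⁻¹ * ∑ r, G b r * v r := by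
        intro b
        rw [Finset.mul_sum]
        exact Finset.sum_congr rfl fun r _ => by simp [w]; ring
      have hpos : 0 < ∑ b, (∑ r, G b r * w r) ^ 2 := by
        refine Finset.sum_pos' (fun b _ => sq_nonneg _) ⟨b, Finset.mem_univ _, ?_⟩
        rw [hw]
        have := mul_ne_zero (inv_ne_zero hv0) hb
        positivity
      obtain ⟨k, hk⟩ := exists_nat_one_div_lt hpos
      refine ⟨k, ⟨w, ?_⟩, fun q => ?_, hk.le⟩
      · simp [w, norm_smul, hv0]
      · simp only [hw]
        have h2 := hv q
        have h3 : ∑ b, G b q * (‖v‖⁻¹ * ∑ r, G b r * v r)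
            = ‖v‖⁻¹ * ∑ b, G b q * ∑ r, G b r * v r := by
          rw [Finset.mul_sum]
          exact Finset.sum_congr rfl fun b _ => by ring
        rw [h3]
        simp only [w, Pi.smul_apply, smul_eq_mul]
        linear_combination ‖v‖⁻¹ * h2
    · rintro ⟨k, v, hv, hk⟩ hG
      have := hG v.1 hv
      simp only [this] at hk
      have h4 : (0 : ℝ) < 1 / ((k : ℝ) + 1) := by positivity
      norm_num at hk
      linarith
  rw [← MeasurableSet.compl_iff, h]
  exact MeasurableSet.iUnion fun k => (isClosedMap_fst_of_compactSpace _ (hC k)).measurableSet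

end Generic

/-! ### Almost sure purity of the data. -/

section GenericSample

variable {n : Fin 2 → ℕ} {M : ℕ}

/-- The leading coordinates of class-centred observations. -/
noncomputable def leadingCoord {p : ℕ} (L : Fin 2 → Vec p →ₗ[ℝ] (Fin M → ℝ)) (x : Idx n → Vec p) :
    Fin M → Idx n → ℝ :=
  fun b q => L q.1 (centredObs (fun k j => x ⟨k, j⟩) q) b

theorem continuous_leadingCoord {p : ℕ} (L : Fin 2 → Vec p →ₗ[ℝ] (Fin M → ℝ)) :
    Continuous (leadingCoord (n := n) L) := by
  refine continuous_pi fun b => continuous_pi fun q => (continuous_apply b).comp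
    ((L q.1).continuous_of_finiteDimensional.comp ?_)
  unfold centredObs classMean
  fun_prop

/-- Multiplication of the observations of class `1` by `t`. -/
def scaleObs (n : Fin 2 → ℕ) (p : ℕ) (t : ℝ) : (Idx n → Vec p) →ₗ[ℝ] (Idx n → Vec p) :=
  LinearMap.pi fun q => (if q.1 = 1 then t else 1) • LinearMap.proj q

theorem scaleObs_apply {p : ℕ} (t : ℝ) (x : Idx n → Vec p) (q : Idx n) :
    scaleObs n p t x q = (if q.1 = 1 then t else 1) • x q := by
  simp only [scaleObs, LinearMap.pi_apply, LinearMap.smul_apply, LinearMap.proj_apply]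

theorem scaleObs_scaleObs {p : ℕ} {t : ℝ} (ht : t ≠ 0) (x : Idx n → Vec p) :
    scaleObs n p t (scaleObs n p t⁻¹ x) = x := by
  ext1 q
  rw [scaleObs_apply, scaleObs_apply, smul_smul]
  split_ifs
  · rw [mul_inv_cancel₀ ht, one_smul]
  · simp

theorem leadingCoord_scaleObs {p : ℕ} (L : Fin 2 → Vec p →ₗ[ℝ] (Fin M → ℝ)) (t : ℝ)
    (x : Idx n → Vec p) :
    leadingCoord L (scaleObs n p t x) = scaleOne t (leadingCoord L x) := by
  ext b q
  have h : centredObs (fun k j => scaleObs n p t x ⟨k, j⟩) q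
      = (if q.1 = 1 then t else 1) • centredObs (fun k j => x ⟨k, j⟩) q := by
    simp only [centredObs, classMean, scaleObs_apply, smul_sub]
    congr 1
    rw [smul_comm _ (n q.1 : ℝ)⁻¹]
    simp only [Finset.smul_sum]
  simp only [leadingCoord, scaleOne, h, map_smul, Pi.smul_apply, smul_eq_mul]

/-- For each sample almost every scale `t > 0` is pure. By Fubini some fixed `t > 0` is pure for
almost every sample, and the invertible linear rescaling by `t⁻¹` preserves null sets, which removes
the factor. -/
theorem ae_volume_isPureAt {p : ℕ} (L : Fin 2 → Vec p →ₗ[ℝ] (Fin M → ℝ)) {tail : Fin 2 → ℝ}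
    (htail : tail 1 < tail 0) :
    ∀ᵐ x : Idx n → Vec p, IsPureAt tail (leadingCoord L x) (tail 0) := by
  have hmeas : MeasurableSet {x : (Idx n → Vec p) × ℝ |
      0 < x.2 → IsPureAt tail (leadingCoord L (scaleObs n p x.2 x.1)) (tail 0)} := by
    have hc : Measurable fun x : (Idx n → Vec p) × ℝ =>
        leadingCoord L (scaleObs n p x.2 x.1) := by
      refine (continuous_leadingCoord L).measurable.comp (measurable_pi_lambda _ fun q => ?_)
      simp_rw [scaleObs_apply]
      split_ifs
      · exact measurable_snd.smul ((measurable_pi_apply q).comp measurable_fst)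
      · simp only [one_smul]
        exact (measurable_pi_apply q).comp measurable_fst
    have h1 := hc (measurableSet_isPureAt tail (tail 0))
    have h2 : MeasurableSet {x : (Idx n → Vec p) × ℝ | 0 < x.2} :=
      measurableSet_lt measurable_const measurable_snd
    exact h2.imp h1
  have hsec : ∀ᵐ x : Idx n → Vec p, ∀ᵐ t : ℝ,
      0 < t → IsPureAt tail (leadingCoord L (scaleObs n p t x)) (tail 0) := by
    refine Eventually.of_forall fun x => ?_
    have hfin := finite_not_isPureAt_scaleOne htail (leadingCoord L x)
    refine measure_mono_null ?_ (hfin.measure_zero volume)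
    intro t ht
    simpa [leadingCoord_scaleObs] using ht
  rw [Measure.ae_ae_comm hmeas] at hsec
  obtain ⟨t, ht, ht0⟩ : ∃ t : ℝ, (∀ᵐ x : Idx n → Vec p,
      0 < t → IsPureAt tail (leadingCoord L (scaleObs n p t x)) (tail 0)) ∧ 0 < t := by
    by_contra! hcon
    have : ∀ᵐ t : ℝ, t ≤ 0 := hsec.mono hcon
    rw [ae_iff] at this
    simp only [not_le] at this
    have h3 : volume (Set.Ioi (0 : ℝ)) = 0 := this
    simp at h3
  have hdet : LinearMap.det (scaleObs n p t⁻¹) ≠ 0 := by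
    have h4 : scaleObs n p t ∘ₗ scaleObs n p t⁻¹ = LinearMap.id :=
      LinearMap.ext fun x => scaleObs_scaleObs ht0.ne' x
    have h5 := congrArg LinearMap.det h4
    rw [LinearMap.det_comp, LinearMap.det_id] at h5
    exact right_ne_zero_of_mul (h5.trans_ne one_ne_zero)
  have hq := Measure.LinearMap.quasiMeasurePreserving (volume : Measure (Idx n → Vec p)) _ hdet
  filter_upwards [hq.ae ht] with x hx
  simpa [scaleObs_scaleObs ht0.ne'] using hx ht0

/-- By independence the joint law is a product of absolutely continuous laws. If the tails agree,
purity at `tail 0` is purity at `tail 1`, which always holds. -/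
theorem ae_isPureAt {Ω : Type*} [MeasurableSpace Ω] {P : Measure Ω} {p : ℕ}
    {X : (k : Fin 2) → Fin (n k) → Ω → Vec p} {mu : Fin 2 → Vec p}
    {Sig : Fin 2 → Matrix (Fin p) (Fin p) ℝ} (hX : IsTrainingSample P X mu Sig)
    (L : Fin 2 → Vec p →ₗ[ℝ] (Fin M → ℝ)) {tail : Fin 2 → ℝ} (htail : tail 1 ≤ tail 0) :
    ∀ᵐ ω ∂P, IsPureAt tail (leadingCoord (n := n) L fun q => X q.1 q.2 ω) (tail 0) := by
  rcases htail.lt_or_eq with hlt | heq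
  · have hm : ∀ q : Idx n, AEMeasurable (X q.1 q.2) P := fun q => (hX.measurable _ _).aemeasurable
    have := hX.indep.isProbabilityMeasure
    have : ∀ q : Idx n, IsProbabilityMeasure (P.map (X q.1 q.2)) :=
      fun q => Measure.isProbabilityMeasure_map (hm q)
    have hac : P.map (fun ω (q : Idx n) => X q.1 q.2 ω) ≪ volume := by
      rw [hX.indep.map_fun_eq_pi_map hm]
      exact pi_absolutelyContinuous fun q => hX.absCont q.1 q.2
    exact ae_of_ae_map (aemeasurable_pi_lambda _ hm) (hac.ae_le (ae_volume_isPureAt L hlt))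
  · exact Eventually.of_forall fun ω => by
      rw [← heq]
      exact isPureAt_tail_one htail

end GenericSample

/-! ### A weighted law of large numbers for ρ-mixing sequences. -/

section MixingLLN

variable {Ω : Type*} {mΩ : MeasurableSpace Ω} {P : Measure Ω} [IsProbabilityMeasure P]

theorem abs_covariance_le_add_variance {f g : Ω → ℝ} (hf : MemLp f 2 P) (hg : MemLp g 2 P) :
    |cov[f, g; P]| ≤ (Var[f; P] + Var[g; P]) / 2 := by
  have h1 := variance_add hf hg
  have h2 := variance_sub hf hg
  have h3 := variance_nonneg (f + g) P
  have h4 := variance_nonneg (f - g) P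
  rw [abs_le]
  constructor <;> linarith

theorem covariance_eq_zero_of_variance_eq_zero {f g : Ω → ℝ} (hf : MemLp f 2 P)
    (h : Var[f; P] = 0) : cov[f, g; P] = 0 := by
  rw [covariance]
  refine integral_eq_zero_of_ae ?_
  filter_upwards [ae_eq_integral_of_variance_eq_zero hf h] with ω hω
  simp [hω]

theorem abs_covariance_le_of_maxCorr_le {A B : MeasurableSpace Ω} {f g : Ω → ℝ}
    (hfA : Measurable[A] f) (hgB : Measurable[B] g) (hf : MemLp f 2 P) (hg : MemLp g 2 P)
    {ε : ℝ} (hε : 0 ≤ ε) (h : maxCorr P A B ≤ ENNReal.ofReal ε) :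
    |cov[f, g; P]| ≤ ε * (√(Var[f; P]) * √(Var[g; P])) := by
  have hcorr : |corr P f g| ≤ ε := by
    rw [← ENNReal.ofReal_le_ofReal_iff hε]
    refine le_trans ?_ h
    unfold maxCorr
    exact le_iSup_of_le f <| le_iSup_of_le g <| le_iSup_of_le hfA <| le_iSup_of_le hgB <|
      le_iSup_of_le hf <| le_iSup_of_le hg le_rfl
  -- With a vanishing variance `corr` is 0 by convention and carries no information, but the
  -- covariance vanishes as well.
  by_cases hf0 : Var[f; P] = 0
  · simp [covariance_eq_zero_of_variance_eq_zero hf hf0, hf0]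
  by_cases hg0 : Var[g; P] = 0
  · simp [covariance_comm f g, covariance_eq_zero_of_variance_eq_zero hg hg0, hg0]
  have h1 : 0 < √(Var[f; P]) * √(Var[g; P]) :=
    mul_pos (Real.sqrt_pos.2 ((variance_nonneg f P).lt_of_ne' hf0))
      (Real.sqrt_pos.2 ((variance_nonneg g P).lt_of_ne' hg0))
  rwa [corr, abs_div, abs_of_pos h1, div_le_iff₀ h1] at hcorr

theorem abs_covariance_le_of_rhoCoeff_le {Z : ℕ → Ω → ℝ} {φ : ℝ → ℝ} (hφ : Measurable φ)
    (hZ : ∀ i, MemLp (fun ω => φ (Z i ω)) 2 P) {V : ℝ}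
    (hV : ∀ i, Var[fun ω => φ (Z i ω); P] ≤ V) {l : ℕ} {ε : ℝ} (hε : 0 ≤ ε)
    (h : rhoCoeff P Z l ≤ ENNReal.ofReal ε) {i j : ℕ} (hij : i + l ≤ j) :
    |cov[fun ω => φ (Z i ω), fun ω => φ (Z j ω); P]| ≤ ε * V := by
  have hA : Measurable[⨆ (i' : ℕ) (_ : i' ≤ i), MeasurableSpace.comap (Z i') inferInstance]
      fun ω => φ (Z i ω) :=
    hφ.comp ((comap_measurable (Z i)).mono (le_iSup₂_of_le i le_rfl le_rfl) le_rfl)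
  have hB : Measurable[⨆ (i' : ℕ) (_ : i + l ≤ i'), MeasurableSpace.comap (Z i') inferInstance]
      fun ω => φ (Z j ω) :=
    hφ.comp ((comap_measurable (Z j)).mono (le_iSup₂_of_le j hij le_rfl) le_rfl)
  have h1 := abs_covariance_le_of_maxCorr_le hA hB (hZ i) (hZ j) hε
    (le_trans (le_iSup (fun j : ℕ => maxCorr P
      (⨆ (i : ℕ) (_ : i ≤ j), MeasurableSpace.comap (Z i) inferInstance)
      (⨆ (i : ℕ) (_ : j + l ≤ i), MeasurableSpace.comap (Z i) inferInstance)) i) h)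
  refine h1.trans (mul_le_mul_of_nonneg_left ?_ hε)
  have h2 := Real.sqrt_le_sqrt (hV i)
  have h3 := Real.sqrt_le_sqrt (hV j)
  calc _ ≤ √V * √V := mul_le_mul h2 h3 (Real.sqrt_nonneg _) (Real.sqrt_nonneg _)
    _ = V := Real.mul_self_sqrt ((variance_nonneg _ P).trans (hV i))

theorem card_filter_lag_lt_le (π : Equiv.Perm ℕ) (p l i : ℕ) :
    ((Finset.range p).filter fun j => ¬ (π i + l ≤ π j) ∧ ¬ (π j + l ≤ π i)).card ≤ 2 * l := by
  refine (Finset.card_le_card_of_injOn (t := Finset.Ico (π i + 1 - l) (π i + l)) π ?_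
    π.injective.injOn).trans ?_
  · intro j hj
    simp only [Finset.coe_filter, Set.mem_ofPred_eq] at hj
    simp only [Finset.coe_Ico, Set.mem_Ico]
    omega
  · rw [Nat.card_Ico]
    omega

/-- A weak law of large numbers for weighted sums of a permuted `ρ`-mixing sequence. -/
theorem tendsto_variance_sum_of_isRhoMixing {z : ℕ → Ω → ℝ} {φ : ℝ → ℝ} (hφ : Measurable φ)
    (hz : ∀ i, MemLp (fun ω => φ (z i ω)) 2 P) {V : ℝ}
    (hV : ∀ i, Var[fun ω => φ (z i ω); P] ≤ V) {perm : Equiv.Perm ℕ}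
    (hmix : IsRhoMixing P fun i => z (perm i)) {w : ℕ → ℕ → ℝ} (hw : ∀ p i, 0 ≤ w p i)
    {b : ℕ → ℝ} (hb : Tendsto b atTop (𝓝 0)) (hwb : ∀ p, ∀ i < p, w p i ≤ b p) {S : ℝ}
    (hS : ∀ᶠ p in atTop, ∑ i ∈ Finset.range p, w p i ≤ S) :
    Tendsto (fun p => Var[fun ω => ∑ i ∈ Finset.range p, w p i * φ (z i ω); P])
      atTop (𝓝 0) := by
  have hV0 : 0 ≤ V := (variance_nonneg _ P).trans (hV 0)
  have hS0 : 0 ≤ S := by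
    obtain ⟨p, hp⟩ := hS.exists
    exact (Finset.sum_nonneg fun i _ => hw p i).trans hp
  rw [Metric.tendsto_nhds]
  intro r hr
  -- Far pairs contribute at most `S * S * V * ε ≤ r / 2`; the near pairs get the other half through
  -- `b p → 0`.
  set ε : ℝ := r / (2 * (S * S * V + 1)) with hε
  have hε0 : 0 < ε := by positivity
  obtain ⟨l, hl⟩ := (hmix.eventually_lt_const (ENNReal.ofReal_pos.2 hε0)).exists
  have hb' : ∀ᶠ p in atTop, S * V * (2 * l) * b p < r / 2 := by
    have : Tendsto (fun p => S * V * (2 * l) * b p) atTop (𝓝 (S * V * (2 * l) * 0)) :=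
      hb.const_mul _
    rw [mul_zero] at this
    exact this.eventually_lt_const (half_pos hr)
  filter_upwards [hS, hb', eventually_gt_atTop 0] with p hS hb' hp
  have hb0 : 0 ≤ b p := (hw p 0).trans (hwb p 0 hp)
  have hcov : ∀ i j, |cov[fun ω => φ (z i ω), fun ω => φ (z j ω); P]| ≤ V := fun i j =>
    (abs_covariance_le_add_variance (hz i) (hz j)).trans (by linarith [hV i, hV j])
  have hcov' : ∀ i j, perm.symm i + l ≤ perm.symm j →
      |cov[fun ω => φ (z i ω), fun ω => φ (z j ω); P]| ≤ ε * V := by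
    intro i j hij
    have := abs_covariance_le_of_rhoCoeff_le (P := P) (Z := fun i => z (perm i)) hφ
      (fun i => hz _) (fun i => hV _) hε0.le hl.le hij
    simpa using this
  -- Split by the distance of the permuted positions. At most `2 * l` indices are nearer than `l`,
  -- each of weight at most `b p`; for the others mixing bounds the covariance by `ε * V`.
  have hsum : ∀ i, ∑ j ∈ Finset.range p,
      w p j * |cov[fun ω => φ (z i ω), fun ω => φ (z j ω); P]|
        ≤ b p * V * (2 * l) + S * (ε * V) := by
    intro i
    rw [← Finset.sum_filter_add_sum_filter_not (Finset.range p)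
      (fun j => ¬ (perm.symm i + l ≤ perm.symm j) ∧ ¬ (perm.symm j + l ≤ perm.symm i))]
    refine add_le_add ?_ ?_
    · calc _ ≤ ∑ j ∈ (Finset.range p).filter
            (fun j => ¬ (perm.symm i + l ≤ perm.symm j) ∧ ¬ (perm.symm j + l ≤ perm.symm i)),
            b p * V := by
            refine Finset.sum_le_sum fun j hj => ?_
            have hjp := Finset.mem_range.1 (Finset.mem_filter.1 hj).1
            exact mul_le_mul (hwb p j hjp) (hcov i j) (abs_nonneg _) hb0
        _ ≤ (2 * l : ℕ) * (b p * V) := by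
            rw [Finset.sum_const, nsmul_eq_mul]
            refine mul_le_mul_of_nonneg_right ?_ (by positivity)
            exact_mod_cast card_filter_lag_lt_le perm.symm p l i
        _ = b p * V * (2 * l) := by push_cast; ring
    · calc _ ≤ ∑ j ∈ (Finset.range p).filter
            (fun j => ¬ (¬ (perm.symm i + l ≤ perm.symm j) ∧
              ¬ (perm.symm j + l ≤ perm.symm i))), w p j * (ε * V) := by
            refine Finset.sum_le_sum fun j hj => ?_
            have hj' := (Finset.mem_filter.1 hj).2
            refine mul_le_mul_of_nonneg_left ?_ (hw p j)
            rw [not_and_or, not_not, not_not] at hj'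
            rcases hj' with h | h
            · exact hcov' i j h
            · rw [covariance_comm]
              exact hcov' j i h
        _ ≤ ∑ j ∈ Finset.range p, w p j * (ε * V) :=
            Finset.sum_le_sum_of_subset_of_nonneg (Finset.filter_subset _ _)
              fun j _ _ => mul_nonneg (hw p j) (by positivity)
        _ ≤ S * (ε * V) := by
            rw [← Finset.sum_mul]
            exact mul_le_mul_of_nonneg_right hS (by positivity)
  have hwz : ∀ i ∈ Finset.range p, MemLp (fun ω => w p i * φ (z i ω)) 2 P :=
    fun i _ => (hz i).const_mul _
  have hvar : Var[fun ω => ∑ i ∈ Finset.range p, w p i * φ (z i ω); P]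
      ≤ S * (b p * V * (2 * l) + S * (ε * V)) := by
    rw [variance_fun_sum' hwz]
    calc _ ≤ ∑ i ∈ Finset.range p, w p i * ∑ j ∈ Finset.range p,
          w p j * |cov[fun ω => φ (z i ω), fun ω => φ (z j ω); P]| := by
          refine Finset.sum_le_sum fun i _ => ?_
          rw [Finset.mul_sum]
          refine Finset.sum_le_sum fun j _ => ?_
          rw [covariance_const_mul_left, covariance_const_mul_right]
          exact mul_le_mul_of_nonneg_left (mul_le_mul_of_nonneg_left (le_abs_self _) (hw p j))
            (hw p i)
      _ ≤ ∑ i ∈ Finset.range p, w p i * (b p * V * (2 * l) + S * (ε * V)) :=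
          Finset.sum_le_sum fun i _ => mul_le_mul_of_nonneg_left (hsum i) (hw p i)
      _ ≤ S * (b p * V * (2 * l) + S * (ε * V)) := by
          rw [← Finset.sum_mul]
          exact mul_le_mul_of_nonneg_right hS (by positivity)
  rw [Real.dist_eq, sub_zero, abs_of_nonneg (variance_nonneg _ _)]
  have hεle : S * S * V * ε ≤ r / 2 := by
    rw [hε, mul_div_assoc', div_le_div_iff₀ (by positivity) (by norm_num)]
    nlinarith [mul_nonneg (mul_nonneg hS0 hS0) hV0]
  calc _ ≤ S * (b p * V * (2 * l) + S * (ε * V)) := hvar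
    _ = S * V * (2 * l) * b p + S * S * V * ε := by ring
    _ < r := by linarith

end MixingLLN

/-! ### Inner products of uncorrelated noise with an independent vector. -/

section Uncorrelated

variable {Ω : Type*} {mΩ : MeasurableSpace Ω} {P : Measure Ω}

/-- The second moment of `⟪∑ c i z i u i, f⟫` for uncorrelated standardized `z` that are independent
of `f`. -/
theorem integral_inner_sum_sq {p : ℕ} {u : Fin p → Vec p} {z : Fin p → Ω → ℝ}
    (hz : ∀ i, MemLp (z i) 2 P) (hzz : ∀ i j, ∫ ω, z i ω * z j ω ∂P = if i = j then 1 else 0)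
    {f : Ω → Vec p} (hf : MemLp f 2 P) (hind : IndepFun (fun ω i => z i ω) f P)
    (c : Fin p → ℝ) :
    Integrable (fun ω => inner ℝ (∑ i, (c i * z i ω) • u i) (f ω) ^ 2) P ∧
    ∫ ω, inner ℝ (∑ i, (c i * z i ω) • u i) (f ω) ^ 2 ∂P
      = ∑ i, c i ^ 2 * ∫ ω, inner ℝ (u i) (f ω) ^ 2 ∂P := by
  have huf : ∀ i, MemLp (fun ω => inner ℝ (u i) (f ω)) 2 P := fun i => hf.const_inner (u i)
  have hexp : ∀ ω, inner ℝ (∑ i, (c i * z i ω) • u i) (f ω) ^ 2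
      = ∑ i, ∑ j, c i * c j * ((z i ω * z j ω) * (inner ℝ (u i) (f ω) * inner ℝ (u j) (f ω))) := by
    intro ω
    rw [sum_inner, sq, Finset.sum_mul_sum]
    refine Finset.sum_congr rfl fun i _ => Finset.sum_congr rfl fun j _ => ?_
    rw [real_inner_smul_left, real_inner_smul_left]
    ring
  have hzij : ∀ i j, Integrable (fun ω => z i ω * z j ω) P :=
    fun i j => (hz i).integrable_mul (hz j)
  have hfij : ∀ i j, Integrable (fun ω => inner ℝ (u i) (f ω) * inner ℝ (u j) (f ω)) P :=
    fun i j => (huf i).integrable_mul (huf j)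
  have hindij : ∀ i j, IndepFun (fun ω => z i ω * z j ω)
      (fun ω => inner ℝ (u i) (f ω) * inner ℝ (u j) (f ω)) P := by
    intro i j
    have h1 : Measurable fun x : Fin p → ℝ => x i * x j :=
      (measurable_pi_apply i).mul (measurable_pi_apply j)
    have h2 : Measurable fun x : Vec p => inner ℝ (u i) x * inner ℝ (u j) x :=
      (measurable_const.inner measurable_id).mul (measurable_const.inner measurable_id)
    exact hind.comp h1 h2
  have hint : ∀ i j, Integrable (fun ω => c i * c j * ((z i ω * z j ω)
      * (inner ℝ (u i) (f ω) * inner ℝ (u j) (f ω)))) P :=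
    fun i j => ((hindij i j).integrable_mul (hzij i j) (hfij i j)).const_mul _
  simp_rw [hexp]
  refine ⟨integrable_finsetSum _ fun i _ => integrable_finsetSum _ fun j _ => hint i j, ?_⟩
  rw [integral_finsetSum _ fun i _ => integrable_finsetSum _ fun j _ => hint i j]
  refine Finset.sum_congr rfl fun i _ => ?_
  rw [integral_finsetSum _ fun j _ => hint i j, Finset.sum_eq_single i]
  · rw [integral_const_mul, (hindij i i).integral_fun_mul_eq_mul_integral
      (hzij i i).aestronglyMeasurable (hfij i i).aestronglyMeasurable, hzz, if_pos rfl, one_mul]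
    simp_rw [sq]
  · intro j _ hji
    rw [integral_const_mul, (hindij i j).integral_fun_mul_eq_mul_integral
      (hzij i j).aestronglyMeasurable (hfij i j).aestronglyMeasurable, hzz, if_neg hji.symm,
      zero_mul, mul_zero]
  · simp

theorem integral_inner_sum_sq_le {p : ℕ} {u : Fin p → Vec p} (hu : Orthonormal ℝ u)
    {z : Fin p → Ω → ℝ}
    (hz : ∀ i, MemLp (z i) 2 P) (hzz : ∀ i j, ∫ ω, z i ω * z j ω ∂P = if i = j then 1 else 0)
    {f : Ω → Vec p} (hf : MemLp f 2 P) (hind : IndepFun (fun ω i => z i ω) f P)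
    {c : Fin p → ℝ} {b : ℝ} (hc : ∀ i, c i ^ 2 ≤ b) :
    ∫ ω, inner ℝ (∑ i, (c i * z i ω) • u i) (f ω) ^ 2 ∂P ≤ b * ∫ ω, ‖f ω‖ ^ 2 ∂P := by
  have huf : ∀ i, Integrable (fun ω => inner ℝ (u i) (f ω) ^ 2) P :=
    fun i => (hf.const_inner (u i)).integrable_sq
  rw [(integral_inner_sum_sq hz hzz hf hind c).2]
  simp_rw [norm_sq_eq_sum_of_orthonormal hu]
  rw [integral_finsetSum _ fun i _ => huf i, Finset.mul_sum]
  exact Finset.sum_le_sum fun i _ => mul_le_mul_of_nonneg_right (hc i)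
    (integral_nonneg fun ω => sq_nonneg _)

end Uncorrelated

/-! ### The eigenvalues outside the strong spikes. -/

section Weights

variable {m : Fin 2 → ℕ} {β : Fin 2 → ℝ} {sigSq tauSq : Fin 2 → ℕ → ℝ} {tail : Fin 2 → ℝ}
  {lam : ∀ _p : ℕ, Fin 2 → ℕ → ℝ}

open Classical in
/-- The scaled eigenvalues outside the strong spikes. -/
noncomputable def noiseWeight (m : Fin 2 → ℕ) (β : Fin 2 → ℝ) (lam : ∀ _p : ℕ, Fin 2 → ℕ → ℝ)
    (k : Fin 2) (p i : ℕ) : ℝ :=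
  if i < p ∧ ¬ (β k = 1 ∧ i < m k) then lam p k i / p else 0

namespace SpikedEigenvalues

theorem lam_pos (h : SpikedEigenvalues m β sigSq tauSq tail lam) {p i : ℕ} (hi : i < p)
    (k : Fin 2) : 0 < lam p k i := by
  by_cases him : i < m k
  · rw [h.spike p k i hi him]
    have h1 := h.sigSq_pos k i him
    have h2 := h.tauSq_pos k i
    have h3 : (0 : ℝ) ≤ (p : ℝ) ^ β k := Real.rpow_nonneg (Nat.cast_nonneg _) _
    positivity
  · rw [h.nonspike p k i hi (not_lt.1 him)]
    exact h.tauSq_pos k i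

theorem noiseWeight_nonneg (h : SpikedEigenvalues m β sigSq tauSq tail lam) (k : Fin 2)
    (p i : ℕ) : 0 ≤ noiseWeight m β lam k p i := by
  unfold noiseWeight
  split_ifs with hi
  · exact div_nonneg (h.lam_pos hi.1 k).le (Nat.cast_nonneg _)
  · exact le_rfl

theorem tendsto_rpow_div (h : SpikedEigenvalues m β sigSq tauSq tail lam) {k : Fin 2}
    (hβ : β k ≠ 1) : Tendsto (fun p : ℕ => (p : ℝ) ^ β k / p) atTop (𝓝 0) := by
  have h1 : 0 < 1 - β k := sub_pos.2 ((h.beta_mem k).2.lt_of_ne hβ)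
  refine ((tendsto_rpow_neg_atTop h1).comp tendsto_natCast_atTop_atTop).congr' ?_
  filter_upwards [eventually_gt_atTop 0] with p hp
  have hp' : (0 : ℝ) < p := by exact_mod_cast hp
  rw [Function.comp_apply, neg_sub, Real.rpow_sub_one hp'.ne']

/-- Without the spikes of order `p`, the eigenvalues are uniformly `o(p)`: they are bounded, or of
order `p ^ β k` with `β k < 1`. This smallness of the largest weight drives every limit for the bulk
noise. -/
theorem exists_noiseWeight_le (h : SpikedEigenvalues m β sigSq tauSq tail lam) (k : Fin 2) :
    ∃ b : ℕ → ℝ, Tendsto b atTop (𝓝 0) ∧ ∀ p i, noiseWeight m β lam k p i ≤ b p := by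
  obtain ⟨C, hC⟩ := h.tauSq_bdd
  have hC0 : 0 ≤ C := (h.tauSq_pos k 0).le.trans (hC k 0)
  have hτ : Tendsto (fun p : ℕ => C / (p : ℝ)) atTop (𝓝 0) := tendsto_const_div_atTop_nhds_zero_nat C
  set s := ∑ i ∈ Finset.range (m k), sigSq k i with hs
  have hs0 : 0 ≤ s := Finset.sum_nonneg fun i hi => (h.sigSq_pos k i (Finset.mem_range.1 hi)).le
  refine ⟨fun p => C / p + if β k = 1 then 0 else s * ((p : ℝ) ^ β k / p), ?_, fun p i => ?_⟩
  · split_ifs with hβ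
    · simpa using hτ
    · simpa using hτ.add ((h.tendsto_rpow_div hβ).const_mul s)
  · have hp0 : (0 : ℝ) ≤ p := Nat.cast_nonneg _
    have hr : (0 : ℝ) ≤ (p : ℝ) ^ β k := Real.rpow_nonneg hp0 _
    unfold noiseWeight
    beta_reduce
    split_ifs with hi hβ hβ
    · rw [h.nonspike p k i hi.1 (not_lt.1 fun him => hi.2 ⟨hβ, him⟩), add_zero]
      exact div_le_div_of_nonneg_right (hC k i) hp0
    · by_cases him : i < m k
      · rw [h.spike p k i hi.1 him, mul_div_assoc', ← add_div]
        refine div_le_div_of_nonneg_right ?_ hp0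
        have h1 : sigSq k i ≤ s := Finset.single_le_sum (f := fun i => sigSq k i)
          (fun i hi => (h.sigSq_pos k i (Finset.mem_range.1 hi)).le) (Finset.mem_range.2 him)
        nlinarith [hC k i]
      · rw [h.nonspike p k i hi.1 (not_lt.1 him)]
        have h1 := div_le_div_of_nonneg_right (hC k i) hp0
        have h2 : 0 ≤ s * ((p : ℝ) ^ β k / p) := by positivity
        linarith
    · positivity
    · positivity

theorem tendsto_sum_noiseWeight (h : SpikedEigenvalues m β sigSq tauSq tail lam) (k : Fin 2) :
    Tendsto (fun p => ∑ i ∈ Finset.range p, noiseWeight m β lam k p i) atTop (𝓝 (tail k)) := by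
  -- The correction to the average of `tauSq` at a spike: a strong spike loses its `tauSq` term, a
  -- weak one gains its spike. There are `m k` corrections, each tending to 0.
  set c : ℕ → ℕ → ℝ := fun p i =>
    if β k = 1 then -(tauSq k i / p) else sigSq k i * ((p : ℝ) ^ β k / p) with hc
  have hc0 : ∀ i, Tendsto (fun p => c p i) atTop (𝓝 0) := by
    intro i
    simp only [hc]
    split_ifs with hβ
    · simpa using (tendsto_const_div_atTop_nhds_zero_nat (tauSq k i)).neg
    · simpa using (h.tendsto_rpow_div hβ).const_mul (sigSq k i)
  have hlim : Tendsto (fun p : ℕ => (∑ i ∈ Finset.range p, tauSq k i) / p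
      + ∑ i ∈ Finset.range (m k), c p i) atTop (𝓝 (tail k)) := by
    simpa using (h.tauSq_avg k).add (tendsto_finsetSum (Finset.range (m k)) fun i _ => hc0 i)
  refine hlim.congr' ?_
  filter_upwards [eventually_ge_atTop (m k)] with p hp
  have h1 : ∀ i ∈ Finset.range p, noiseWeight m β lam k p i
      = tauSq k i / p + if i < m k then c p i else 0 := by
    intro i hi
    have hip := Finset.mem_range.1 hi
    simp only [noiseWeight, hip, true_and, hc]
    by_cases him : i < m k
    · by_cases hβ : β k = 1
      · simp [him, hβ]
      · simp only [him, hβ, if_true, and_true, not_false_eq_true, if_false, h.spike p k i hip him]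
        ring
    · simp [him, h.nonspike p k i hip (not_lt.1 him)]
  rw [Finset.sum_congr rfl h1, Finset.sum_add_distrib, Finset.sum_div, ← Finset.sum_filter]
  congr 1
  refine Finset.sum_congr ?_ fun _ _ => rfl
  ext i
  simp only [Finset.mem_range, Finset.mem_filter]
  omega

end SpikedEigenvalues

end Weights

/-! ### Second moments of linear functionals of the observations. -/

section Scores

variable {Ω : Type*} {mΩ : MeasurableSpace Ω} {P : Measure Ω} [IsProbabilityMeasure P]

theorem IsTrainingSample.covariance_inner {n : Fin 2 → ℕ} {p : ℕ}
    {X : (k : Fin 2) → Fin (n k) → Ω → Vec p} {mu : Fin 2 → Vec p}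
    {Sig : Fin 2 → Matrix (Fin p) (Fin p) ℝ} (h : IsTrainingSample P X mu Sig) (k : Fin 2)
    (j : Fin (n k)) (a b : Vec p) :
    cov[fun ω => inner ℝ a (X k j ω), fun ω => inner ℝ b (X k j ω); P]
      = inner ℝ a (Matrix.toEuclideanLin (Sig k) b) := by
  have hX : ∀ c, MemLp (fun ω => X k j ω c) 2 P := by
    exact fun c => (h.sqIntegrable k j).eval_piLp c
  have hin : ∀ a : Vec p, (fun ω => inner ℝ a (X k j ω)) = fun ω => ∑ c, a c * X k j ω c := by
    intro a
    ext ω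
    rw [PiLp.inner_apply]
    exact Finset.sum_congr rfl fun c _ => by simp [mul_comm]
  rw [hin a, hin b, covariance_fun_sum_fun_sum (fun c => (hX c).const_mul _)
    (fun c => (hX c).const_mul _), PiLp.inner_apply]
  refine Finset.sum_congr rfl fun c _ => ?_
  simp only [covariance_const_mul_left, covariance_const_mul_right, h.covariance,
    Matrix.toLpLin_apply, Matrix.mulVec, dotProduct]
  simp only [RCLike.inner_apply, conj_trivial]
  rw [Finset.sum_mul]
  exact Finset.sum_congr rfl fun e _ => by ring

theorem IsTrainingSample.integral_inner_sub {n : Fin 2 → ℕ} {p : ℕ}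
    {X : (k : Fin 2) → Fin (n k) → Ω → Vec p} {mu : Fin 2 → Vec p}
    {Sig : Fin 2 → Matrix (Fin p) (Fin p) ℝ} (h : IsTrainingSample P X mu Sig) (k : Fin 2)
    (j : Fin (n k)) (a b : Vec p) :
    ∫ ω, inner ℝ a (X k j ω - mu k) * inner ℝ b (X k j ω - mu k) ∂P
      = inner ℝ a (Matrix.toEuclideanLin (Sig k) b) := by
  rw [← h.covariance_inner k j a b, ProbabilityTheory.covariance]
  have hmean : ∀ a : Vec p, ∫ ω, inner ℝ a (X k j ω) ∂P = inner ℝ a (mu k) := by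
    intro a
    rw [integral_inner ((h.sqIntegrable k j).integrable (by norm_num)), h.mean]
  simp_rw [hmean, inner_sub_right]

end Scores

/-! ### The bulk noise: norms and inner products in mean square. -/

section Bulk

variable {Ω : Type*} {mΩ : MeasurableSpace Ω} {P : Measure Ω}

/-- The data model: training samples with spiked covariances and mixing scores. -/
structure IsSpikedModel (P : Measure Ω) (n m : Fin 2 → ℕ) (β : Fin 2 → ℝ)
    (sigSq tauSq : Fin 2 → ℕ → ℝ) (tail : Fin 2 → ℝ)
    (X : ∀ p : ℕ, (k : Fin 2) → Fin (n k) → Ω → Vec p) (mu : ∀ p : ℕ, Fin 2 → Vec p)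
    (Sig : ∀ p : ℕ, Fin 2 → Matrix (Fin p) (Fin p) ℝ) (lam : ∀ _p : ℕ, Fin 2 → ℕ → ℝ)
    (u : ∀ p : ℕ, Fin 2 → ℕ → Vec p) (z : (k : Fin 2) → Fin (n k) → ℕ → Ω → ℝ) : Prop where
  sample : ∀ p, IsTrainingSample P (X p) (mu p) (Sig p)
  eigen : ∀ p k, IsPopulationEigen (Sig p k) (lam p k) (u p k)
  spiked : SpikedEigenvalues m β sigSq tauSq tail lam
  scores : MixingScores P X mu lam u z

/-- The scaled noise outside the strong spikes, as a function of the scores. -/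
noncomputable def bulkNoise {p : ℕ} (w : ℕ → ℝ) (u : ℕ → Vec p) (z : ℕ → Ω → ℝ) (ω : Ω) : Vec p :=
  ∑ i : Fin p, (√(w i) * z i ω) • u i

namespace IsSpikedModel

variable {n m : Fin 2 → ℕ} {β : Fin 2 → ℝ} {sigSq tauSq : Fin 2 → ℕ → ℝ} {tail : Fin 2 → ℝ}
  {X : ∀ p : ℕ, (k : Fin 2) → Fin (n k) → Ω → Vec p} {mu : ∀ p : ℕ, Fin 2 → Vec p}
  {Sig : ∀ p : ℕ, Fin 2 → Matrix (Fin p) (Fin p) ℝ} {lam : ∀ _p : ℕ, Fin 2 → ℕ → ℝ}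
  {u : ∀ p : ℕ, Fin 2 → ℕ → Vec p} {z : (k : Fin 2) → Fin (n k) → ℕ → Ω → ℝ}

theorem measurable_score (h : IsSpikedModel P n m β sigSq tauSq tail X mu Sig lam u z)
    (k : Fin 2) (j : Fin (n k)) (i : ℕ) : Measurable (z k j i) := by
  have h1 : z k j i = fun ω => (√(lam (i + 1) k i))⁻¹
      * inner ℝ (u (i + 1) k i) (X (i + 1) k j ω - mu (i + 1) k) := by
    ext ω
    rw [h.scores.score (i + 1) k j i ω (Nat.lt_succ_self i)]
  rw [h1]
  exact measurable_const.mul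
    (measurable_const.inner (((h.sample (i + 1)).measurable k j).sub_const _))

/-- In dimension `p` both sides involve only the first `p` scores, which are functions of the two
independent observations. -/
theorem indepFun_bulkNoise (h : IsSpikedModel P n m β sigSq tauSq tail X mu Sig lam u z)
    {q r : Idx n} (hqr : q ≠ r) (p : ℕ) (w : ℕ → ℝ) :
    IndepFun (fun ω (i : Fin p) => z q.1 q.2 i ω)
      (bulkNoise w (u p r.1) (z r.1 r.2)) P := by
  have h1 : ∀ q : Idx n, (fun ω (i : Fin p) => z q.1 q.2 i ω)
      = (fun (x : Vec p) (i : Fin p) => (√(lam p q.1 i))⁻¹ * inner ℝ (u p q.1 i) (x - mu p q.1))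
        ∘ X p q.1 q.2 := by
    intro q
    ext ω i
    exact (h.scores.score p q.1 q.2 i ω i.2).symm
  have h2 : ∀ q : Idx n, Measurable
      fun (x : Vec p) (i : Fin p) => (√(lam p q.1 i))⁻¹ * inner ℝ (u p q.1 i) (x - mu p q.1) :=
    fun q => measurable_pi_lambda _ fun i =>
      measurable_const.mul (measurable_const.inner (measurable_id.sub_const _))
  have h3 : IndepFun (fun ω (i : Fin p) => z q.1 q.2 i ω)
      (fun ω (i : Fin p) => z r.1 r.2 i ω) P := by
    rw [h1 q, h1 r]
    exact ((h.sample p).indep.indepFun hqr).comp (h2 q) (h2 r)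
  have h4 : Measurable fun x : Fin p → ℝ => ∑ i : Fin p, (√(w i) * x i) • u p r.1 i :=
    Finset.measurable_sum _ fun i _ =>
      ((measurable_pi_apply i).const_mul _).smul measurable_const
  exact h3.comp measurable_id h4

theorem norm_sq_bulkNoise (h : IsSpikedModel P n m β sigSq tauSq tail X mu Sig lam u z)
    (k : Fin 2) (j : Fin (n k)) {p : ℕ} {w : ℕ → ℝ} (hw : ∀ i, 0 ≤ w i) (ω : Ω) :
    ‖bulkNoise w (u p k) (z k j) ω‖ ^ 2 = ∑ i ∈ Finset.range p, w i * z k j i ω ^ 2 := by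
  rw [bulkNoise, norm_sq_sum_smul_of_orthonormal (h.eigen p k).1,
    ← Fin.sum_univ_eq_sum_range (fun i => w i * z k j i ω ^ 2)]
  refine Finset.sum_congr rfl fun i _ => ?_
  rw [mul_pow, Real.sq_sqrt (hw i)]

theorem memLp_score_sq (h : IsSpikedModel P n m β sigSq tauSq tail X mu Sig lam u z)
    (k : Fin 2) (j : Fin (n k)) (i : ℕ) : MemLp (fun ω => z k j i ω ^ 2) 2 P := by
  obtain ⟨C, hC⟩ := h.scores.fourth_moment
  rw [memLp_two_iff_integrable_sq ((h.measurable_score k j i).pow_const 2).aestronglyMeasurable]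
  simpa [← pow_mul] using (hC k j i).1

variable [IsProbabilityMeasure P]

theorem memLp_score (h : IsSpikedModel P n m β sigSq tauSq tail X mu Sig lam u z)
    (k : Fin 2) (j : Fin (n k)) (i : ℕ) : MemLp (z k j i) 2 P := by
  have h1 : z k j i = fun ω => (√(lam (i + 1) k i))⁻¹
      * inner ℝ (u (i + 1) k i) (X (i + 1) k j ω - mu (i + 1) k) := by
    ext ω
    rw [h.scores.score (i + 1) k j i ω (Nat.lt_succ_self i)]
  rw [h1]
  exact ((((h.sample (i + 1)).sqIntegrable k j).sub (memLp_const _)).const_inner _).const_mul _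

/-- The population eigenvectors diagonalize the covariance, and `lam` is the normalization, so the
scores are uncorrelated with unit second moment. -/
theorem integral_score_mul_score (h : IsSpikedModel P n m β sigSq tauSq tail X mu Sig lam u z)
    (k : Fin 2) (j : Fin (n k)) {p : ℕ} (a b : Fin p) :
    ∫ ω, z k j a ω * z k j b ω ∂P = if a = b then 1 else 0 := by
  have h1 : ∀ ω, z k j a ω * z k j b ω = ((√(lam p k a))⁻¹ * (√(lam p k b))⁻¹)
      * (inner ℝ (u p k a) (X p k j ω - mu p k) * inner ℝ (u p k b) (X p k j ω - mu p k)) := by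
    intro ω
    rw [← h.scores.score p k j a ω a.2, ← h.scores.score p k j b ω b.2]
    ring
  simp_rw [h1]
  rw [integral_const_mul, (h.sample p).integral_inner_sub, (h.eigen p k).2, real_inner_smul_right,
    orthonormal_iff_ite.1 (h.eigen p k).1]
  split_ifs with hab
  · subst hab
    have hpos := h.spiked.lam_pos a.2 k
    have h2 := Real.mul_self_sqrt hpos.le
    have h3 : √(lam p k a) ≠ 0 := (Real.sqrt_pos.2 hpos).ne'
    field_simp
    rw [sq]
    exact h2.symm
  · simp

theorem memLp_bulkNoise (h : IsSpikedModel P n m β sigSq tauSq tail X mu Sig lam u z)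
    (k : Fin 2) (j : Fin (n k)) {p : ℕ} (w : ℕ → ℝ) (v : ℕ → Vec p) :
    MemLp (bulkNoise w v (z k j)) 2 P := by
  unfold bulkNoise
  refine memLp_finsetSum _ fun i _ => ?_
  exact (ContinuousLinearMap.toSpanSingleton ℝ (v i)).comp_memLp'
    ((h.memLp_score k j i).const_mul (√(w i)))

theorem integral_score_sq (h : IsSpikedModel P n m β sigSq tauSq tail X mu Sig lam u z)
    (k : Fin 2) (j : Fin (n k)) (i : ℕ) : ∫ ω, z k j i ω ^ 2 ∂P = 1 := by
  have := h.integral_score_mul_score k j (p := i + 1) (Fin.last i) (Fin.last i)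
  simpa [sq] using this

theorem integral_sum_mul_score_sq (h : IsSpikedModel P n m β sigSq tauSq tail X mu Sig lam u z)
    (k : Fin 2) (j : Fin (n k)) (p : ℕ) (w : ℕ → ℝ) :
    ∫ ω, ∑ i ∈ Finset.range p, w i * z k j i ω ^ 2 ∂P = ∑ i ∈ Finset.range p, w i := by
  rw [integral_finsetSum _ fun i _ => (h.memLp_score k j i).integrable_sq.const_mul _]
  refine Finset.sum_congr rfl fun i _ => ?_
  rw [integral_const_mul, h.integral_score_sq, mul_one]

theorem integral_norm_sq_bulkNoise (h : IsSpikedModel P n m β sigSq tauSq tail X mu Sig lam u z)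
    (k : Fin 2) (j : Fin (n k)) {p : ℕ} {w : ℕ → ℝ} (hw : ∀ i, 0 ≤ w i) :
    ∫ ω, ‖bulkNoise w (u p k) (z k j) ω‖ ^ 2 ∂P = ∑ i ∈ Finset.range p, w i := by
  simp_rw [h.norm_sq_bulkNoise k j hw]
  exact h.integral_sum_mul_score_sq k j p w

/-- The squared norm of the bulk noise converges in `L²`. -/
theorem tendsto_integral_norm_sq_sub (h : IsSpikedModel P n m β sigSq tauSq tail X mu Sig lam u z)
    (q : Idx n) :
    Tendsto (fun p => ∫ ω, (‖bulkNoise (noiseWeight m β lam q.1 p) (u p q.1) (z q.1 q.2) ω‖ ^ 2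
      - tail q.1) ^ 2 ∂P) atTop (𝓝 0) := by
  obtain ⟨k, j⟩ := q
  obtain ⟨C, hC⟩ := h.scores.fourth_moment
  obtain ⟨perm, hperm⟩ := h.scores.mixing k j
  obtain ⟨b, hb, hwb⟩ := h.spiked.exists_noiseWeight_le k
  have hsum := h.spiked.tendsto_sum_noiseWeight k
  have hV : ∀ i, Var[fun ω => z k j i ω ^ 2; P] ≤ C := by
    intro i
    refine (variance_le_expectation_sq
      ((h.measurable_score k j i).pow_const 2).aestronglyMeasurable).trans ?_
    simpa [← pow_mul] using (hC k j i).2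
  have hvar := tendsto_variance_sum_of_isRhoMixing (φ := fun x => x ^ 2)
    (measurable_id.pow_const 2) (h.memLp_score_sq k j) hV hperm
    (w := noiseWeight m β lam k) (h.spiked.noiseWeight_nonneg k) hb (fun p i _ => hwb p i)
    (hsum.eventually_le_const (lt_add_one _))
  have hlim : Tendsto (fun p => Var[fun ω => ∑ i ∈ Finset.range p,
      noiseWeight m β lam k p i * z k j i ω ^ 2; P]
      + (∑ i ∈ Finset.range p, noiseWeight m β lam k p i - tail k) ^ 2) atTop (𝓝 0) := by
    simpa using hvar.add ((hsum.sub_const (tail k)).pow 2)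
  refine hlim.congr fun p => ?_
  simp only [h.norm_sq_bulkNoise k j (h.spiked.noiseWeight_nonneg k p)]
  have hmem : MemLp (fun ω => ∑ i ∈ Finset.range p,
      noiseWeight m β lam k p i * z k j i ω ^ 2) 2 P :=
    memLp_finsetSum _ fun i _ => (h.memLp_score_sq k j i).const_mul _
  have hmem2 : MemLp (fun ω => (∑ i ∈ Finset.range p,
      noiseWeight m β lam k p i * z k j i ω ^ 2) - tail k) 2 P := hmem.sub (memLp_const _)
  -- The mean square error is the variance, which mixing makes vanish, plus the squared bias, which
  -- vanishes as the total weight tends to `tail k`.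
  have h1 := variance_eq_sub hmem2
  rw [variance_sub_const hmem.aestronglyMeasurable] at h1
  have h2 : ∫ ω, ((∑ i ∈ Finset.range p, noiseWeight m β lam k p i * z k j i ω ^ 2) - tail k) ∂P
      = ∑ i ∈ Finset.range p, noiseWeight m β lam k p i - tail k := by
    rw [integral_sub (hmem.integrable (by norm_num)) (integrable_const _),
      h.integral_sum_mul_score_sq]
    simp
  rw [h2] at h1
  rw [h1]
  simp

theorem integrable_norm_sq_sub (h : IsSpikedModel P n m β sigSq tauSq tail X mu Sig lam u z)
    (q : Idx n) (p : ℕ) :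
    Integrable (fun ω => (‖bulkNoise (noiseWeight m β lam q.1 p) (u p q.1) (z q.1 q.2) ω‖ ^ 2
      - tail q.1) ^ 2) P := by
  have hmem : MemLp (fun ω => (∑ i ∈ Finset.range p,
      noiseWeight m β lam q.1 p i * z q.1 q.2 i ω ^ 2) - tail q.1) 2 P :=
    (memLp_finsetSum _ fun i _ => (h.memLp_score_sq q.1 q.2 i).const_mul _).sub (memLp_const _)
  simp_rw [h.norm_sq_bulkNoise q.1 q.2 (h.spiked.noiseWeight_nonneg q.1 p)]
  exact hmem.integrable_sq

theorem integrable_inner_sq (h : IsSpikedModel P n m β sigSq tauSq tail X mu Sig lam u z)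
    (q : Idx n) {p : ℕ} (w : ℕ → ℝ) {f : Ω → Vec p} (hf : MemLp f 2 P)
    (hind : IndepFun (fun ω (i : Fin p) => z q.1 q.2 i ω) f P) :
    Integrable (fun ω => inner ℝ (bulkNoise w (u p q.1) (z q.1 q.2) ω) (f ω) ^ 2) P :=
  (integral_inner_sum_sq (fun i : Fin p => h.memLp_score q.1 q.2 i)
    (fun a b => h.integral_score_mul_score q.1 q.2 a b) hf hind (fun i => √(w i))).1

/-- The bulk noise is asymptotically orthogonal to independent vectors with bounded second
moment. -/
theorem tendsto_integral_inner_sq (h : IsSpikedModel P n m β sigSq tauSq tail X mu Sig lam u z)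
    (q : Idx n) {f : ∀ p, Ω → Vec p} (hf : ∀ p, MemLp (f p) 2 P)
    (hind : ∀ p, IndepFun (fun ω (i : Fin p) => z q.1 q.2 i ω) (f p) P) {C : ℝ}
    (hC : ∀ᶠ p in atTop, ∫ ω, ‖f p ω‖ ^ 2 ∂P ≤ C) :
    Tendsto (fun p => ∫ ω, inner ℝ (bulkNoise (noiseWeight m β lam q.1 p) (u p q.1)
      (z q.1 q.2) ω) (f p ω) ^ 2 ∂P) atTop (𝓝 0) := by
  obtain ⟨b, hb, hwb⟩ := h.spiked.exists_noiseWeight_le q.1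
  have hlim : Tendsto (fun p => b p * C) atTop (𝓝 0) := by simpa using hb.mul_const C
  refine tendsto_of_tendsto_of_tendsto_of_le_of_le' tendsto_const_nhds hlim
    (Eventually.of_forall fun p => integral_nonneg fun ω => sq_nonneg _) ?_
  filter_upwards [hC] with p hC
  have h1 := integral_inner_sum_sq_le (h.eigen p q.1).1 (fun i : Fin p => h.memLp_score q.1 q.2 i)
    (fun a b => h.integral_score_mul_score q.1 q.2 a b) (hf p) (hind p)
    (c := fun i => √(noiseWeight m β lam q.1 p i)) (b := b p)
    (fun i => by rw [Real.sq_sqrt (h.spiked.noiseWeight_nonneg _ _ _)]; exact hwb p i)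
  refine h1.trans (mul_le_mul_of_nonneg_left hC ?_)
  exact (h.spiked.noiseWeight_nonneg q.1 p 0).trans (hwb p 0)

end IsSpikedModel

end Bulk

/-! ### The component outside the leading space. -/

section Residual

variable {M p : ℕ}

/-- The part of a vector outside the leading eigenspace with orthonormal basis `e`. -/
noncomputable def residual (e : Fin M → Vec p) : Vec p →ₗ[ℝ] Vec p :=
  LinearMap.id - ∑ a, (innerₛₗ ℝ (e a)).smulRight (e a)

theorem inner_residual (e : Fin M → Vec p) (x z : Vec p) :
    inner ℝ (residual e x) z = inner ℝ x z - ∑ a, inner ℝ (e a) x * inner ℝ (e a) z := by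
  simp [residual, inner_sub_left, sum_inner, real_inner_smul_left]

theorem inner_residual_comm (e : Fin M → Vec p) (x z : Vec p) :
    inner ℝ (residual e x) z = inner ℝ (residual e z) x := by
  simp only [inner_residual, real_inner_comm x z, mul_comm]

theorem inner_residual_self_nonneg {e : Fin M → Vec p} (he : Orthonormal ℝ e) (x : Vec p) :
    0 ≤ inner ℝ (residual e x) x := by
  have := he.sum_inner_products_le x (s := Finset.univ)
  rw [inner_residual, real_inner_self_eq_norm_sq, sub_nonneg]
  simpa [sq] using this

theorem residual_eq_zero {e : Fin M → Vec p} (he : Orthonormal ℝ e) {x : Vec p}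
    (hx : x ∈ Submodule.span ℝ (Set.range e)) : residual e x = 0 := by
  have h : Submodule.span ℝ (Set.range e) ≤ LinearMap.ker (residual e) := by
    rw [Submodule.span_le]
    rintro _ ⟨b, rfl⟩
    rw [SetLike.mem_coe, LinearMap.mem_ker]
    simp [residual, orthonormal_iff_ite.1 he]
  exact h hx

end Residual

/-! ### Class centring and the mean difference as linear combinations of the noise. -/

section Centring

variable {n : Fin 2 → ℕ}

/-- The coefficients of the mean difference. -/
noncomputable def meanDiffCoeff (n : Fin 2 → ℕ) (q : Idx n) : ℝ :=
  if q.1 = 0 then (n 0 : ℝ)⁻¹ else -(n 1 : ℝ)⁻¹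

theorem tailGram_comm (tail : Fin 2 → ℝ) (q r : Idx n) : tailGram tail q r = tailGram tail r q := by
  unfold tailGram
  by_cases h : q.1 = r.1
  · simp [h, eq_comm]
  · simp [h, Ne.symm h]

theorem tailGram_eq_mul (tail : Fin 2 → ℝ) (q r : Idx n) :
    tailGram tail q r = tail q.1 * tailGram (fun _ => 1) q r := by
  unfold tailGram
  split_ifs <;> simp

theorem isClassCentred_tailGram (hn : ∀ k, 0 < n k) (tail : Fin 2 → ℝ) (q : Idx n) :
    IsClassCentred (tailGram tail q) := by
  intro k
  obtain ⟨l, j⟩ := q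
  by_cases h : l = k
  · subst h
    have : (n l : ℝ) ≠ 0 := by exact_mod_cast (hn l).ne'
    simp [tailGram, ← Finset.mul_sum, Finset.sum_sub_distrib, this]
  · simp [tailGram, h]

theorem sum_tailGram_smul {V : Type*} [AddCommGroup V] [Module ℝ V] (x : Idx n → V) (q : Idx n) :
    ∑ r, tailGram (fun _ => 1) q r • x r = x q - (n q.1 : ℝ)⁻¹ • ∑ j, x ⟨q.1, j⟩ := by
  obtain ⟨k, j⟩ := q
  rw [Fintype.sum_sigma, Finset.sum_eq_single k]
  · simp [tailGram, sub_smul, Finset.sum_sub_distrib, Finset.smul_sum]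
  · intro l _ hl
    refine Finset.sum_eq_zero fun j' _ => ?_
    simp [tailGram, Ne.symm hl]
  · simp

/-- Centring removes any shift that is constant on the classes, so the population means may be
subtracted beforehand. -/
theorem centredObs_eq_sum {p : ℕ} (hn : ∀ k, 0 < n k) (x : (k : Fin 2) → Fin (n k) → Vec p)
    (c : Fin 2 → Vec p) (q : Idx n) :
    centredObs x q = ∑ r, tailGram (fun _ => 1) q r • (x r.1 r.2 - c r.1) := by
  have : (n q.1 : ℝ) ≠ 0 := by exact_mod_cast (hn q.1).ne'
  rw [sum_tailGram_smul (fun r : Idx n => x r.1 r.2 - c r.1), centredObs, classMean]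
  simp only [Finset.sum_sub_distrib, Finset.sum_const, Finset.card_univ, Fintype.card_fin,
    smul_sub, ← Nat.cast_smul_eq_nsmul ℝ, smul_smul, inv_mul_cancel₀ this, one_smul]
  abel

theorem meanDiff_eq_add_sum {p : ℕ} (hn : ∀ k, 0 < n k) (x : (k : Fin 2) → Fin (n k) → Vec p)
    (c : Fin 2 → Vec p) :
    meanDiff x = c 0 - c 1 + ∑ r, meanDiffCoeff n r • (x r.1 r.2 - c r.1) := by
  have h0 : (n 0 : ℝ) ≠ 0 := by exact_mod_cast (hn 0).ne'
  have h1 : (n 1 : ℝ) ≠ 0 := by exact_mod_cast (hn 1).ne'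
  have hs0 : ∑ j, meanDiffCoeff n ⟨0, j⟩ • (x 0 j - c 0) = (n 0 : ℝ)⁻¹ • ∑ j, x 0 j - c 0 := by
    simp [meanDiffCoeff, ← Finset.smul_sum, ← Nat.cast_smul_eq_nsmul ℝ, smul_sub, smul_smul, h0]
  have hs1 : ∑ j, meanDiffCoeff n ⟨1, j⟩ • (x 1 j - c 1) = c 1 - (n 1 : ℝ)⁻¹ • ∑ j, x 1 j := by
    have : ∀ j, meanDiffCoeff n ⟨1, j⟩ = -(n 1 : ℝ)⁻¹ := fun j => by simp [meanDiffCoeff]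
    simp_rw [this, ← Finset.smul_sum]
    simp [← Nat.cast_smul_eq_nsmul ℝ, smul_sub, smul_smul, h1]
    abel
  rw [Fintype.sum_sigma, Fin.sum_univ_two, hs0, hs1, meanDiff, classMean, classMean]
  abel

/-- Class means are orthogonal to within-class deviations: the coefficients of `d` and the tails are
constant on each class. This yields `cross`. -/
theorem sum_meanDiffCoeff_mul (tail : Fin 2 → ℝ) {a : Idx n → ℝ} (ha : IsClassCentred a) :
    ∑ q, meanDiffCoeff n q * a q * tail q.1 = 0 := by
  rw [Fintype.sum_sigma]
  refine Finset.sum_eq_zero fun k _ => ?_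
  have h : ∀ j, meanDiffCoeff n ⟨k, j⟩ * a ⟨k, j⟩ * tail k
      = ((if k = 0 then (n 0 : ℝ)⁻¹ else -(n 1 : ℝ)⁻¹) * tail k) * a ⟨k, j⟩ := by
    intro j; simp only [meanDiffCoeff]; ring
  simp_rw [h, ← Finset.mul_sum, ha k, mul_zero]

/-- The limiting squared size of the bulk noise in `d`; its positivity is the source of `resid`. -/
theorem sum_meanDiffCoeff_sq_pos (hn : ∀ k, 0 < n k) {tail : Fin 2 → ℝ} (ht : ∀ k, 0 < tail k) :
    0 < ∑ q, meanDiffCoeff n q * meanDiffCoeff n q * tail q.1 := by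
  refine Finset.sum_pos (fun q _ => ?_) ⟨⟨0, ⟨0, hn 0⟩⟩, Finset.mem_univ _⟩
  have : meanDiffCoeff n q ≠ 0 := by
    have h0 : (n 0 : ℝ) ≠ 0 := by exact_mod_cast (hn 0).ne'
    have h1 : (n 1 : ℝ) ≠ 0 := by exact_mod_cast (hn 1).ne'
    unfold meanDiffCoeff
    split_ifs <;> simp [h0, h1]
  exact mul_pos (mul_self_pos.2 this) (ht _)

end Centring

/-! ### From limits of the noise to the limiting Gram matrix. -/

section Assembly

variable {n : Fin 2 → ℕ} {tail : Fin 2 → ℝ} {M : ℕ} {N : ℕ → ℕ} {e : ∀ s, Fin M → Vec (N s)}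
  {f : ∀ s, Idx n → Vec (N s)}

theorem tendsto_inner_residual_sum
    (h : ∀ q r, Tendsto (fun s => inner ℝ (residual (e s) (f s q)) (f s r)) atTop
      (𝓝 (if q = r then tail q.1 else 0))) (a b : Idx n → ℝ) :
    Tendsto (fun s => inner ℝ (residual (e s) (∑ q, a q • f s q)) (∑ q, b q • f s q)) atTop
      (𝓝 (∑ q, a q * b q * tail q.1)) := by
  have h1 : Tendsto (fun s => ∑ q, ∑ r, a q * b r * inner ℝ (residual (e s) (f s q)) (f s r)) atTop
      (𝓝 (∑ q, ∑ r, a q * b r * if q = r then tail q.1 else 0)) :=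
    tendsto_finsetSum _ fun q _ => tendsto_finsetSum _ fun r _ => (h q r).const_mul _
  have h2 : ∑ q, ∑ r, a q * b r * (if q = r then tail q.1 else 0) = ∑ q, a q * b q * tail q.1 := by
    simp
  rw [← h2]
  refine h1.congr fun s => ?_
  simp only [map_sum, map_smul, sum_inner, inner_sum, real_inner_smul_left, real_inner_smul_right,
    mul_assoc]
  rw [Finset.sum_comm]
  exact Finset.sum_congr rfl fun q _ => Finset.sum_congr rfl fun r _ => mul_left_comm _ _ _

/-- The limiting Gram matrix of observations `x = c + √N f` with class centres `c`. -/
theorem hasGramLimit_of_noise (hn : ∀ k, 0 < n k) (ht : ∀ k, 0 < tail k)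
    {x : ∀ s, (k : Fin 2) → Fin (n k) → Vec (N s)} {c : ∀ s, Fin 2 → Vec (N s)}
    (hf : ∀ s q, f s q = (√(N s : ℝ))⁻¹ • (x s q.1 q.2 - c s q.1)) {F : Fin M → Idx n → ℝ}
    (he : ∀ᶠ s in atTop, Orthonormal ℝ (e s))
    (hF : ∀ a q, Tendsto (fun s => inner ℝ (e s a) (f s q)) atTop (𝓝 (F a q)))
    (hres : ∀ q r, Tendsto (fun s => inner ℝ (residual (e s) (f s q)) (f s r)) atTop
      (𝓝 (if q = r then tail q.1 else 0)))
    (hc : ∀ q, Tendsto (fun s => inner ℝ (residual (e s) (f s q))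
      ((√(N s : ℝ))⁻¹ • (c s 0 - c s 1))) atTop (𝓝 0))
    (hB : ∃ B, ∀ᶠ s in atTop, ‖(√(N s : ℝ))⁻¹ • (c s 0 - c s 1)‖ ≤ B) :
    HasGramLimit tail (fun s q => (√(N s : ℝ))⁻¹ • centredObs (x s) q) e
      (fun s => (√(N s : ℝ))⁻¹ • meanDiff (x s))
      (fun a q => ∑ r, tailGram (fun _ => 1) q r * F a r) := by
  set ν : ∀ s, Vec (N s) := fun s => (√(N s : ℝ))⁻¹ • (c s 0 - c s 1) with hν
  have hy : ∀ s q, (√(N s : ℝ))⁻¹ • centredObs (x s) q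
      = ∑ r, tailGram (fun _ => 1) q r • f s r := by
    intro s q
    simp only [centredObs_eq_sum hn (x s) (c s), Finset.smul_sum, hf]
    exact Finset.sum_congr rfl fun r _ => smul_comm _ _ _
  have hd : ∀ s, (√(N s : ℝ))⁻¹ • meanDiff (x s) = ν s + ∑ r, meanDiffCoeff n r • f s r := by
    intro s
    simp only [meanDiff_eq_add_sum hn (x s) (c s), smul_add, Finset.smul_sum, hf, hν]
    congr 1
    exact Finset.sum_congr rfl fun r _ => smul_comm _ _ _
  have hlin : ∀ (b : Idx n → ℝ) (a : Fin M), Tendsto (fun s => inner ℝ (e s a) (∑ r, b r • f s r))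
      atTop (𝓝 (∑ r, b r * F a r)) := by
    intro b a
    simp only [inner_sum, real_inner_smul_right]
    exact tendsto_finsetSum _ fun r _ => (hF a r).const_mul _
  have hcν : ∀ b : Idx n → ℝ, Tendsto (fun s => inner ℝ (residual (e s) (ν s))
      (∑ r, b r • f s r)) atTop (𝓝 0) := by
    intro b
    simp only [inner_sum, real_inner_smul_right]
    have : Tendsto (fun s => ∑ r, b r * inner ℝ (residual (e s) (ν s)) (f s r)) atTop
        (𝓝 (∑ r, b r * 0)) :=
      tendsto_finsetSum _ fun r _ => ((hc r).congr fun s => inner_residual_comm _ _ _).const_mul _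
    simpa using this
  have hprod : ∀ (b b' : Idx n → ℝ), Tendsto (fun s => inner ℝ (∑ r, b r • f s r)
      (∑ r, b' r • f s r)) atTop
      (𝓝 (∑ a, (∑ r, b r * F a r) * (∑ r, b' r * F a r) + ∑ q, b q * b' q * tail q.1)) := by
    intro b b'
    have h1 := (tendsto_finsetSum Finset.univ fun a _ => (hlin b a).mul (hlin b' a)).add
      (tendsto_inner_residual_sum hres b b')
    refine h1.congr fun s => ?_
    rw [inner_residual]
    ring
  simp only [hy, hd]
  refine ⟨he, fun s k => ?_, fun a q => hlin _ a, fun q r => ?_, fun q => ?_, ?_, ?_⟩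
  · rw [← Finset.sum_congr rfl fun j _ => hy s ⟨k, j⟩, ← Finset.smul_sum, sum_centredObs hn,
      smul_zero]
  · have h1 := hprod (tailGram (fun _ => 1) q) (tailGram (fun _ => 1) r)
    -- The centring projection is idempotent and commutes with the class-constant tails.
    have h2 : ∑ t, tailGram (fun _ => 1) q t * tailGram (fun _ => 1) r t * tail t.1
        = tailGram tail q r := by
      have h3 := sum_tailGram_mul (fun _ => 1) (isClassCentred_tailGram hn tail r) q
      rw [tailGram_comm tail q r, ← one_mul (tailGram tail r q), ← h3]
      refine Finset.sum_congr rfl fun t _ => ?_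
      rw [tailGram_comm tail r t, tailGram_eq_mul tail t r, tailGram_comm _ t r]
      ring
    rwa [h2] at h1
  · have h1 := (hcν (tailGram (fun _ => 1) q)).add
      (tendsto_inner_residual_sum hres (meanDiffCoeff n) (tailGram (fun _ => 1) q))
    rw [sum_meanDiffCoeff_mul tail (isClassCentred_tailGram hn _ q), add_zero] at h1
    refine h1.congr fun s => ?_
    rw [← inner_residual, map_add, inner_add_left]
  · obtain ⟨B, hB⟩ := hB
    have h1 := hprod (meanDiffCoeff n) (meanDiffCoeff n)
    obtain ⟨C, hC⟩ := h1.bddAbove_range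
    refine ⟨B + (C + 1), ?_⟩
    filter_upwards [hB] with s hs
    refine (norm_add_le _ _).trans (add_le_add hs ?_)
    have h2 := hC ⟨s, rfl⟩
    simp only [real_inner_self_eq_norm_sq] at h2
    nlinarith [sq_nonneg (‖∑ r, meanDiffCoeff n r • f s r‖ - 1)]
  -- With `d = ν + g`, the residual form of `d` is that of `ν`, which is nonnegative, plus a cross
  -- term tending to 0, plus that of `g`, with a positive limit.
  · have h1 := ((hcν (meanDiffCoeff n)).const_mul 2).add
      (tendsto_inner_residual_sum hres (meanDiffCoeff n) (meanDiffCoeff n))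
    have hpos := sum_meanDiffCoeff_sq_pos hn ht
    rw [mul_zero, zero_add] at h1
    refine ⟨_, half_pos hpos, ?_⟩
    filter_upwards [h1.eventually_const_le (half_lt_self hpos), he] with s hs hes
    have h2 := inner_residual_self_nonneg hes (ν s)
    set g := ∑ r, meanDiffCoeff n r • f s r with hg
    have h3 := inner_residual (e s) (ν s + g) (ν s + g)
    rw [real_inner_self_eq_norm_sq] at h3
    simp only [← sq] at h3
    rw [← h3, map_add, inner_add_left, inner_add_right, inner_add_right,
      inner_residual_comm _ g (ν s)]
    linarith

end Assembly

/-! ### Splitting the observations into bulk noise and strong spikes. -/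

section Decomposition

variable {Ω : Type*} {mΩ : MeasurableSpace Ω} {P : Measure Ω}

open Classical in
/-- The number of spikes of class `k` that are of the order of the dimension. -/
noncomputable def strongCount (m : Fin 2 → ℕ) (β : Fin 2 → ℝ) (k : Fin 2) : ℕ :=
  if β k = 1 then m k else 0

theorem lt_strongCount {m : Fin 2 → ℕ} {β : Fin 2 → ℝ} {k : Fin 2} {i : ℕ} :
    i < strongCount m β k ↔ β k = 1 ∧ i < m k := by
  unfold strongCount
  split_ifs with h <;> simp [h]

theorem strongCount_le (m : Fin 2 → ℕ) (β : Fin 2 → ℝ) (k : Fin 2) : strongCount m β k ≤ m k := by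
  unfold strongCount
  split_ifs <;> simp

/-- The bulk noise of the observation `q`. -/
noncomputable abbrev bulkObs {n : Fin 2 → ℕ} (m : Fin 2 → ℕ) (β : Fin 2 → ℝ)
    (lam : ∀ _p : ℕ, Fin 2 → ℕ → ℝ) (u : ∀ p : ℕ, Fin 2 → ℕ → Vec p)
    (z : (k : Fin 2) → Fin (n k) → ℕ → Ω → ℝ) (p : ℕ) (q : Idx n) (ω : Ω) : Vec p :=
  bulkNoise (noiseWeight m β lam q.1 p) (u p q.1) (z q.1 q.2) ω

/-- The scaled noise of the observation `q` along the strong spikes. -/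
noncomputable def spikeObs {n : Fin 2 → ℕ} (m : Fin 2 → ℕ) (β : Fin 2 → ℝ)
    (lam : ∀ _p : ℕ, Fin 2 → ℕ → ℝ) (u : ∀ p : ℕ, Fin 2 → ℕ → Vec p)
    (z : (k : Fin 2) → Fin (n k) → ℕ → Ω → ℝ) (p : ℕ) (q : Idx n) (ω : Ω) : Vec p :=
  ∑ i ∈ Finset.range (strongCount m β q.1), (√(lam p q.1 i / p) * z q.1 q.2 i ω) • u p q.1 i

/-- The limiting coordinates of the noise in the common leading eigenspace, where `R k i` are the
coordinates of the leading eigenvectors. -/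
noncomputable def spikeCoord {n : Fin 2 → ℕ} {M : ℕ} (m : Fin 2 → ℕ) (β : Fin 2 → ℝ)
    (sigSq : Fin 2 → ℕ → ℝ) (R : Fin 2 → ℕ → Fin M → ℝ)
    (z : (k : Fin 2) → Fin (n k) → ℕ → Ω → ℝ) (ω : Ω) (a : Fin M) (q : Idx n) : ℝ :=
  ∑ i ∈ Finset.range (strongCount m β q.1), √(sigSq q.1 i) * z q.1 q.2 i ω * R q.1 i a

variable {n m : Fin 2 → ℕ} {β : Fin 2 → ℝ} {sigSq tauSq : Fin 2 → ℕ → ℝ} {tail : Fin 2 → ℝ}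
  {X : ∀ p : ℕ, (k : Fin 2) → Fin (n k) → Ω → Vec p} {mu : ∀ p : ℕ, Fin 2 → Vec p}
  {Sig : ∀ p : ℕ, Fin 2 → Matrix (Fin p) (Fin p) ℝ} {lam : ∀ _p : ℕ, Fin 2 → ℕ → ℝ}
  {u : ∀ p : ℕ, Fin 2 → ℕ → Vec p} {z : (k : Fin 2) → Fin (n k) → ℕ → Ω → ℝ}

theorem SpikedEigenvalues.tendsto_sqrt_lam_div
    (h : SpikedEigenvalues m β sigSq tauSq tail lam) {k : Fin 2} {i : ℕ}
    (hi : i < strongCount m β k) :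
    Tendsto (fun p : ℕ => √(lam p k i / p)) atTop (𝓝 (√(sigSq k i))) := by
  obtain ⟨hβ, him⟩ := lt_strongCount.1 hi
  refine (Real.continuous_sqrt.tendsto _).comp ?_
  have h1 : Tendsto (fun p : ℕ => sigSq k i + tauSq k i / p) atTop (𝓝 (sigSq k i)) := by
    simpa using (tendsto_const_div_atTop_nhds_zero_nat (tauSq k i)).const_add (sigSq k i)
  refine h1.congr' ?_
  filter_upwards [eventually_gt_atTop i] with p hp
  have hp0 : (p : ℝ) ≠ 0 := by exact_mod_cast (by omega : p ≠ 0)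
  rw [h.spike p k i hp him, hβ, Real.rpow_one]
  field_simp

namespace IsSpikedModel

/-- The scaled and centred observations split into bulk noise and strong spikes. -/
theorem inv_sqrt_smul_sub (h : IsSpikedModel P n m β sigSq tauSq tail X mu Sig lam u z)
    {p : ℕ} (q : Idx n) (hp : m q.1 ≤ p) (ω : Ω) :
    (√(p : ℝ))⁻¹ • (X p q.1 q.2 ω - mu p q.1)
      = bulkObs m β lam u z p q ω + spikeObs m β lam u z p q ω := by
  obtain ⟨k, j⟩ := q
  dsimp only at hp ⊢
  have h1 : ∀ i < p, (√(p : ℝ))⁻¹ * inner ℝ (u p k i) (X p k j ω - mu p k)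
      = √(lam p k i / p) * z k j i ω := by
    intro i hi
    have hl : √(lam p k i) ≠ 0 := (Real.sqrt_pos.2 (h.spiked.lam_pos hi k)).ne'
    rw [← h.scores.score p k j i ω hi, Real.sqrt_div (h.spiked.lam_pos hi k).le]
    field_simp
  -- The noise weight is 0 exactly at the strong spikes, so each index is counted once.
  have h2 : ∀ i ∈ Finset.range p, (√(lam p k i / p) * z k j i ω) • u p k i
      = (√(noiseWeight m β lam k p i) * z k j i ω) • u p k i
        + if i < strongCount m β k then (√(lam p k i / p) * z k j i ω) • u p k i else 0 := by
    intro i hi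
    have hip := Finset.mem_range.1 hi
    by_cases hs : i < strongCount m β k
    · have hs' := lt_strongCount.1 hs
      simp [noiseWeight, hs, hs']
    · have hs' := fun h => hs (lt_strongCount.2 h)
      rw [noiseWeight, if_pos ⟨hip, hs'⟩, if_neg hs, add_zero]
  rw [← sum_inner_smul_of_orthonormal (h.eigen p k).1 (X p k j ω - mu p k), Finset.smul_sum]
  simp_rw [smul_smul]
  rw [Finset.sum_congr rfl fun (i : Fin p) _ => by rw [h1 i i.2],
    Fin.sum_univ_eq_sum_range (fun i => (√(lam p k i / p) * z k j i ω) • u p k i),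
    Finset.sum_congr rfl h2, Finset.sum_add_distrib, ← Finset.sum_filter, bulkObs, bulkNoise,
    Fin.sum_univ_eq_sum_range (fun i => (√(noiseWeight m β lam k p i) * z k j i ω) • u p k i),
    spikeObs]
  congr 1
  refine Finset.sum_congr ?_ fun _ _ => rfl
  ext i
  have := strongCount_le m β k
  simp only [Finset.mem_range, Finset.mem_filter]
  omega

end IsSpikedModel

theorem spikeObs_mem_commonLeadingSpace (p : ℕ) (q : Idx n) (ω : Ω) :
    spikeObs m β lam u z p q ω ∈ commonLeadingSpace m β (u p) := by
  refine Submodule.sum_mem _ fun i hi => Submodule.smul_mem _ _ (Submodule.subset_span ?_)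
  obtain ⟨hβ, him⟩ := lt_strongCount.1 (Finset.mem_range.1 hi)
  exact ⟨q.1, i, hβ, him, rfl⟩

/-- The limiting Gram matrix of the scaled data along a sequence of dimensions. -/
theorem IsSpikedModel.hasGramLimit (h : IsSpikedModel P n m β sigSq tauSq tail X mu Sig lam u z)
    (hn : ∀ k, 0 < n k) {δ : ℝ} (hδ : MeanDifferenceScale mu δ) {N : ℕ → ℕ}
    (hN : Tendsto N atTop atTop) {M : ℕ} {e : ∀ p, Fin M → Vec p}
    (he : ∀ᶠ p in atTop, Orthonormal ℝ (e p) ∧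
      Submodule.span ℝ (Set.range (e p)) = commonLeadingSpace m β (u p))
    {R : Fin 2 → ℕ → Fin M → ℝ} (hR : ∀ k i a, i < strongCount m β k →
      Tendsto (fun s => inner ℝ (e (N s) a) (u (N s) k i)) atTop (𝓝 (R k i a))) {ω : Ω}
    (hself : ∀ q, Tendsto (fun s => ‖bulkObs m β lam u z (N s) q ω‖ ^ 2) atTop (𝓝 (tail q.1)))
    (hcross : ∀ q r, q ≠ r → Tendsto (fun s => inner ℝ (bulkObs m β lam u z (N s) q ω)
      (bulkObs m β lam u z (N s) r ω)) atTop (𝓝 0))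
    (hlead : ∀ q a, Tendsto (fun s => inner ℝ (bulkObs m β lam u z (N s) q ω) (e (N s) a))
      atTop (𝓝 0))
    (hmean : ∀ q, Tendsto (fun s => inner ℝ (bulkObs m β lam u z (N s) q ω)
      ((√(N s : ℝ))⁻¹ • muDiff mu (N s))) atTop (𝓝 0)) :
    HasGramLimit tail (fun s q => (√(N s : ℝ))⁻¹ • centredObs (fun k j => X (N s) k j ω) q)
      (fun s => e (N s)) (fun s => (√(N s : ℝ))⁻¹ • meanDiff (fun k j => X (N s) k j ω))
      (fun a q => ∑ r, tailGram (fun _ => 1) q r * spikeCoord m β sigSq R z ω a r) := by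
  have heN := hN.eventually he
  have hm : ∀ᶠ s in atTop, ∀ k, m k ≤ N s :=
    eventually_all.2 fun k => hN.eventually (eventually_ge_atTop (m k))
  -- The strong spikes lie in the leading space, so only the bulk noise survives in the residual.
  have hdec : ∀ᶠ s in atTop, ∀ q : Idx n,
      residual (e (N s)) ((√(N s : ℝ))⁻¹ • (X (N s) q.1 q.2 ω - mu (N s) q.1))
        = residual (e (N s)) (bulkObs m β lam u z (N s) q ω) := by
    filter_upwards [heN, hm] with s hs hms q
    have hz : residual (e (N s)) (spikeObs m β lam u z (N s) q ω) = 0 :=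
      residual_eq_zero hs.1 (hs.2 ▸ spikeObs_mem_commonLeadingSpace _ _ _)
    rw [h.inv_sqrt_smul_sub q (hms q.1), map_add, hz, add_zero]
  have hlead' : ∀ q a, Tendsto (fun s => inner ℝ (e (N s) a) (bulkObs m β lam u z (N s) q ω))
      atTop (𝓝 0) := fun q a => (hlead q a).congr fun s => real_inner_comm _ _
  have hnorm : Tendsto (fun s => ‖(√(N s : ℝ))⁻¹ • muDiff mu (N s)‖) atTop (𝓝 δ) := by
    refine (hδ.2.comp hN).congr fun s => ?_
    rw [norm_smul, norm_inv, Real.norm_of_nonneg (Real.sqrt_nonneg _), Function.comp_apply]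
    ring
  refine hasGramLimit_of_noise (f := fun s q => (√(N s : ℝ))⁻¹ • (X (N s) q.1 q.2 ω - mu (N s) q.1))
    (c := fun s => mu (N s)) hn h.spiked.tail_pos (fun s q => rfl) (heN.mono fun s hs => hs.1)
    (fun a q => ?_) (fun q r => ?_) (fun q => ?_) ⟨δ + 1, hnorm.eventually_le_const (lt_add_one δ)⟩
  · have h1 : Tendsto (fun s => inner ℝ (e (N s) a) (bulkObs m β lam u z (N s) q ω)
        + ∑ i ∈ Finset.range (strongCount m β q.1), √(lam (N s) q.1 i / N s) * z q.1 q.2 i ω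
          * inner ℝ (e (N s) a) (u (N s) q.1 i)) atTop
        (𝓝 (0 + spikeCoord m β sigSq R z ω a q)) := by
      refine (hlead' q a).add (tendsto_finsetSum _ fun i hi => ?_)
      have hi' := Finset.mem_range.1 hi
      exact (((h.spiked.tendsto_sqrt_lam_div hi').comp hN).mul_const _).mul (hR q.1 i a hi')
    rw [zero_add] at h1
    refine h1.congr' ?_
    filter_upwards [hm] with s hms
    rw [h.inv_sqrt_smul_sub q (hms q.1), inner_add_right, spikeObs, inner_sum]
    simp only [real_inner_smul_right]
  · have h1 : Tendsto (fun s => inner ℝ (bulkObs m β lam u z (N s) q ω)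
        (bulkObs m β lam u z (N s) r ω) - ∑ a, inner ℝ (e (N s) a) (bulkObs m β lam u z (N s) q ω)
          * inner ℝ (e (N s) a) (bulkObs m β lam u z (N s) r ω)) atTop
        (𝓝 ((if q = r then tail q.1 else 0) - ∑ _a : Fin M, (0 * 0 : ℝ))) := by
      refine Tendsto.sub ?_ (tendsto_finsetSum _ fun a _ => (hlead' q a).mul (hlead' r a))
      split_ifs with hqr
      · subst hqr
        exact (hself q).congr fun s => (real_inner_self_eq_norm_sq _).symm
      · exact hcross q r hqr
    simp only [mul_zero, Finset.sum_const_zero, sub_zero] at h1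
    refine h1.congr' ?_
    filter_upwards [hdec] with s hs
    rw [← inner_residual, hs q, inner_residual_comm _ _ ((√(N s : ℝ))⁻¹ • _), hs r,
      inner_residual_comm]
  · have h1 : Tendsto (fun s => inner ℝ (bulkObs m β lam u z (N s) q ω)
        ((√(N s : ℝ))⁻¹ • muDiff mu (N s))
        - ∑ a, inner ℝ (e (N s) a) (bulkObs m β lam u z (N s) q ω)
          * inner ℝ (e (N s) a) ((√(N s : ℝ))⁻¹ • muDiff mu (N s))) atTop
        (𝓝 (0 - ∑ _a : Fin M, (0 : ℝ))) := by
      refine (hmean q).sub (tendsto_finsetSum _ fun a _ => ?_)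
      -- Boundedness of the leading coordinates of the scaled mean difference suffices, since the
      -- other factor tends to 0.
      refine (hlead' q a).zero_mul_isBoundedUnder_le ⟨δ + 1, ?_⟩
      rw [eventually_map]
      filter_upwards [hnorm.eventually_le_const (lt_add_one δ), heN] with s hs hes
      refine (norm_inner_le_norm _ _).trans ?_
      rwa [hes.1.1 a, one_mul]
    simp only [Finset.sum_const_zero, sub_zero] at h1
    refine h1.congr' ?_
    filter_upwards [hdec] with s hs
    rw [← inner_residual, hs q]
    rfl

end Decomposition

/-! ### Extraction of subsequences. -/

section Subsequence

variable {Ω : Type*} {mΩ : MeasurableSpace Ω} {P : Measure Ω}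

/-- Nonnegative random variables whose expectations vanish in the limit converge to zero almost
surely along a subsequence. -/
theorem exists_seq_forall_tendsto_ae {ι : Type*} [Fintype ι] {g : ι → ℕ → Ω → ℝ}
    (hint : ∀ i p, Integrable (g i p) P) (hnn : ∀ i p ω, 0 ≤ g i p ω)
    (hlim : ∀ i, Tendsto (fun p => ∫ ω, g i p ω ∂P) atTop (𝓝 0)) {N : ℕ → ℕ}
    (hN : Tendsto N atTop atTop) :
    ∃ φ : ℕ → ℕ, StrictMono φ ∧
      ∀ᵐ ω ∂P, ∀ i, Tendsto (fun s => g i (N (φ s)) ω) atTop (𝓝 0) := by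
  have hW : ∀ p, Integrable (fun ω => ∑ i, g i p ω) P := fun p =>
    integrable_finsetSum _ fun i _ => hint i p
  have h1 : Tendsto (fun p => ∫ ω, ∑ i, g i p ω ∂P) atTop (𝓝 0) := by
    have h2 : Tendsto (fun p => ∑ i, ∫ ω, g i p ω ∂P) atTop (𝓝 (∑ _i : ι, (0 : ℝ))) :=
      tendsto_finsetSum _ fun i _ => hlim i
    rw [Finset.sum_const_zero] at h2
    exact h2.congr fun p => (integral_finsetSum _ fun i _ => hint i p).symm
  -- The sum of the nonnegative variables dominates each of them, so one subsequence of the sum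
  -- serves all indices.
  have hmeas : TendstoInMeasure P (fun p ω => ∑ i, g i p ω) atTop (fun _ => 0) := by
    refine tendstoInMeasure_of_tendsto_eLpNorm one_ne_zero
      (fun p => (hW p).aestronglyMeasurable) aestronglyMeasurable_const ?_
    have h3 : ∀ p, eLpNorm ((fun ω => ∑ i, g i p ω) - fun _ => 0) 1 P
        = ENNReal.ofReal (∫ ω, ∑ i, g i p ω ∂P) := by
      intro p
      have hz : ((fun ω => ∑ i, g i p ω) - fun _ => 0) = fun ω => ∑ i, g i p ω := sub_zero _
      rw [hz, eLpNorm_one_eq_lintegral_enorm, ← ofReal_integral_norm_eq_lintegral_enorm (hW p)]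
      congr 1
      refine integral_congr_ae (Eventually.of_forall fun ω => ?_)
      simpa using Finset.sum_nonneg fun i _ => hnn i p ω
    simp_rw [h3]
    simpa using ENNReal.tendsto_ofReal h1
  obtain ⟨φ, hφ, hae⟩ := (hmeas.comp hN).exists_seq_tendsto_ae
  refine ⟨φ, hφ, ?_⟩
  filter_upwards [hae] with ω hω i
  exact squeeze_zero (fun s => hnn i _ ω)
    (fun s => Finset.single_le_sum (fun i _ => hnn i _ ω) (Finset.mem_univ i)) hω

/-- Along a subsequence, the coordinates of the leading eigenvectors converge. -/
theorem exists_seq_tendsto_inner {m : Fin 2 → ℕ} {u : ∀ p : ℕ, Fin 2 → ℕ → Vec p} {M : ℕ}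
    {e : ∀ p, Fin M → Vec p} (hu : ∀ p k, Orthonormal ℝ fun i : Fin p => u p k i)
    (he : ∀ᶠ p in atTop, Orthonormal ℝ (e p)) {N : ℕ → ℕ} (hN : Tendsto N atTop atTop) :
    ∃ (φ : ℕ → ℕ) (R : Fin 2 → ℕ → Fin M → ℝ), StrictMono φ ∧ ∀ k i a, i < m k →
      Tendsto (fun s => inner ℝ (e (N (φ s)) a) (u (N (φ s)) k i)) atTop (𝓝 (R k i a)) := by
  let v : ℕ → ((k : Fin 2) × Fin (m k)) → Fin M → ℝ := fun s t a =>
    inner ℝ (e (N s) a) (u (N s) t.1 t.2)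
  -- Inner products of unit vectors are at most 1 in absolute value, so Bolzano-Weierstrass applies
  -- to the finitely many coordinates.
  have hv : ∀ᶠ s in atTop, v s ∈ Metric.closedBall 0 1 := by
    have hm : ∀ᶠ s in atTop, ∀ k, m k ≤ N s :=
      eventually_all.2 fun k => hN.eventually (eventually_ge_atTop (m k))
    filter_upwards [hN.eventually he, hm] with s hs hms
    rw [mem_closedBall_zero_iff, pi_norm_le_iff_of_nonneg zero_le_one]
    intro t
    rw [pi_norm_le_iff_of_nonneg zero_le_one]
    intro a
    refine (norm_inner_le_norm _ _).trans ?_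
    rw [hs.1 a, (hu (N s) t.1).1 ⟨t.2, t.2.2.trans_le (hms t.1)⟩, one_mul]
  obtain ⟨l, -, φ, hφ, hl⟩ :=
    tendsto_subseq_of_frequently_bounded Metric.isBounded_closedBall hv.frequently
  refine ⟨φ, fun k i a => if hi : i < m k then l ⟨k, ⟨i, hi⟩⟩ a else 0, hφ, fun k i a hi => ?_⟩
  simp only [dif_pos hi]
  exact tendsto_pi_nhds.1 (tendsto_pi_nhds.1 hl ⟨k, ⟨i, hi⟩⟩) a

end Subsequence

/-! ### Almost sure limits of the bulk noise along a subsequence. -/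

section Bulk

variable {Ω : Type*} {mΩ : MeasurableSpace Ω} {P : Measure Ω} [IsProbabilityMeasure P]
  {n m : Fin 2 → ℕ} {β : Fin 2 → ℝ} {sigSq tauSq : Fin 2 → ℕ → ℝ} {tail : Fin 2 → ℝ}
  {X : ∀ p : ℕ, (k : Fin 2) → Fin (n k) → Ω → Vec p} {mu : ∀ p : ℕ, Fin 2 → Vec p}
  {Sig : ∀ p : ℕ, Fin 2 → Matrix (Fin p) (Fin p) ℝ} {lam : ∀ _p : ℕ, Fin 2 → ℕ → ℝ}
  {u : ∀ p : ℕ, Fin 2 → ℕ → Vec p} {z : (k : Fin 2) → Fin (n k) → ℕ → Ω → ℝ}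

/-- The bulk noise is asymptotically orthogonal to deterministic vectors of bounded norm. -/
theorem IsSpikedModel.tendsto_integral_inner_const_sq
    (h : IsSpikedModel P n m β sigSq tauSq tail X mu Sig lam u z) (q : Idx n) {v : ∀ p, Vec p}
    {C : ℝ} (hC : ∀ᶠ p in atTop, ‖v p‖ ^ 2 ≤ C) :
    Tendsto (fun p => ∫ ω, inner ℝ (bulkObs m β lam u z p q ω) (v p) ^ 2 ∂P) atTop (𝓝 0) := by
  refine h.tendsto_integral_inner_sq q (f := fun p _ => v p) (fun p => memLp_const _)
    (fun p => indepFun_const_right _ _) (C := C) ?_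
  simpa using hC

/-- Along a subsequence, the bulk noise almost surely has the limiting inner products. -/
theorem IsSpikedModel.exists_seq_tendsto_bulkObs
    (h : IsSpikedModel P n m β sigSq tauSq tail X mu Sig lam u z) {M : ℕ} {e : ∀ p, Fin M → Vec p}
    (he : ∀ᶠ p in atTop, Orthonormal ℝ (e p)) {v : ∀ p, Vec p} {C : ℝ}
    (hC : ∀ᶠ p in atTop, ‖v p‖ ^ 2 ≤ C) {N : ℕ → ℕ} (hN : Tendsto N atTop atTop) :
    ∃ φ : ℕ → ℕ, StrictMono φ ∧ ∀ᵐ ω ∂P,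
      (∀ q, Tendsto (fun s => ‖bulkObs m β lam u z (N (φ s)) q ω‖ ^ 2) atTop (𝓝 (tail q.1))) ∧
      (∀ q r, q ≠ r → Tendsto (fun s => inner ℝ (bulkObs m β lam u z (N (φ s)) q ω)
        (bulkObs m β lam u z (N (φ s)) r ω)) atTop (𝓝 0)) ∧
      (∀ q a, Tendsto (fun s => inner ℝ (bulkObs m β lam u z (N (φ s)) q ω) (e (N (φ s)) a))
        atTop (𝓝 0)) ∧
      (∀ q, Tendsto (fun s => inner ℝ (bulkObs m β lam u z (N (φ s)) q ω) (v (N (φ s))))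
        atTop (𝓝 0)) := by
  classical
  -- All squared deviations in one finite family, so that a single subsequence and a single null set
  -- suffice.
  let g : (Idx n × Idx n) ⊕ (Idx n × Fin M) ⊕ Idx n → ℕ → Ω → ℝ := Sum.elim
    (fun t p ω => if t.1 = t.2 then (‖bulkObs m β lam u z p t.1 ω‖ ^ 2 - tail t.1.1) ^ 2
      else inner ℝ (bulkObs m β lam u z p t.1 ω) (bulkObs m β lam u z p t.2 ω) ^ 2)
    (Sum.elim (fun t p ω => inner ℝ (bulkObs m β lam u z p t.1 ω) (e p t.2) ^ 2)
      fun q p ω => inner ℝ (bulkObs m β lam u z p q ω) (v p) ^ 2)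
  have hmem : ∀ p (r : Idx n), MemLp (bulkObs m β lam u z p r) 2 P := fun p r =>
    h.memLp_bulkNoise _ _ _ _
  have hbd : ∀ r : Idx n, ∀ᶠ p in atTop, ∫ ω, ‖bulkObs m β lam u z p r ω‖ ^ 2 ∂P
      ≤ tail r.1 + 1 := by
    intro r
    filter_upwards [(h.spiked.tendsto_sum_noiseWeight r.1).eventually_le_const (lt_add_one _)]
      with p hp
    rwa [h.integral_norm_sq_bulkNoise r.1 r.2 (h.spiked.noiseWeight_nonneg r.1 p)]
  obtain ⟨φ, hφ, hae⟩ := exists_seq_forall_tendsto_ae (P := P) (g := g) (fun i p => by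
      rcases i with t | t | q
      · by_cases ht : t.1 = t.2
        · simpa [g, ht] using h.integrable_norm_sq_sub t.2 p
        · simpa [g, ht] using h.integrable_inner_sq t.1 _ (hmem p t.2)
            (h.indepFun_bulkNoise ht p _)
      · exact h.integrable_inner_sq t.1 _ (memLp_const _) (indepFun_const_right _ _)
      · exact h.integrable_inner_sq q _ (memLp_const _) (indepFun_const_right _ _))
    (fun i p ω => by
      rcases i with t | t | q
      · by_cases ht : t.1 = t.2
        · simpa [g, ht] using sq_nonneg _
        · simpa [g, ht] using sq_nonneg _
      · exact sq_nonneg _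
      · exact sq_nonneg _)
    (fun i => by
      rcases i with t | t | q
      · by_cases ht : t.1 = t.2
        · simpa [g, ht] using h.tendsto_integral_norm_sq_sub t.2
        · simpa [g, ht] using h.tendsto_integral_inner_sq t.1 (fun p => hmem p t.2)
            (fun p => h.indepFun_bulkNoise ht p _) (hbd t.2)
      · refine h.tendsto_integral_inner_const_sq t.1 (C := 1) ?_
        filter_upwards [he] with p hp
        rw [hp.1 t.2, one_pow]
      · exact h.tendsto_integral_inner_const_sq q hC) hN
  have hsq : ∀ {a : ℕ → ℝ}, Tendsto (fun s => a s ^ 2) atTop (𝓝 0) → Tendsto a atTop (𝓝 0) := by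
    intro a ha
    have h1 := (Real.continuous_sqrt.tendsto 0).comp ha
    simp only [Function.comp_def, Real.sqrt_sq_eq_abs, Real.sqrt_zero] at h1
    exact (tendsto_zero_iff_abs_tendsto_zero _).2 h1
  refine ⟨φ, hφ, ?_⟩
  filter_upwards [hae] with ω hω
  refine ⟨fun q => ?_, fun q r hqr => hsq ?_, fun q a => hsq (hω (Sum.inr (Sum.inl (q, a)))),
    fun q => hsq (hω (Sum.inr (Sum.inr q)))⟩
  · have h1 := hω (Sum.inl (q, q))
    simp only [g, Sum.elim_inl, if_true] at h1
    simpa using (hsq h1).add_const (tail q.1)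
  · simpa [g, hqr] using hω (Sum.inl (q, r))

end Bulk

/-! ### The limiting leading coordinates: dependence on the data and rank. -/

section Spikes

variable {Ω : Type*} {mΩ : MeasurableSpace Ω} {P : Measure Ω}
  {n m : Fin 2 → ℕ} {β : Fin 2 → ℝ} {sigSq tauSq : Fin 2 → ℕ → ℝ} {tail : Fin 2 → ℝ}
  {X : ∀ p : ℕ, (k : Fin 2) → Fin (n k) → Ω → Vec p} {mu : ∀ p : ℕ, Fin 2 → Vec p}
  {Sig : ∀ p : ℕ, Fin 2 → Matrix (Fin p) (Fin p) ℝ} {lam : ∀ _p : ℕ, Fin 2 → ℕ → ℝ}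
  {u : ∀ p : ℕ, Fin 2 → ℕ → Vec p} {z : (k : Fin 2) → Fin (n k) → ℕ → Ω → ℝ} {M : ℕ}

/-- The limiting coordinates of the class-centred noise in the common leading eigenspace. -/
noncomputable def centredCoord (m : Fin 2 → ℕ) (β : Fin 2 → ℝ)
    (sigSq : Fin 2 → ℕ → ℝ) (R : Fin 2 → ℕ → Fin M → ℝ)
    (z : (k : Fin 2) → Fin (n k) → ℕ → Ω → ℝ) (ω : Ω) (a : Fin M) (q : Idx n) : ℝ :=
  ∑ r, tailGram (fun _ => 1) q r * spikeCoord m β sigSq R z ω a r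

/-- The coordinates of `spikeCoord` as linear functionals of the observations in a fixed
dimension. -/
noncomputable def spikeFunctional {p : ℕ} (m : Fin 2 → ℕ) (β : Fin 2 → ℝ)
    (sigSq : Fin 2 → ℕ → ℝ) (R : Fin 2 → ℕ → Fin M → ℝ) (lam : Fin 2 → ℕ → ℝ)
    (u : Fin 2 → ℕ → Vec p) (k : Fin 2) : Vec p →ₗ[ℝ] (Fin M → ℝ) :=
  LinearMap.pi fun a => ∑ i ∈ Finset.range (strongCount m β k),
    (√(sigSq k i) * (√(lam k i))⁻¹ * R k i a) • innerₛₗ ℝ (u k i)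

/-- The limit involves only finitely many scores per observation, and these do not depend on the
dimension. It can thus be read off from the data in one fixed dimension, where the law is absolutely
continuous and almost sure purity applies. -/
theorem IsSpikedModel.leadingCoord_spikeFunctional
    (h : IsSpikedModel P n m β sigSq tauSq tail X mu Sig lam u z) (hn : ∀ k, 0 < n k)
    (R : Fin 2 → ℕ → Fin M → ℝ) {p : ℕ} (hp : ∀ k, m k ≤ p) (ω : Ω) :
    leadingCoord (spikeFunctional m β sigSq R (lam p) (u p)) (fun q : Idx n => X p q.1 q.2 ω)
      = centredCoord m β sigSq R z ω := by
  ext a q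
  rw [leadingCoord, centredObs_eq_sum hn _ (mu p), map_sum, Finset.sum_apply, centredCoord]
  refine Finset.sum_congr rfl fun r _ => ?_
  rw [map_smul, Pi.smul_apply, smul_eq_mul]
  by_cases hqr : q.1 = r.1
  · rw [hqr]
    congr 1
    simp only [spikeFunctional, spikeCoord, LinearMap.pi_apply, LinearMap.sum_apply,
      LinearMap.smul_apply, smul_eq_mul, innerₛₗ_apply_apply]
    refine Finset.sum_congr rfl fun i hi => ?_
    have hi' := (lt_strongCount.1 (Finset.mem_range.1 hi)).2
    rw [← h.scores.score p r.1 r.2 i ω (hi'.trans_le (hp _))]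
    ring
  · simp [tailGram, hqr]

theorem hasRankBound_dim (G : Fin M → Idx n → ℝ) : HasRankBound G M :=
  ⟨LinearMap.pi fun b => ∑ q, G b q • LinearMap.proj q, fun a ha b => by
    simpa using congrFun ha b⟩

/-- The functional `a ↦ ∑ j, z k j i a°_{kj}`, where `a°` are the class-centred coefficients. -/
noncomputable def scoreFunctional (z : (k : Fin 2) → Fin (n k) → ℕ → Ω → ℝ) (ω : Ω) (k : Fin 2)
    (i : ℕ) : (Idx n → ℝ) →ₗ[ℝ] ℝ :=
  ∑ j, z k j i ω • ∑ q, tailGram (fun _ => 1) q ⟨k, j⟩ • LinearMap.proj q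

theorem scoreFunctional_apply (z : (k : Fin 2) → Fin (n k) → ℕ → Ω → ℝ) (ω : Ω) (k : Fin 2)
    (i : ℕ) (a : Idx n → ℝ) : scoreFunctional z ω k i a
      = ∑ j, z k j i ω * ∑ q, tailGram (fun _ => 1) q ⟨k, j⟩ * a q := by
  simp [scoreFunctional]

/-- Only one score functional per strong spike enters, which gives the rank bounds. -/
theorem sum_centredCoord_mul (m : Fin 2 → ℕ) (β : Fin 2 → ℝ) (sigSq : Fin 2 → ℕ → ℝ)
    (R : Fin 2 → ℕ → Fin M → ℝ) (z : (k : Fin 2) → Fin (n k) → ℕ → Ω → ℝ) (ω : Ω) (b : Fin M)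
    (a : Idx n → ℝ) : ∑ q, centredCoord m β sigSq R z ω b q * a q
      = ∑ k, ∑ i ∈ Finset.range (strongCount m β k),
        √(sigSq k i) * R k i b * scoreFunctional z ω k i a := by
  have h1 : ∑ q, centredCoord m β sigSq R z ω b q * a q
      = ∑ r, spikeCoord m β sigSq R z ω b r * ∑ q, tailGram (fun _ => 1) q r * a q := by
    simp_rw [centredCoord, Finset.sum_mul, Finset.mul_sum]
    rw [Finset.sum_comm]
    exact Finset.sum_congr rfl fun r _ => Finset.sum_congr rfl fun q _ => by ring
  rw [h1, Fintype.sum_sigma]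
  refine Finset.sum_congr rfl fun k _ => ?_
  simp_rw [scoreFunctional_apply, spikeCoord, Finset.sum_mul]
  rw [Finset.sum_comm]
  refine Finset.sum_congr rfl fun i _ => ?_
  rw [Finset.mul_sum]
  exact Finset.sum_congr rfl fun j _ => by ring

theorem hasRankBound_centredCoord (m : Fin 2 → ℕ) (β : Fin 2 → ℝ) (sigSq : Fin 2 → ℕ → ℝ)
    (R : Fin 2 → ℕ → Fin M → ℝ) (z : (k : Fin 2) → Fin (n k) → ℕ → Ω → ℝ) (ω : Ω) :
    HasRankBound (centredCoord m β sigSq R z ω) (strongCount m β 0 + strongCount m β 1) := by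
  refine ⟨LinearMap.pi (Fin.addCases (fun i => scoreFunctional z ω 0 i)
    fun i => scoreFunctional z ω 1 i), fun a ha b => ?_⟩
  rw [sum_centredCoord_mul, Fin.sum_univ_two, Finset.sum_eq_zero, Finset.sum_eq_zero, add_zero]
  · intro i hi
    have := congrFun ha (Fin.natAdd _ ⟨i, Finset.mem_range.1 hi⟩)
    simp only [LinearMap.pi_apply, Fin.addCases_right, Pi.zero_apply] at this
    rw [this, mul_zero]
  · intro i hi
    have := congrFun ha (Fin.castAdd _ ⟨i, Finset.mem_range.1 hi⟩)
    simp only [LinearMap.pi_apply, Fin.addCases_left, Pi.zero_apply] at this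
    rw [this, mul_zero]

/-- Centring acts within classes, so coefficients that vanish on class 0 make the score functionals
of class 0 vanish. -/
theorem hasClassOneRankBound_centredCoord (m : Fin 2 → ℕ) (β : Fin 2 → ℝ) (sigSq : Fin 2 → ℕ → ℝ)
    (R : Fin 2 → ℕ → Fin M → ℝ) (z : (k : Fin 2) → Fin (n k) → ℕ → Ω → ℝ) (ω : Ω) :
    HasClassOneRankBound (centredCoord m β sigSq R z ω) (strongCount m β 1) := by
  refine ⟨LinearMap.pi fun i => scoreFunctional z ω 1 i, fun a ha0 ha b => ?_⟩
  rw [sum_centredCoord_mul, Fin.sum_univ_two, Finset.sum_eq_zero, Finset.sum_eq_zero, add_zero]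
  · intro i hi
    have := congrFun ha ⟨i, Finset.mem_range.1 hi⟩
    simp only [LinearMap.pi_apply, Pi.zero_apply] at this
    rw [this, mul_zero]
  · intro i _
    rw [scoreFunctional_apply, Finset.sum_eq_zero, mul_zero]
    intro j _
    rw [Finset.sum_eq_zero, mul_zero]
    rintro ⟨l, j'⟩ _
    by_cases hl : l = 0
    · subst hl
      rw [ha0, mul_zero]
    · simp [tailGram, hl]

/-- Outside of `signalIndices`, the sample eigenvalues have the limits `tail 0` and `tail 1`. -/
theorem exists_rank_le_of_notMem_signalIndices (n : Fin 2 → ℕ) {m : Fin 2 → ℕ} (β tail : Fin 2 → ℝ)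
    (dimU : ℕ) (hm : ∀ k, 1 ≤ m k) :
    ∃ ρ, (ρ = dimU ∨ ρ = strongCount m β 0 + strongCount m β 1) ∧
      ∀ i, i + 1 ∉ signalIndices n m β tail dimU →
        ρ ≤ i ∧ (i + 1 < n 0 ∨ n 0 + strongCount m β 1 ≤ i + 1 ∨ tail 0 = tail 1) := by
  have hm1 := hm 1
  unfold signalIndices strongCount
  by_cases h0 : β 0 = 1 <;> by_cases h1 : β 1 = 1 <;> by_cases ht : tail 0 = tail 1
  · refine ⟨dimU, Or.inl rfl, fun i hi => ?_⟩
    simp [h0, h1, ht] at hi ⊢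
    omega
  · by_cases hd : dimU = m 0
    · refine ⟨dimU, Or.inl rfl, fun i hi => ?_⟩
      simp [h0, h1, ht, hd] at hi ⊢
      omega
    · refine ⟨_, Or.inr rfl, fun i hi => ?_⟩
      simp [h0, h1, ht, hd] at hi ⊢
      omega
  -- If class 1 has no strong spikes, the window starting at `n 0` is empty and the alternatives `i
  -- + 1 < n 0`, `n 0 ≤ i + 1` are exhaustive; otherwise the window is part of the index set or the
  -- tails agree.
  all_goals
    refine ⟨_, Or.inr rfl, fun i hi => ?_⟩
    simp [h0, h1, ht] at hi ⊢ <;> omega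

end Spikes

end RidgePiling

theorem mainTheorem9 {Ω : Type*} [MeasurableSpace Ω] (P : Measure Ω) [IsProbabilityMeasure P]
    -- sample sizes, numbers of spikes, and the parameters of the covariance models
    (n m : Fin 2 → ℕ) (β : Fin 2 → ℝ) (sigSq tauSq : Fin 2 → ℕ → ℝ) (tail : Fin 2 → ℝ) (δ : ℝ)
    (dimU : ℕ)
    -- training data, population means, covariances, their eigen-decompositions, and scores
    (X : ∀ p : ℕ, (k : Fin 2) → Fin (n k) → Ω → RidgePiling.Vec p)
    (mu : ∀ p : ℕ, Fin 2 → RidgePiling.Vec p)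
    (Sig : ∀ p : ℕ, Fin 2 → Matrix (Fin p) (Fin p) ℝ)
    (lam : ∀ _p : ℕ, Fin 2 → ℕ → ℝ) (u : ∀ p : ℕ, Fin 2 → ℕ → RidgePiling.Vec p)
    (z : (k : Fin 2) → Fin (n k) → ℕ → Ω → ℝ)
    (hsample : ∀ p, RidgePiling.IsTrainingSample P (X p) (mu p) (Sig p))
    (heigen : ∀ p k, RidgePiling.IsPopulationEigen (Sig p k) (lam p k) (u p k))
    (hsize : ∀ k, m k < n k)
    (h1 : RidgePiling.MeanDifferenceScale mu δ)
    (h2 : RidgePiling.SpikedEigenvalues m β sigSq tauSq tail lam)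
    (h3 : RidgePiling.MixingScores P X mu lam u z)
    (h4 : RidgePiling.LeadingAngles m mu u)
    (h5 : RidgePiling.CommonLeadingBasis m β dimU mu u)
    (htail : tail 1 ≤ tail 0)
    -- an eigen-decomposition of the within-class scatter matrix
    (lamhat : ∀ p : ℕ, Ω → Fin p → ℝ) (uhat : ∀ p : ℕ, Ω → Fin p → RidgePiling.Vec p)
    (huhat_meas : ∀ p i, Measurable fun ω => uhat p ω i)
    (huhat : ∀ p ω, RidgePiling.IsEigenDecomposition
      (RidgePiling.withinScatter fun k j => X p k j ω) (lamhat p ω) (uhat p ω))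
    -- the maximal data piling direction
    (wMDP : ∀ p : ℕ, Ω → RidgePiling.Vec p) (hwMDP_meas : ∀ p, Measurable (wMDP p))
    (hwMDP : ∀ᶠ p in atTop, ∀ᵐ ω ∂P,
      RidgePiling.IsMaximalDataPiling (fun k j => X p k j ω) (wMDP p ω))
    -- the ridge parameter
    (α : ℝ) (hα0 : α ≠ -tail 0) (hα1 : α ≠ -tail 1)
    (hα : ∀ᶠ p in atTop, ∀ᵐ ω ∂P, RidgePiling.RidgeDefined (n 0 + n 1) α (lamhat p ω)) :
    TendstoInMeasure P
      (fun p ω => RidgePiling.angleToSubspace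
        (RidgePiling.ridgeDirection (n 0 + n 1) α (lamhat p ω) (uhat p ω)
          (RidgePiling.meanDiff fun k j => X p k j ω))
        (RidgePiling.signalSubspace (RidgePiling.signalIndices n m β tail dimU)
          (uhat p ω) (wMDP p ω)))
      atTop (fun _ => 0) := by
  have hmodel : RidgePiling.IsSpikedModel P n m β sigSq tauSq tail X mu Sig lam u z :=
    ⟨hsample, heigen, h2, h3⟩
  obtain ⟨e, he, -, -⟩ := h5
  have hn : ∀ k, 0 < n k := fun k => (Nat.zero_le _).trans_lt (hsize k)
  have heon : ∀ᶠ p in atTop, Orthonormal ℝ (e p) := he.mono fun p hp => hp.1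
  have hmuB : ∀ᶠ p : ℕ in atTop,
      ‖(√(p : ℝ))⁻¹ • RidgePiling.muDiff mu p‖ ^ 2 ≤ δ ^ 2 + 1 := by
    filter_upwards [(h1.2.pow 2).eventually_le_const (lt_add_one _)] with p hp
    rwa [norm_smul, norm_inv, Real.norm_of_nonneg (Real.sqrt_nonneg _), ← div_eq_inv_mul]
  obtain ⟨ρ, hρ, hD⟩ := RidgePiling.exists_rank_le_of_notMem_signalIndices n β tail dimU h2.m_pos
  -- Convergence in probability amounts to almost sure convergence along a further subsequence of
  -- every subsequence. The first extraction fixes the deterministic limits `R`, the second gives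
  -- the almost sure limits of the bulk noise.
  refine (exists_seq_tendstoInMeasure_atTop_iff fun p =>
    (RidgePiling.measurable_angle_ridgeDirection (hsample p).measurable (huhat_meas p) (huhat p)
      (hwMDP_meas p) _ _ _).aestronglyMeasurable).2 fun ns hns => ?_
  obtain ⟨φ, R, hφ, hR⟩ := RidgePiling.exists_seq_tendsto_inner (m := m)
    (fun p k => (heigen p k).1) heon hns.tendsto_atTop
  obtain ⟨ψ, hψ, hae⟩ := hmodel.exists_seq_tendsto_bulkObs heon hmuB
    (hns.tendsto_atTop.comp hφ.tendsto_atTop)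
  refine ⟨φ ∘ ψ, hφ.comp hψ, ?_⟩
  have hN : Tendsto (fun s => ns (φ (ψ s))) atTop atTop :=
    hns.tendsto_atTop.comp (hφ.tendsto_atTop.comp hψ.tendsto_atTop)
  obtain ⟨p₀, hp₀⟩ := eventually_atTop.1 hwMDP
  have hw : ∀ᵐ ω ∂P, ∀ p ≥ p₀,
      RidgePiling.IsMaximalDataPiling (fun k j => X p k j ω) (wMDP p ω) :=
    ae_all_iff.2 fun p => by
      by_cases hp : p₀ ≤ p
      · exact (hp₀ p hp).mono fun ω hω _ => hω
      · exact Eventually.of_forall fun ω h => absurd h hp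
  have hm : ∀ k, m k ≤ m 0 + m 1 := by
    intro k
    fin_cases k <;> simp
  -- Purity is taken in the single dimension `m 0 + m 1`, large enough to contain all spikes; as `R`
  -- is deterministic, this costs one null set.
  filter_upwards [hae, hw, RidgePiling.ae_isPureAt (hsample (m 0 + m 1))
    (RidgePiling.spikeFunctional m β sigSq R (lam _) (u _)) htail] with ω hω hwω hpure
  rw [hmodel.leadingCoord_spikeFunctional hn R hm ω] at hpure
  have hgram := hmodel.hasGramLimit hn h1 hN he (R := R) (fun k i a hi =>
    (hR k i a (RidgePiling.lt_strongCount.1 hi).2).comp hψ.tendsto_atTop)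
    hω.1 hω.2.1 hω.2.2.1 hω.2.2.2
  refine hgram.tendsto_angle hn htail (h2.tail_pos 1) hpure (ρ := ρ) ?_
    (RidgePiling.hasClassOneRankBound_centredCoord m β sigSq R z ω) (fun i _ hi => hD i hi)
    hα0 hα1 (fun s => huhat _ ω) ?_ (hN.eventually_gt_atTop 0)
  · rcases hρ with rfl | rfl
    · exact RidgePiling.hasRankBound_dim _
    · exact RidgePiling.hasRankBound_centredCoord m β sigSq R z ω
  · exact (hN.eventually_ge_atTop p₀).mono fun s hs => hwω _ hs
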